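/- Let $\mathbb F_q$ be a finite field of characteristic $\ne 2$ and fix a non-square $\delta\in\mathbb F_q^*$. Consider one of the series $B_n$ ($M=2n+1$), $C_n$ or $D_n$ ($M=2n$). Number the rows and columns of $M\times M$ matrices by $I=\{n>\dots>1>0>-1>\dots>-n\}$ for $B_n$, and by $I=\{n>\dots>1>-1>\dots>-n\}$ for $C_n$ and $D_n$. Let $X^\dagger=\Phi X^t\Phi^{-1}$, where $\Phi$ is the antidiagonal matrix with all entries $\Phi_{i,-i}=1$ for $B_n$, $D_n$, and with $\Phi_{i,-i}=1$ for $i>0$, $\Phi_{i,-i}=-1$ for $i<0$ for $C_n$. Let $I=\bigsqcup_k I_k$ be a partition of $I$ into consecutive segments, numbered compatibly with the order of $I$ and symmetric about zero, $I_{-k}=-I_k$ ($I_0$ may be empty for $C_n$, $D_n$). *Contraction.* Let $\mathfrak p$ be the algebra of block upper triangular $M\times M$ matrices for this partition, $\mathcal U_+$ the ideal of strictly block upper triangular ones, and $\mathcal U_-$ the space of strictly block lower triangular ones, identified with $\mathcal U_+^*$ by $\lambda(x)=\operatorname{tr}(\lambda x)$. Let $\mathfrak{gl}^a(M)=\mathfrak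 p\oplus\mathcal U_-^a$ be the associative algebra in which $\mathfrak p$ has the matrix multiplication, $\mathcal U_-^a=\mathcal U_-$ has zero multiplication, and $(t\lambda)(x)=\lambda(xt)$, $(\lambda t)(x)=\lambda(tx)$ for $t\in\mathfrak p$, $\lambda\in\mathcal U_-^a$, $x\in\mathcal U_+$. Let $\mathbf G^a$ be its group of invertible elements (the parabolic contraction of $\mathrm{GL}(M)$). The map $X\mapsto X^\dagger$ is an involutive antiautomorphism of $\mathfrak{gl}^a(M)$. Put $\mathfrak u^a=\{X\in\mathcal U_+\oplus\mathcal U_-^a:\ X^\dagger=-X\}$. The group $\mathbf G^a$ acts on $\mathfrak u^a$ by $g\centerdot X=gXg^\dagger$ and on $(\mathfrak u^a)^*$ by $(g\centerdot\Lambda)(X)=\Lambda(g^\dagger Xg)$. *Basic pairs.* For $\gamma=(i,j)\in I\times I$ put $\gamma'=(-j,-i)$. Let $\Delta$ be the set of pairs $(i,j)$, $i\neq j$, with $i+j>0$ and, for $C_n$ only, also those with $i+j=0$ (these represent the roots of the orthogonal or symplectic group). Let $\Delta(\mathfrak u^a)$ be the set of $(i,j)\in\Delta$ with $i,j$ in different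 segments. For $\gamma\in\Delta(\mathfrak u^a)$ the root vector $\mathcal E_\gamma\in\mathfrak u^a$ is $E_\gamma$ if $\gamma=\gamma'$ and otherwise $E_\gamma\pm E_{\gamma'}$, with the sign for which it lies in $\mathfrak u^a$; these vectors form a basis of $\mathfrak u^a$, and $\mathcal E_\gamma^*$ denotes the dual basis. A rook placement is a subset $D\subset\Delta(\mathfrak u^a)$ such that every row and every column contains at most one pair of $D\cup D'$, $D'=\{\gamma':\gamma\in D\}$. For a rook placement $D$ and $\phi:D\to\mathbb F_q^*$ put $\Lambda_{D,\phi}=\sum_{\gamma\in D}\phi(\gamma)\mathcal E_\gamma^*$. The pair $(D,\phi)$ is *basic* if: for $B_n$, $D_n$, $\phi$ is identically $1$; for $C_n$, (1) $\phi(\gamma)\in\{1,\delta\}$ for all $\gamma$, (2) $\phi(\gamma)=\delta$ implies that $\gamma$ is antidiagonal, i.e. $\gamma=(i,-i)$, and (3) for every $k$ the set $D\cap(I_k\times I_{-k})$ consists of antidiagonal pairs and contains at most one $\gamma$ with $\phi(\gamma)=\delta$. *Weyl group.* Let $W_{\mathbf L}$ be the group of permutations of $I$ that preserve every segment $I_k$.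 Conjugation $X\mapsto\dot wX\dot w^\dagger$ by the permutation matrix $\dot w$ of $w\in W_{\mathbf L}$ permutes the root vectors up to sign, and so defines an action of $W_{\mathbf L}$ on $\Delta(\mathfrak u^a)$: $w\centerdot(i,j)$ is the one of the pairs $(w(i),-w(-j))$ and $(w(-j),-w(i))$ that lies in $\Delta$. Correspondingly $w\centerdot(D,\phi)=(w\centerdot D,\ \phi\circ w^{-1})$, i.e. the value of $\phi$ is carried along with each root. **Proposition.** 1) Each $\mathbf G^a$-orbit in $(\mathfrak u^a)^*$ contains an element of the form $\Lambda_{D,\phi}$ for some basic pair $(D,\phi)$. 2) For basic pairs $(D,\phi)$ and $(D',\phi')$, the elements $\Lambda_{D,\phi}$ and $\Lambda_{D',\phi'}$ belong to a common $\mathbf G^a$-orbit if and only if $(D,\phi)$ and $(D',\phi')$ belong to a common $W_{\mathbf L}$-orbit. -/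

import Mathlib

noncomputable section

namespace ParabolicContraction

/-- The classical series `B_n` (orthogonal, `M = 2n+1`), `C_n` (symplectic, `M = 2n`) and
`D_n` (orthogonal, `M = 2n`). -/
inductive Series
  | B
  | C
  | D
  deriving DecidableEq

/-- The set `I` that numbers rows and columns: `[-n, n]` for `B_n`, and `[-n, n] \ {0}` for `C_n`
and `D_n`. Rows and columns are listed in decreasing order, so an entry `(i, j)` lies above the
diagonal when `i > j`. -/
def idxSet (s : Series) (n : ℕ) : Finset ℤ :=
  (Finset.Icc (-(n : ℤ)) n).filter fun i => s = Series.B ∨ i ≠ 0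

abbrev Idx (s : Series) (n : ℕ) : Type := {i : ℤ // i ∈ idxSet s n}

theorem neg_mem_idxSet {s : Series} {n : ℕ} {i : ℤ} (hi : i ∈ idxSet s n) : -i ∈ idxSet s n := by
  simp only [idxSet, Finset.mem_filter, Finset.mem_Icc] at hi ⊢
  refine ⟨⟨by omega, by omega⟩, ?_⟩
  rcases hi.2 with h | h
  · exact Or.inl h
  · exact Or.inr (by omega)

/-- The index `-i`. -/
def opp {s : Series} {n : ℕ} (i : Idx s n) : Idx s n := ⟨-i.1, neg_mem_idxSet i.2⟩

@[simp] theorem opp_val {s : Series} {n : ℕ} (i : Idx s n) : (opp i).1 = -i.1 := rfl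

@[simp] theorem opp_opp {s : Series} {n : ℕ} (i : Idx s n) : opp (opp i) = i :=
  Subtype.ext (neg_neg i.1)

/-- `i ↦ -i` as a permutation of `I`. -/
def oppEquiv (s : Series) (n : ℕ) : Equiv.Perm (Idx s n) := ⟨opp, opp, opp_opp, opp_opp⟩

/-- A partition of `I` into consecutive segments that is symmetric about zero:
`blk i` is the number `k` of the segment `I_k` containing `i`, so `I_k = {i | blk i = k}`.
Segments are numbered compatibly with the order on `I`, and `I_{-k} = -I_k`.
A segment (in particular `I_0`, in the series `C` and `D`) may be empty. -/
structure SymmetricPartition (s : Series) (n : ℕ) where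
  blk : Idx s n → ℤ
  mono : Monotone blk
  blk_opp : ∀ i, blk (opp i) = -blk i

variable {s : Series} {n : ℕ}

/-- `0` on the positions of the (block upper triangular) parabolic subalgebra,
`1` on the positions of the complementary nilpotent subalgebra. -/
def SymmetricPartition.deg (P : SymmetricPartition s n) (i j : Idx s n) : ℕ :=
  if P.blk i < P.blk j then 1 else 0

/-- The underlying vector space of the algebra `gl^a(M)`: all `M × M` matrices. -/
def ContractedAlgebra (F : Type*) (_P : SymmetricPartition s n) : Type _ :=
  Matrix (Idx s n) (Idx s n) F

section Algebra

variable {F : Type*} [Field F] {P : SymmetricPartition s n}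

instance : AddCommGroup (ContractedAlgebra F P) :=
  inferInstanceAs (AddCommGroup (Matrix (Idx s n) (Idx s n) F))

instance : Module F (ContractedAlgebra F P) :=
  inferInstanceAs (Module F (Matrix (Idx s n) (Idx s n) F))

@[ext] theorem ContractedAlgebra.ext {F : Type*} {P : SymmetricPartition s n} {A B : ContractedAlgebra F P} (h : ∀ i j, A i j = B i j) :
    A = B := Matrix.ext h

@[simp] theorem add_entry (A B : ContractedAlgebra F P) (i j : Idx s n) :
    (A + B) i j = A i j + B i j := rfl

@[simp] theorem neg_entry (A : ContractedAlgebra F P) (i j : Idx s n) : (-A) i j = -A i j := rfl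

@[simp] theorem zero_entry (i j : Idx s n) : (0 : ContractedAlgebra F P) i j = 0 := rfl

@[simp] theorem smul_entry (c : F) (A : ContractedAlgebra F P) (i j : Idx s n) :
    (c • A) i j = c * A i j := rfl

/-- The multiplication of `gl^a(M) = p ⊕ u_-^a`. On matrix units, the product of the units at
`(i, t)` and `(t, j)` is the unit at `(i, j)` if the degrees add up, and is zero otherwise. So `p`
multiplies as matrices, `u_-^a` has zero multiplication, and for `T ∈ p`, `λ ∈ u_-^a` the products
`T λ`, `λ T` are the `u_-`-components of the matrix products; under the identification
`λ ↔ (x ↦ tr (λ x))` of `u_-` with the dual of `u_+` this says `(T λ)(x) = λ(x T)` and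
`(λ T)(x) = λ(T x)`. -/
instance : Mul (ContractedAlgebra F P) where
  mul A B := Matrix.of fun i j =>
    ∑ t, if P.deg i t + P.deg t j = P.deg i j then A i t * B t j else 0

instance : One (ContractedAlgebra F P) := ⟨(1 : Matrix (Idx s n) (Idx s n) F)⟩

theorem mul_entry (A B : ContractedAlgebra F P) (i j : Idx s n) :
    (A * B) i j = ∑ t, if P.deg i t + P.deg t j = P.deg i j then A i t * B t j else 0 := rfl

theorem one_entry (i j : Idx s n) :
    (1 : ContractedAlgebra F P) i j = if i = j then 1 else 0 := Matrix.one_apply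

theorem deg_le (P : SymmetricPartition s n) (i t j : Idx s n) :
    P.deg i j ≤ P.deg i t + P.deg t j := by
  unfold SymmetricPartition.deg
  split_ifs <;> omega

theorem deg_self (P : SymmetricPartition s n) (i : Idx s n) : P.deg i i = 0 := by
  simp [SymmetricPartition.deg]

theorem mul_assoc_aux (A B C : ContractedAlgebra F P) : A * B * C = A * (B * C) := by
  ext i j
  have hL : (A * B * C) i j = ∑ t, ∑ r, if P.deg i r + P.deg r t + P.deg t j = P.deg i j then
      A i r * B r t * C t j else 0 := by
    rw [mul_entry]
    refine Finset.sum_congr rfl fun t _ => ?_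
    rw [mul_entry]
    by_cases h : P.deg i t + P.deg t j = P.deg i j
    · rw [if_pos h, Finset.sum_mul]
      refine Finset.sum_congr rfl fun r _ => ?_
      by_cases h2 : P.deg i r + P.deg r t = P.deg i t
      · rw [if_pos h2, if_pos (by omega)]
      · rw [if_neg h2, if_neg (by omega), zero_mul]
    · rw [if_neg h, Finset.sum_eq_zero]
      intro r _
      have h1 := deg_le P i r t
      have h2 := deg_le P i t j
      rw [if_neg (by omega)]
  have hR : (A * (B * C)) i j = ∑ r, ∑ t, if P.deg i r + P.deg r t + P.deg t j = P.deg i j then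
      A i r * B r t * C t j else 0 := by
    rw [mul_entry]
    refine Finset.sum_congr rfl fun r _ => ?_
    rw [mul_entry]
    by_cases h : P.deg i r + P.deg r j = P.deg i j
    · rw [if_pos h, Finset.mul_sum]
      refine Finset.sum_congr rfl fun t _ => ?_
      by_cases h2 : P.deg r t + P.deg t j = P.deg r j
      · rw [if_pos h2, if_pos (by omega), mul_assoc]
      · rw [if_neg h2, if_neg (by omega), mul_zero]
    · rw [if_neg h, Finset.sum_eq_zero]
      intro t _
      have h1 := deg_le P r t j
      have h2 := deg_le P i r j
      rw [if_neg (by omega)]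
  rw [hL, hR, Finset.sum_comm]

instance : Ring (ContractedAlgebra F P) where
  __ := (inferInstance : AddCommGroup (ContractedAlgebra F P))
  __ := (inferInstance : Mul (ContractedAlgebra F P))
  __ := (inferInstance : One (ContractedAlgebra F P))
  mul_assoc := mul_assoc_aux
  one_mul A := by
    ext i j
    rw [mul_entry, Finset.sum_eq_single i]
    · simp [one_entry, deg_self]
    · intro t _ ht
      simp [one_entry, ht.symm]
    · simp
  mul_one A := by
    ext i j
    rw [mul_entry, Finset.sum_eq_single j]
    · simp [one_entry, deg_self]
    · intro t _ ht
      simp [one_entry, ht]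
    · simp
  left_distrib A B C := by
    ext i j
    rw [add_entry, mul_entry, mul_entry, mul_entry, ← Finset.sum_add_distrib]
    refine Finset.sum_congr rfl fun t _ => ?_
    split_ifs <;> simp [mul_add]
  right_distrib A B C := by
    ext i j
    rw [add_entry, mul_entry, mul_entry, mul_entry, ← Finset.sum_add_distrib]
    refine Finset.sum_congr rfl fun t _ => ?_
    split_ifs <;> simp [add_mul]
  zero_mul A := by
    ext i j
    rw [mul_entry]
    simp
  mul_zero A := by
    ext i j
    rw [mul_entry]
    simp

/-- The entry at `(i, -i)` of the antidiagonal matrix defining the form: all ones in the orthogonal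
cases, and in the symplectic case `1` for `i > 0` and `-1` for `i < 0`. -/
def sgn (F : Type*) [Field F] (i : Idx s n) : F := if s = Series.C ∧ i.1 < 0 then -1 else 1

theorem sgn_mul_self (i : Idx s n) : sgn F i * sgn F i = 1 := by
  unfold sgn
  split_ifs <;> simp

theorem sgn_opp_mul (i j : Idx s n) :
    sgn F (opp i) * sgn F (opp j) = sgn F i * sgn F j := by
  by_cases hs : s = Series.C
  · have h0 : ∀ k : Idx s n, k.1 ≠ 0 := by
      intro k
      have := (Finset.mem_filter.1 k.2).2
      rcases this with h | h
      · rw [hs] at h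
        cases h
      · exact h
    have hi := h0 i
    have hj := h0 j
    have e : ∀ k : Idx s n, k.1 ≠ 0 → sgn F (opp k) = -sgn F k := by
      intro k hk
      unfold sgn
      rw [opp_val]
      rcases lt_or_gt_of_ne hk with h | h
      · rw [if_neg (by omega), if_pos ⟨hs, h⟩, neg_neg]
      · rw [if_pos ⟨hs, by omega⟩, if_neg (by omega)]
    rw [e i hi, e j hj, neg_mul_neg]
  · simp [sgn, hs]

theorem deg_opp (P : SymmetricPartition s n) (i j : Idx s n) :
    P.deg (opp j) (opp i) = P.deg i j := by
  simp [SymmetricPartition.deg, P.blk_opp]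

/-- The involutive antiautomorphism `X ↦ X†` of `gl^a(M)`, given by the same entrywise formula as
for matrices: `X† = Φ Xᵀ Φ⁻¹`, where `Φ` is the antidiagonal matrix with entries `sgn i`
at `(i, -i)`. -/
instance : Star (ContractedAlgebra F P) where
  star X := Matrix.of fun i j => sgn F i * sgn F j * X (opp j) (opp i)

theorem star_entry (X : ContractedAlgebra F P) (i j : Idx s n) :
    star X i j = sgn F i * sgn F j * X (opp j) (opp i) := rfl

instance : StarRing (ContractedAlgebra F P) where
  star_involutive X := by
    ext i j
    rw [star_entry, star_entry, sgn_opp_mul, opp_opp, opp_opp]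
    linear_combination (X i j * sgn F j * sgn F j) * sgn_mul_self (F := F) i +
      X i j * sgn_mul_self (F := F) j
  star_mul A B := by
    ext i j
    rw [star_entry, mul_entry, mul_entry, Finset.mul_sum, ← Equiv.sum_comp (oppEquiv s n)]
    refine Finset.sum_congr rfl fun t _ => ?_
    change sgn F i * sgn F j * (if P.deg (opp j) (opp t) + P.deg (opp t) (opp i) =
      P.deg (opp j) (opp i) then A (opp j) (opp t) * B (opp t) (opp i) else 0) =
      if P.deg i t + P.deg t j = P.deg i j then
        (sgn F i * sgn F t * B (opp t) (opp i)) * (sgn F t * sgn F j * A (opp j) (opp t)) else 0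
    rw [deg_opp, deg_opp, deg_opp, add_comm (P.deg t j)]
    split_ifs
    · linear_combination (-(sgn F i * sgn F j * A (opp j) (opp t) * B (opp t) (opp i))) *
        sgn_mul_self (F := F) t
    · simp
  star_add A B := by
    ext i j
    rw [star_entry, add_entry, add_entry, star_entry, star_entry]
    ring

theorem mul_entry_eq_zero_left (A X : ContractedAlgebra F P)
    (hX : ∀ i j, P.blk i = P.blk j → X i j = 0) (i j : Idx s n) (h : P.blk i = P.blk j) :
    (A * X) i j = 0 := by
  rw [mul_entry, Finset.sum_eq_zero]
  intro t _
  unfold SymmetricPartition.deg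
  by_cases h1 : P.blk t = P.blk j
  · simp [hX t j h1]
  · rw [if_neg]
    intro hd
    split_ifs at hd <;> omega

theorem mul_entry_eq_zero_right (A X : ContractedAlgebra F P)
    (hX : ∀ i j, P.blk i = P.blk j → X i j = 0) (i j : Idx s n) (h : P.blk i = P.blk j) :
    (X * A) i j = 0 := by
  rw [mul_entry, Finset.sum_eq_zero]
  intro t _
  unfold SymmetricPartition.deg
  by_cases h1 : P.blk i = P.blk t
  · simp [hX i t h1]
  · rw [if_neg]
    intro hd
    split_ifs at hd <;> omega

end Algebra

/-- The space `u^a = u_+ ⊕ u_-^a` attached to the orthogonal or symplectic group: elements of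
`gl^a(M)` with zero diagonal blocks such that `X† = -X`. -/
def nilradical (F : Type*) [Field F] (P : SymmetricPartition s n) :
    Submodule F (ContractedAlgebra F P) where
  carrier := {X | (∀ i j, P.blk i = P.blk j → X i j = 0) ∧ star X = -X}
  zero_mem' := ⟨fun _ _ _ => rfl, by simp⟩
  add_mem' := by
    rintro X Y ⟨hX, hX'⟩ ⟨hY, hY'⟩
    refine ⟨fun i j h => ?_, ?_⟩
    · rw [add_entry, hX i j h, hY i j h, add_zero]
    · rw [star_add, hX', hY', neg_add]
  smul_mem' := by
    rintro c X ⟨hX, hX'⟩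
    refine ⟨fun i j h => ?_, ?_⟩
    · rw [smul_entry, hX i j h, mul_zero]
    · ext i j
      have h := congrFun (congrFun hX' i) j
      change star X i j = -X i j at h
      rw [star_entry] at h
      rw [star_entry, neg_entry, smul_entry, smul_entry]
      linear_combination c * h

section Action

variable {F : Type*} [Field F] {P : SymmetricPartition s n}

theorem conj_mem (g : ContractedAlgebra F P) {X : ContractedAlgebra F P}
    (hX : X ∈ nilradical F P) : g * X * star g ∈ nilradical F P := by
  refine ⟨mul_entry_eq_zero_right _ _ (mul_entry_eq_zero_left _ _ hX.1), ?_⟩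
  rw [star_mul, star_mul, star_star, hX.2, neg_mul, mul_neg, mul_assoc]

theorem conj_mem' (g : ContractedAlgebra F P) {X : ContractedAlgebra F P}
    (hX : X ∈ nilradical F P) : star g * X * g ∈ nilradical F P := by
  simpa using conj_mem (star g) hX

theorem mul_smul_entry (A X : ContractedAlgebra F P) (c : F) : A * (c • X) = c • (A * X) := by
  ext i j
  rw [smul_entry, mul_entry, mul_entry, Finset.mul_sum]
  refine Finset.sum_congr rfl fun t _ => ?_
  split_ifs
  · rw [smul_entry]
    ring
  · simp

theorem smul_mul_entry (A X : ContractedAlgebra F P) (c : F) : (c • X) * A = c • (X * A) := by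
  ext i j
  rw [smul_entry, mul_entry, mul_entry, Finset.mul_sum]
  refine Finset.sum_congr rfl fun t _ => ?_
  split_ifs
  · rw [smul_entry]
    ring
  · simp

/-- The linear map `X ↦ g† X g` of `u^a`. -/
def conjDagger (g : ContractedAlgebra F P) : nilradical F P →ₗ[F] nilradical F P where
  toFun X := ⟨star g * X.1 * g, conj_mem' g X.2⟩
  map_add' X Y := by
    apply Subtype.ext
    change star g * (X.1 + Y.1) * g = star g * X.1 * g + star g * Y.1 * g
    rw [mul_add, add_mul]
  map_smul' c X := by
    apply Subtype.ext
    change star g * (c • X.1) * g = c • (star g * X.1 * g)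
    rw [mul_smul_entry, smul_mul_entry]

/-- The group of invertible elements of `gl^a(M)`, i.e. the parabolic contraction of `GL(M)`. -/
abbrev ContractedGL (F : Type*) [Field F] (P : SymmetricPartition s n) : Type _ :=
  (ContractedAlgebra F P)ˣ

/-- The action of the contraction of `GL(M)` on the dual space of `u^a`:
`(g • Λ)(X) = Λ(g† X g)`. -/
instance : MulAction (ContractedGL F P) (Module.Dual F (nilradical F P)) where
  smul g Λ := Λ ∘ₗ conjDagger (g : ContractedAlgebra F P)
  one_smul Λ := by
    ext X
    change Λ (conjDagger 1 X) = Λ X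
    congr 1
    apply Subtype.ext
    change star 1 * X.1 * 1 = X.1
    simp
  mul_smul g h Λ := by
    ext X
    change Λ (conjDagger ((g : ContractedAlgebra F P) * (h : ContractedAlgebra F P)) X) =
      Λ (conjDagger (h : ContractedAlgebra F P) (conjDagger (g : ContractedAlgebra F P) X))
    congr 1
    apply Subtype.ext
    change star ((g : ContractedAlgebra F P) * (h : ContractedAlgebra F P)) * X.1 *
      ((g : ContractedAlgebra F P) * (h : ContractedAlgebra F P)) =
      star (h : ContractedAlgebra F P) * (star (g : ContractedAlgebra F P) * X.1 * g) * h
    rw [star_mul]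
    simp only [mul_assoc]

theorem smul_dual_apply (g : ContractedGL F P) (Λ : Module.Dual F (nilradical F P))
    (X : nilradical F P) :
    (g • Λ) X = Λ ⟨star (g : ContractedAlgebra F P) * X.1 * g, conj_mem' _ X.2⟩ := rfl

end Action

/-- `(i, j)' = (-j, -i)`. -/
def prime (γ : Idx s n × Idx s n) : Idx s n × Idx s n := (opp γ.2, opp γ.1)

theorem prime_prime (γ : Idx s n × Idx s n) : prime (prime γ) = γ := by simp [prime]

/-- The roots, written as pairs. The positive roots are `ε_i - ε_j = (i, j)` and
`ε_i + ε_j = (i, -j)` for `i > j > 0`, together with `ε_i = (i, 0)` in the series `B` and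
`2 ε_i = (i, -i)` in the series `C`, for `i > 0`; the negative roots are the transposed pairs.
In other words, these are the pairs `(i, j)`, `i ≠ j`, with `i + j > 0`, and in the series `C` also
those with `i + j = 0`. -/
def IsRoot (γ : Idx s n × Idx s n) : Prop :=
  γ.1 ≠ γ.2 ∧ (0 < γ.1.1 + γ.2.1 ∨ (s = Series.C ∧ γ.1.1 + γ.2.1 = 0))

/-- The roots whose root vectors lie in `u^a`. -/
def IsNilRoot (P : SymmetricPartition s n) (γ : Idx s n × Idx s n) : Prop :=
  IsRoot γ ∧ P.blk γ.1 ≠ P.blk γ.2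

/-- The root vector attached to `γ`, as a matrix: `E_γ + η(γ) E_γ'` with `η(γ) = 0` if `γ = γ'`;
otherwise `η(γ) = ±1` is the sign for which the vector satisfies `X† = -X`. (For a negative root the
matrix unit is written `F_γ` in `u_-^a`.) -/
def rootMatrix (F : Type*) [Field F] (P : SymmetricPartition s n) (γ : Idx s n × Idx s n) :
    ContractedAlgebra F P :=
  Matrix.of fun i j =>
    if (i, j) = γ then 1
    else if (i, j) = prime γ then -(sgn F γ.1 * sgn F γ.2) else 0

/-- The linear form on `u^a` dual to the root vector of `γ`: it reads off the coefficient of the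
matrix unit at `γ`. That these forms are the dual basis of the basis of root vectors is shown in
`rootForm_rootVector` and `eq_sum_rootVector`. -/
def rootForm (F : Type*) [Field F] (P : SymmetricPartition s n) (γ : Idx s n × Idx s n) :
    Module.Dual F (nilradical F P) where
  toFun X := X.1 γ.1 γ.2
  map_add' _ _ := rfl
  map_smul' _ _ := rfl

section RootVectors

variable {F : Type*} [Field F] {P : SymmetricPartition s n}

theorem eq_of_prime_isRoot {γ : Idx s n × Idx s n} (h : IsRoot γ) (h' : IsRoot (prime γ)) :
    prime γ = γ := by
  obtain ⟨-, h⟩ := h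
  obtain ⟨-, h'⟩ := h'
  simp only [prime, opp_val] at h'
  ext
  · simp only [prime, opp_val]
    omega
  · simp only [prime, opp_val]
    omega

theorem sgn_antidiag {γ : Idx s n × Idx s n} (h : IsRoot γ) (hp : prime γ = γ) :
    sgn F γ.1 * sgn F γ.2 = -1 := by
  have h2 : -γ.2.1 = γ.1.1 := congrArg (fun x => x.1.1) hp
  obtain ⟨hne, h | ⟨hs, h⟩⟩ := h
  · omega
  · have h0 : γ.1.1 ≠ γ.2.1 := fun e => hne (Subtype.ext e)
    unfold sgn
    rcases lt_or_ge γ.1.1 0 with h3 | h3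
    · rw [if_pos ⟨hs, h3⟩, if_neg (by omega), mul_one]
    · rw [if_neg (by omega), if_pos ⟨hs, by omega⟩, one_mul]

theorem rootMatrix_mem {γ : Idx s n × Idx s n} (h : IsNilRoot P γ) :
    rootMatrix F P γ ∈ nilradical F P := by
  refine ⟨fun i j hij => ?_, ?_⟩
  · change (if (i, j) = γ then (1 : F) else
      if (i, j) = prime γ then -(sgn F γ.1 * sgn F γ.2) else 0) = 0
    rw [if_neg, if_neg]
    · rintro e
      apply h.2
      have e1 : i = opp γ.2 := congrArg Prod.fst e
      have e2 : j = opp γ.1 := congrArg Prod.snd e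
      rw [e1, e2, P.blk_opp, P.blk_opp] at hij
      omega
    · rintro rfl
      exact h.2 hij
  · ext i j
    rw [star_entry, neg_entry]
    change sgn F i * sgn F j * (if (opp j, opp i) = γ then (1 : F) else
      if (opp j, opp i) = prime γ then -(sgn F γ.1 * sgn F γ.2) else 0) =
      -(if (i, j) = γ then (1 : F) else
      if (i, j) = prime γ then -(sgn F γ.1 * sgn F γ.2) else 0)
    have e1 : (opp j, opp i) = γ ↔ (i, j) = prime γ := by
      constructor
      · rintro rfl
        simp [prime]
      · intro e
        rw [← prime_prime γ, ← e]
        rfl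
    have e2 : (opp j, opp i) = prime γ ↔ (i, j) = γ := by
      constructor
      · intro e
        rw [← prime_prime γ, ← e]
        simp [prime]
      · rintro rfl
        rfl
    rw [if_congr e1 rfl (if_congr e2 rfl rfl)]
    by_cases a : (i, j) = γ
    · subst a
      by_cases b : (i, j) = prime (i, j)
      · rw [if_pos b, if_pos rfl]
        have := sgn_antidiag (F := F) h.1 b.symm
        simpa using this
      · rw [if_neg b, if_pos rfl, if_pos rfl]
        linear_combination -(sgn F j * sgn F j) * sgn_mul_self (F := F) i -
          sgn_mul_self (F := F) j
    · by_cases b : (i, j) = prime γ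
      · rw [if_pos b, if_neg a, if_pos b]
        have e3 : i = opp γ.2 := congrArg Prod.fst b
        have e4 : j = opp γ.1 := congrArg Prod.snd b
        rw [e3, e4, sgn_opp_mul]
        ring
      · rw [if_neg b, if_neg a, if_neg a, if_neg b]
        simp

/-- The root vector of `γ` as an element of `u^a`. -/
def rootVector (F : Type*) [Field F] (P : SymmetricPartition s n)
    (γ : {γ : Idx s n × Idx s n // IsNilRoot P γ}) : nilradical F P :=
  ⟨rootMatrix F P γ, rootMatrix_mem γ.2⟩

theorem rootForm_rootVector (γ β : {γ : Idx s n × Idx s n // IsNilRoot P γ}) [Decidable (γ = β)] :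
    rootForm F P γ.1 (rootVector F P β) = if γ = β then 1 else 0 := by
  change (if ((γ.1.1, γ.1.2) : Idx s n × Idx s n) = β.1 then (1 : F) else
      if (γ.1.1, γ.1.2) = prime β.1 then -(sgn F β.1.1 * sgn F β.1.2) else 0) = _
  by_cases h : γ = β
  · subst h
    simp
  · have h1 : γ.1 ≠ β.1 := fun e => h (Subtype.ext e)
    rw [if_neg h, if_neg h1, if_neg]
    intro e
    have e' : γ.1 = prime β.1 := e
    have := eq_of_prime_isRoot β.2.1 (e' ▸ γ.2.1)
    exact h1 (e'.trans this)

theorem ext_of_rootForm {X Y : nilradical F P} (h2 : (2 : F) ≠ 0)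
    (h : ∀ γ, IsNilRoot P γ → rootForm F P γ X = rootForm F P γ Y) : X = Y := by
  apply Subtype.ext
  ext i j
  have key : ∀ Z : nilradical F P, ∀ i j : Idx s n,
      sgn F i * sgn F j * Z.1 (opp j) (opp i) = -Z.1 i j := by
    intro Z i j
    have := congrFun (congrFun Z.2.2 i) j
    exact this
  have pos : ∀ i j : Idx s n, 0 < i.1 + j.1 → X.1 i j = Y.1 i j := by
    intro i j hij
    by_cases hb : P.blk i = P.blk j
    · rw [X.2.1 i j hb, Y.2.1 i j hb]
    · exact h (i, j) ⟨⟨fun e => hb (congrArg P.blk e), Or.inl hij⟩, hb⟩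
  rcases lt_trichotomy (i.1 + j.1) 0 with hij | hij | hij
  · have h1 := key X i j
    have h3 := key Y i j
    rw [pos (opp j) (opp i) (by simp only [opp_val]; omega)] at h1
    exact neg_injective (h1.symm.trans h3)
  · by_cases hb : P.blk i = P.blk j
    · rw [X.2.1 i j hb, Y.2.1 i j hb]
    by_cases hs : s = Series.C
    · exact h (i, j) ⟨⟨fun e => hb (congrArg P.blk e), Or.inr ⟨hs, hij⟩⟩, hb⟩
    · have ej : opp j = i := Subtype.ext (by rw [opp_val]; omega)
      have ei : opp i = j := Subtype.ext (by rw [opp_val]; omega)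
      have z : ∀ Z : nilradical F P, Z.1 i j = 0 := by
        intro Z
        have h1 := key Z i j
        rw [ej, ei] at h1
        simp only [sgn, hs, false_and, if_false, one_mul] at h1
        have : (2 : F) * Z.1 i j = 0 := by linear_combination h1
        exact (mul_eq_zero.1 this).resolve_left h2
      rw [z X, z Y]
  · exact pos i j hij

open Classical in
theorem eq_sum_rootVector (h2 : (2 : F) ≠ 0) (X : nilradical F P) :
    X = ∑ γ : {γ : Idx s n × Idx s n // IsNilRoot P γ},
      rootForm F P γ.1 X • rootVector F P γ := by
  apply ext_of_rootForm h2
  intro γ hγ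
  rw [map_sum, Finset.sum_eq_single ⟨γ, hγ⟩]
  · rw [map_smul, rootForm_rootVector ⟨γ, hγ⟩ ⟨γ, hγ⟩]
    simp
  · intro β _ hβ
    rw [map_smul, rootForm_rootVector ⟨γ, hγ⟩ β, if_neg hβ.symm, smul_zero]
  · simp

end RootVectors

/-- A pair `(D, φ)`: a rook placement `D` in the set of roots of `u^a`, and a map `φ : D → F^*`.
`D` is a rook placement if any row and any column contains at most one pair of `D ∪ D'`, where
`D' = {γ' | γ ∈ D}`. -/
structure RookPair (F : Type*) [Field F] (P : SymmetricPartition s n) where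
  D : Finset (Idx s n × Idx s n)
  isNilRoot : ∀ γ ∈ D, IsNilRoot P γ
  row_unique : ∀ α ∈ D ∪ D.image prime, ∀ β ∈ D ∪ D.image prime, α.1 = β.1 → α = β
  col_unique : ∀ α ∈ D ∪ D.image prime, ∀ β ∈ D ∪ D.image prime, α.2 = β.2 → α = β
  φ : {γ // γ ∈ D} → Fˣ

/-- The linear form `Λ_{D,φ}`: the sum over `γ ∈ D` of `φ(γ)` times the form dual to the root
vector of `γ`. -/
def RookPair.form {F : Type*} [Field F] {P : SymmetricPartition s n} (p : RookPair F P) :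
    Module.Dual F (nilradical F P) :=
  ∑ γ : {γ // γ ∈ p.D}, (p.φ γ : F) • rootForm F P γ.1

/-- `γ = (i, -i)`. -/
def IsAntidiagonal (γ : Idx s n × Idx s n) : Prop := γ.2 = opp γ.1

/-- Basic pairs, for a fixed non-square `δ`. In the orthogonal cases: `φ = 1`. In the symplectic
case: `φ` takes values in `{1, δ}`, the value `δ` only on the antidiagonal, and for each `k` the set
`D ∩ (I_k × I_{-k})` lies on the antidiagonal and has at most one root with `φ(γ) = δ`. -/
def RookPair.IsBasic {F : Type*} [Field F] {P : SymmetricPartition s n} (δ : Fˣ)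
    (p : RookPair F P) : Prop :=
  (s ≠ Series.C → ∀ γ, p.φ γ = 1) ∧
  (s = Series.C →
    (∀ γ, p.φ γ = 1 ∨ p.φ γ = δ) ∧
    (∀ γ, p.φ γ = δ → IsAntidiagonal γ.1) ∧
    ∀ k : ℤ,
      (∀ γ ∈ p.D, P.blk γ.1 = k → P.blk γ.2 = -k → IsAntidiagonal γ) ∧
      {γ : {γ // γ ∈ p.D} | P.blk γ.1.1 = k ∧ P.blk γ.1.2 = -k ∧ p.φ γ = δ}.Subsingleton)

/-- The Weyl group `W_L` of the Levi subgroup `∏ GL(I_k)` of `GL(M)`: permutations of `I` that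
preserve every segment. -/
def leviWeylGroup (P : SymmetricPartition s n) : Subgroup (Equiv.Perm (Idx s n)) where
  carrier := {w | ∀ i, P.blk (w i) = P.blk i}
  mul_mem' {v w} hv hw i := (hv (w i)).trans (hw i)
  one_mem' _ := rfl
  inv_mem' {w} hw i := by
    have := hw (w⁻¹ i)
    rw [show w (w⁻¹ i) = i from w.apply_symm_apply i] at this
    exact this.symm

/-- The action of `W_L` on roots that comes from `X ↦ ẇ X ẇ†`, where `ẇ` is the permutation matrix
of `w`: the pair `(i, j)` goes to `(w i, -w(-j))` or, if that is not a root, to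
`(w i, -w(-j))' = (w(-j), -w i)`. See `permElement_conj_rootMatrix`. -/
def weylActRoot (w : Equiv.Perm (Idx s n)) (γ : Idx s n × Idx s n) : Idx s n × Idx s n :=
  if 0 ≤ (w γ.1).1 + (opp (w (opp γ.2))).1 then (w γ.1, opp (w (opp γ.2)))
  else prime (w γ.1, opp (w (opp γ.2)))

/-- The permutation matrix of `w`, as an element of `gl^a(M)`. -/
def permElement (F : Type*) [Field F] (P : SymmetricPartition s n) (w : Equiv.Perm (Idx s n)) :
    ContractedAlgebra F P :=
  Matrix.of fun i j => if i = w j then 1 else 0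

section Perm

variable {F : Type*} [Field F] {P : SymmetricPartition s n}

theorem permElement_mul_entry {w : Equiv.Perm (Idx s n)} (hw : w ∈ leviWeylGroup P)
    (A : ContractedAlgebra F P) (i j : Idx s n) :
    (permElement F P w * A) (w i) j = A i j := by
  rw [mul_entry, Finset.sum_eq_single i]
  · have h := hw i
    rw [if_pos]
    · simp [permElement]
    · simp [SymmetricPartition.deg, h]
  · intro t _ ht
    have : permElement F P w (w i) t = 0 := if_neg fun e => ht (w.injective e).symm
    simp [this]
  · simp

theorem mul_star_permElement_entry {w : Equiv.Perm (Idx s n)} (hw : w ∈ leviWeylGroup P)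
    (A : ContractedAlgebra F P) (i j : Idx s n) :
    (A * star (permElement F P w)) i (opp (w (opp j))) =
      sgn F j * sgn F (opp (w (opp j))) * A i j := by
  rw [mul_entry, Finset.sum_eq_single j]
  · have h : P.blk (opp (w (opp j))) = P.blk j := by
      rw [P.blk_opp, hw (opp j), P.blk_opp, neg_neg]
    rw [if_pos, star_entry]
    · simp [permElement]
      ring
    · simp [SymmetricPartition.deg, h]
  · intro t _ ht
    have : star (permElement F P w) t (opp (w (opp j))) = 0 := by
      rw [star_entry, opp_opp]
      have : permElement F P w (w (opp j)) (opp t) = 0 :=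
        if_neg fun e => ht (by simpa using (congrArg opp (w.injective e)).symm)
      rw [this, mul_zero]
    simp [this]
  · simp

theorem sgn_eq (i : Idx s n) : sgn F i = 1 ∨ sgn F i = -1 := by
  unfold sgn
  split_ifs <;> simp

theorem sgn_mul_eq (i j : Idx s n) : sgn F i * sgn F j = 1 ∨ sgn F i * sgn F j = -1 := by
  rcases sgn_eq (F := F) i with h | h <;> rcases sgn_eq (F := F) j with h' | h' <;> simp [h, h']

theorem rootMatrix_entry (γ : Idx s n × Idx s n) (i j : Idx s n) :
    rootMatrix F P γ i j = if (i, j) = γ then 1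
      else if (i, j) = prime γ then -(sgn F γ.1 * sgn F γ.2) else 0 := rfl

theorem rootMatrix_prime (γ : Idx s n × Idx s n) :
    rootMatrix F P (prime γ) = rootMatrix F P γ ∨
      rootMatrix F P (prime γ) = -(sgn F γ.1 * sgn F γ.2) • rootMatrix F P γ := by
  by_cases h : prime γ = γ
  · left
    rw [h]
  · right
    ext i j
    rw [smul_entry, rootMatrix_entry, rootMatrix_entry, prime_prime]
    by_cases a : (i, j) = γ
    · have b : (i, j) ≠ prime γ := fun b => h (b.symm.trans a)
      rw [if_neg b, if_pos a, if_pos a]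
      change -(sgn F (opp γ.2) * sgn F (opp γ.1)) = _
      rw [sgn_opp_mul]
      ring
    · by_cases b : (i, j) = prime γ
      · rw [if_pos b, if_neg a, if_pos b]
        linear_combination (-(sgn F γ.2 * sgn F γ.2)) * sgn_mul_self (F := F) γ.1 -
          sgn_mul_self (F := F) γ.2
      · rw [if_neg b, if_neg a, if_neg a, if_neg b, mul_zero]

/-- Up to sign, conjugation by permutation matrices permutes the root vectors
through `weylActRoot`. -/
theorem permElement_conj_rootMatrix {w : Equiv.Perm (Idx s n)} (hw : w ∈ leviWeylGroup P)
    (γ : Idx s n × Idx s n) :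
    ∃ c : F, (c = 1 ∨ c = -1) ∧
      permElement F P w * rootMatrix F P γ * star (permElement F P w) =
        c • rootMatrix F P (weylActRoot w γ) := by
  have main : permElement F P w * rootMatrix F P γ * star (permElement F P w) =
      (sgn F γ.2 * sgn F (opp (w (opp γ.2)))) •
        rootMatrix F P (w γ.1, opp (w (opp γ.2))) := by
    ext i j
    obtain ⟨i, rfl⟩ := w.surjective i
    obtain ⟨j, rfl⟩ : ∃ j', opp (w (opp j')) = j :=
      ⟨opp (w.symm (opp j)), by simp⟩
    rw [mul_star_permElement_entry hw, permElement_mul_entry hw, smul_entry, rootMatrix_entry,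
      rootMatrix_entry]
    have oinj : ∀ {a b : Idx s n}, opp a = opp b → a = b := fun h => (oppEquiv s n).injective h
    have e1 : (w i, opp (w (opp j))) = (w γ.1, opp (w (opp γ.2))) ↔ (i, j) = γ := by
      constructor
      · intro e
        obtain ⟨h1, h2⟩ := Prod.ext_iff.1 e
        exact Prod.ext (w.injective h1) (oinj (w.injective (oinj h2)))
      · rintro rfl
        rfl
    have e2 : (w i, opp (w (opp j))) = prime (w γ.1, opp (w (opp γ.2))) ↔
        (i, j) = prime γ := by
      constructor
      · intro e
        obtain ⟨h1, h2⟩ := Prod.ext_iff.1 e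
        simp only [prime, opp_opp] at h1 h2
        exact Prod.ext (w.injective h1) (by simpa [prime] using congrArg opp (w.injective (oinj h2)))
      · intro e
        obtain ⟨h1, h2⟩ := Prod.ext_iff.1 e
        simp only [prime] at h1 h2
        simp [prime, h1, h2]
    rw [if_congr e1 rfl (if_congr e2 rfl rfl)]
    by_cases a : (i, j) = γ
    · rw [if_pos a, if_pos a, ← a]
    · rw [if_neg a, if_neg a]
      by_cases b : (i, j) = prime γ
      · rw [if_pos b, if_pos b]
        obtain ⟨-, h2⟩ := Prod.ext_iff.1 b
        simp only [prime] at h2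
        subst h2
        rw [opp_opp, sgn_opp_mul]
        linear_combination (-(sgn F γ.2 * sgn F (w γ.1))) * sgn_mul_self (F := F) γ.1 +
          (sgn F γ.2 * sgn F (w γ.1)) * sgn_mul_self (F := F) (opp (w (opp γ.2)))
      · rw [if_neg b, if_neg b, mul_zero, mul_zero]
  rw [main]
  unfold weylActRoot
  split_ifs
  · exact ⟨_, sgn_mul_eq _ _, rfl⟩
  · set β := (w γ.1, opp (w (opp γ.2))) with hβ
    have h := sgn_mul_eq (F := F) γ.2 (opp (w (opp γ.2)))
    rcases rootMatrix_prime (F := F) (P := P) β with e | e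
    · exact ⟨_, h, by rw [e]⟩
    · rcases sgn_mul_eq (F := F) β.1 β.2 with h' | h'
      · refine ⟨-(sgn F γ.2 * sgn F (opp (w (opp γ.2)))), ?_, ?_⟩
        · rcases h with h | h <;> simp [h]
        · rw [e, h', smul_smul]
          congr 1
          ring
      · refine ⟨_, h, ?_⟩
        rw [e, h', neg_neg, one_smul]

end Perm

/-- `(D₂, φ₂) = w • (D₁, φ₁)` for some `w ∈ W_L`: `w` maps `D₁` bijectively onto `D₂` and carries
`φ₁` to `φ₂`. -/
def RookPair.WeylConj {F : Type*} [Field F] {P : SymmetricPartition s n} (p₁ p₂ : RookPair F P) :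
    Prop :=
  ∃ w ∈ leviWeylGroup P, ∃ e : {γ // γ ∈ p₁.D} ≃ {γ // γ ∈ p₂.D},
    ∀ γ, (e γ).1 = weylActRoot w γ.1 ∧ p₂.φ (e γ) = p₁.φ γ

end ParabolicContraction

end

noncomputable section

namespace ParabolicContraction

section

variable {s : Series} {n : ℕ} {F : Type*} [Field F] {P : SymmetricPartition s n}

/-- The sign `ε` with `Φᵗ = ε' Φ`, `ε = -1` in the orthogonal cases and `ε = 1` in the symplectic
case: symbols of linear forms are `ε`-symmetric. -/
def formSign (F : Type*) [Field F] (s : Series) : F := if s = Series.C then 1 else -1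

theorem val_ne_zero (hs : s = Series.C) (a : Idx s n) : a.1 ≠ 0 := by
  rcases (Finset.mem_filter.1 a.2).2 with h | h
  · rw [hs] at h
    cases h
  · exact h

theorem sgn_opp (a : Idx s n) : sgn F (opp a) = -(formSign F s * sgn F a) := by
  unfold formSign
  by_cases hs : s = Series.C
  · have h0 := val_ne_zero hs a
    unfold sgn
    rw [opp_val, if_pos hs]
    rcases lt_or_gt_of_ne h0 with h | h
    · rw [if_neg (by omega), if_pos ⟨hs, h⟩]
      ring
    · rw [if_pos ⟨hs, by omega⟩, if_neg (by omega)]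
      ring
  · simp [sgn, hs]

theorem formSign_mul_self : formSign F s * formSign F s = 1 := by
  unfold formSign
  split_ifs <;> simp

theorem sgn_ne_zero (a : Idx s n) : sgn F a ≠ 0 := by
  intro h
  have := sgn_mul_self (F := F) a
  rw [h] at this
  simp at this

theorem formSign_ne_zero : formSign F s ≠ 0 := by
  intro h
  have := formSign_mul_self (F := F) (s := s)
  rw [h] at this
  simp at this

/-- The matrix unit at `(i, j)`. -/
def matrixUnit (F : Type*) [Field F] (P : SymmetricPartition s n) (i j : Idx s n) :
    ContractedAlgebra F P :=
  Matrix.of fun p q => if p = i ∧ q = j then 1 else 0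

theorem matrixUnit_entry (i j p q : Idx s n) :
    matrixUnit F P i j p q = if p = i ∧ q = j then 1 else 0 := rfl

/-- The entry at `(i, j)` as a linear form. -/
def entryForm (i j : Idx s n) : ContractedAlgebra F P →ₗ[F] F where
  toFun A := A i j
  map_add' _ _ := rfl
  map_smul' _ _ := rfl

theorem sum_entry {ι : Type*} (t : Finset ι) (A : ι → ContractedAlgebra F P) (i j : Idx s n) :
    (∑ k ∈ t, A k) i j = ∑ k ∈ t, A k i j :=
  map_sum (entryForm (F := F) (P := P) i j) A t

theorem eq_sum_matrixUnit (A : ContractedAlgebra F P) :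
    A = ∑ i, ∑ j, A i j • matrixUnit F P i j := by
  ext p q
  rw [sum_entry, Finset.sum_eq_single p]
  · rw [sum_entry, Finset.sum_eq_single q]
    · simp [matrixUnit_entry]
    · intro j _ hj
      simp [matrixUnit_entry, hj.symm]
    · simp
  · intro i _ hi
    rw [sum_entry]
    exact Finset.sum_eq_zero fun j _ => by simp [matrixUnit_entry, hi.symm]
  · simp

/-- `E ↦ E - E†` on matrices with zero diagonal blocks, extended by zero on diagonal blocks. -/
def skewPart (F : Type*) [Field F] (P : SymmetricPartition s n) :
    ContractedAlgebra F P →ₗ[F] nilradical F P where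
  toFun E := ⟨Matrix.of fun i j => if P.blk i = P.blk j then 0 else
      E i j - sgn F i * sgn F j * E (opp j) (opp i), by
    refine ⟨fun i j h => if_pos h, ?_⟩
    ext i j
    change sgn F i * sgn F j * (if P.blk (opp j) = P.blk (opp i) then (0 : F) else
      E (opp j) (opp i) - sgn F (opp j) * sgn F (opp i) * E (opp (opp i)) (opp (opp j))) =
      -(if P.blk i = P.blk j then (0 : F) else E i j - sgn F i * sgn F j * E (opp j) (opp i))
    rw [P.blk_opp, P.blk_opp, sgn_opp_mul, opp_opp, opp_opp]
    by_cases h : P.blk i = P.blk j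
    · simp [h]
    · rw [if_neg h, if_neg (by omega)]
      linear_combination (-(sgn F j * sgn F j * E i j)) * sgn_mul_self (F := F) i -
        E i j * sgn_mul_self (F := F) j⟩
  map_add' A B := by
    apply Subtype.ext
    ext i j
    change (if P.blk i = P.blk j then (0 : F) else
      (A + B) i j - sgn F i * sgn F j * (A + B) (opp j) (opp i)) =
      (if P.blk i = P.blk j then (0 : F) else A i j - sgn F i * sgn F j * A (opp j) (opp i)) +
      (if P.blk i = P.blk j then (0 : F) else B i j - sgn F i * sgn F j * B (opp j) (opp i))
    rw [add_entry, add_entry]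
    split_ifs
    · simp
    · ring
  map_smul' c A := by
    apply Subtype.ext
    ext i j
    change (if P.blk i = P.blk j then (0 : F) else
      (c • A) i j - sgn F i * sgn F j * (c • A) (opp j) (opp i)) =
      c * (if P.blk i = P.blk j then (0 : F) else A i j - sgn F i * sgn F j * A (opp j) (opp i))
    rw [smul_entry, smul_entry]
    split_ifs
    · simp
    · ring

theorem skewPart_entry (E : ContractedAlgebra F P) (i j : Idx s n) :
    (skewPart F P E).1 i j = if P.blk i = P.blk j then 0 else
      E i j - sgn F i * sgn F j * E (opp j) (opp i) := rfl

theorem skewPart_eq {E : ContractedAlgebra F P} (hE : ∀ i j, P.blk i = P.blk j → E i j = 0) :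
    (skewPart F P E).1 = E + -star E := by
  ext i j
  rw [skewPart_entry, add_entry, neg_entry, star_entry]
  split_ifs with h
  · rw [hE i j h, hE _ _ (by rw [P.blk_opp, P.blk_opp, h])]
    simp
  · ring

theorem skewPart_self (X : nilradical F P) : skewPart F P X.1 = (2 : F) • X := by
  apply Subtype.ext
  rw [skewPart_eq X.2.1, X.2.2, neg_neg]
  ext i j
  change X.1 i j + X.1 i j = 2 * X.1 i j
  ring

theorem smul_skewPart (g : ContractedGL F P) (Λ : Module.Dual F (nilradical F P))
    {E : ContractedAlgebra F P} (hE : ∀ i j, P.blk i = P.blk j → E i j = 0) :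
    (g • Λ) (skewPart F P E) = Λ (skewPart F P (star (g : ContractedAlgebra F P) * E * g)) := by
  rw [smul_dual_apply]
  congr 1
  apply Subtype.ext
  rw [skewPart_eq (mul_entry_eq_zero_right _ _ (mul_entry_eq_zero_left _ _ hE))]
  change star (g : ContractedAlgebra F P) * (skewPart F P E).1 * g = _
  rw [skewPart_eq hE, star_mul, star_mul, star_star, mul_add, add_mul, mul_neg, neg_mul,
    mul_assoc _ (star E)]

/-- The degree of the position `(-a, b)`. -/
def SymmetricPartition.pairDeg (P : SymmetricPartition s n) (a b : Idx s n) : ℕ :=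
  if 0 < P.blk a + P.blk b then 1 else 0

theorem deg_opp_left (a b : Idx s n) : P.deg (opp a) b = P.pairDeg a b := by
  unfold SymmetricPartition.deg SymmetricPartition.pairDeg
  rw [P.blk_opp]
  split_ifs <;> omega

/-- The coefficients of a linear form on `u^a`, arranged so that they form a symmetric or
skew-symmetric matrix on which `g` acts by a truncated version of `Y ↦ g Y gᵗ`. -/
def symbol (Λ : Module.Dual F (nilradical F P)) (a b : Idx s n) : F :=
  sgn F a * Λ (skewPart F P (matrixUnit F P (opp a) b))

theorem apply_skewPart (Λ : Module.Dual F (nilradical F P)) (E : ContractedAlgebra F P) :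
    Λ (skewPart F P E) = ∑ a, ∑ b, sgn F a * E (opp a) b * symbol Λ a b := by
  conv_lhs => rw [eq_sum_matrixUnit E]
  rw [map_sum, map_sum, ← Equiv.sum_comp (oppEquiv s n)]
  refine Finset.sum_congr rfl fun a _ => ?_
  rw [map_sum, map_sum]
  refine Finset.sum_congr rfl fun b _ => ?_
  rw [map_smul, map_smul, smul_eq_mul]
  change E (opp a) b * Λ (skewPart F P (matrixUnit F P (opp a) b)) = _
  unfold symbol
  linear_combination (-(E (opp a) b * Λ (skewPart F P (matrixUnit F P (opp a) b)))) *
    sgn_mul_self (F := F) a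

theorem symbol_injective (h2 : (2 : F) ≠ 0) {Λ Λ' : Module.Dual F (nilradical F P)}
    (h : ∀ a b, symbol Λ a b = symbol Λ' a b) : Λ = Λ' := by
  ext X
  have e : Λ (skewPart F P X.1) = Λ' (skewPart F P X.1) := by
    simp only [apply_skewPart, h]
  rw [skewPart_self, map_smul, map_smul, smul_eq_mul, smul_eq_mul] at e
  exact mul_left_cancel₀ h2 e

theorem symbol_eq_zero (Λ : Module.Dual F (nilradical F P)) {a b : Idx s n}
    (h : P.blk a + P.blk b = 0) : symbol Λ a b = 0 := by
  have : skewPart F P (matrixUnit F P (opp a) b) = 0 := by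
    apply Subtype.ext
    ext i j
    rw [skewPart_entry]
    change _ = (0 : F)
    split_ifs with hij
    · rfl
    · rw [matrixUnit_entry, matrixUnit_entry, if_neg, if_neg]
      · simp
      · rintro ⟨h1, h2⟩
        apply hij
        have h1' := congrArg P.blk h1
        have h2' := congrArg P.blk h2
        simp only [P.blk_opp] at h1' h2'
        omega
      · rintro ⟨rfl, rfl⟩
        rw [P.blk_opp] at hij
        omega
  rw [symbol, this, map_zero, mul_zero]

theorem symbol_symm (Λ : Module.Dual F (nilradical F P)) (a b : Idx s n) :
    symbol Λ b a = formSign F s * symbol Λ a b := by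
  have : skewPart F P (matrixUnit F P (opp b) a) =
      (formSign F s * sgn F a * sgn F b) • skewPart F P (matrixUnit F P (opp a) b) := by
    apply Subtype.ext
    ext i j
    change (skewPart F P (matrixUnit F P (opp b) a)).1 i j =
      (formSign F s * sgn F a * sgn F b) * (skewPart F P (matrixUnit F P (opp a) b)).1 i j
    rw [skewPart_entry, skewPart_entry]
    split_ifs with hij
    · simp
    simp only [matrixUnit_entry]
    have e : ∀ p q : Idx s n, opp p = opp q ↔ p = q := fun p q => (oppEquiv s n).injective.eq_iff
    have e' : ∀ p q : Idx s n, opp p = q ↔ p = opp q := fun p q =>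
      ⟨fun h => by rw [← h, opp_opp], fun h => by rw [h, opp_opp]⟩
    simp only [e, e']
    have c1 : (if i = opp b ∧ j = a then (1 : F) else 0) =
      (if j = a ∧ i = opp b then (1 : F) else 0) := by simp only [and_comm]
    have c2 : (if i = opp a ∧ j = b then (1 : F) else 0) =
      (if j = b ∧ i = opp a then (1 : F) else 0) := by simp only [and_comm]
    rw [c1, c2]
    have f := formSign_mul_self (F := F) (s := s)
    have fa := sgn_mul_self (F := F) a
    have fb := sgn_mul_self (F := F) b
    by_cases h1 : j = a ∧ i = opp b
    · obtain ⟨rfl, rfl⟩ := h1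
      rw [sgn_opp]
      by_cases h2 : j = b ∧ opp b = opp j
      · obtain ⟨rfl, -⟩ := h2
        simp only [and_self, if_true]
        linear_combination (-(sgn F j ^ 2 + 1)) * fa - sgn F j ^ 4 * f
      · rw [if_neg h2, if_pos ⟨rfl, rfl⟩]
        linear_combination (-1 : F) * fa - sgn F j ^ 2 * fb - sgn F j ^ 2 * sgn F b ^ 2 * f
    · rw [if_neg h1]
      by_cases h2 : j = b ∧ i = opp a
      · obtain ⟨rfl, rfl⟩ := h2
        rw [if_pos ⟨rfl, rfl⟩, sgn_opp]
        ring
      · rw [if_neg h2]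
        ring
  rw [symbol, this, map_smul, smul_eq_mul, symbol]
  linear_combination (formSign F s * sgn F a * Λ (skewPart F P (matrixUnit F P (opp a) b))) *
    sgn_mul_self (F := F) b

theorem symbol_ne_zero_comm {Λ : Module.Dual F (nilradical F P)} {a b : Idx s n} :
    symbol Λ b a ≠ 0 ↔ symbol Λ a b ≠ 0 := by
  rw [symbol_symm]
  simp [formSign_ne_zero]

/-- The action of the contracted group on symbols. -/
theorem symbol_smul (g : ContractedGL F P) (Λ : Module.Dual F (nilradical F P)) {a b : Idx s n}
    (h : P.blk a + P.blk b ≠ 0) :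
    symbol (g • Λ) a b = ∑ p, ∑ q,
      if P.deg a p + P.pairDeg a b + P.deg b q = P.pairDeg p q then
        (g : ContractedAlgebra F P) a p * (g : ContractedAlgebra F P) b q * symbol Λ p q
      else 0 := by
  have hE : ∀ i j, P.blk i = P.blk j → matrixUnit F P (opp a) b i j = 0 := by
    intro i j hij
    rw [matrixUnit_entry, if_neg]
    rintro ⟨rfl, rfl⟩
    rw [P.blk_opp] at hij
    omega
  rw [symbol, smul_skewPart g Λ hE, apply_skewPart, Finset.mul_sum]
  refine Finset.sum_congr rfl fun p _ => ?_
  rw [Finset.mul_sum]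
  refine Finset.sum_congr rfl fun q _ => ?_
  have e1 : (star (g : ContractedAlgebra F P) * matrixUnit F P (opp a) b) (opp p) b =
      if P.deg a p + P.pairDeg a b = P.pairDeg p b then
        sgn F p * sgn F a * (g : ContractedAlgebra F P) a p else 0 := by
    rw [mul_entry, Finset.sum_eq_single (opp a)]
    · rw [deg_opp, deg_opp_left, deg_opp_left, star_entry, sgn_opp_mul, opp_opp, opp_opp,
        matrixUnit_entry]
      simp
    · intro r _ hr
      simp [matrixUnit_entry, hr]
    · simp
  have e2 : ∀ t, t ≠ b →
      (star (g : ContractedAlgebra F P) * matrixUnit F P (opp a) b) (opp p) t = 0 := by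
    intro t ht
    rw [mul_entry]
    exact Finset.sum_eq_zero fun r _ => by simp [matrixUnit_entry, ht]
  have e3 : (star (g : ContractedAlgebra F P) * matrixUnit F P (opp a) b * g) (opp p) q =
      if P.deg a p + P.pairDeg a b + P.deg b q = P.pairDeg p q then
        sgn F p * sgn F a * (g : ContractedAlgebra F P) a p * (g : ContractedAlgebra F P) b q
      else 0 := by
    rw [mul_entry, Finset.sum_eq_single b]
    · rw [deg_opp_left, deg_opp_left, e1]
      have h1 := deg_le P (opp p) (opp a) b
      have h2 := deg_le P (opp p) b q
      rw [deg_opp, deg_opp_left, deg_opp_left] at h1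
      rw [deg_opp_left, deg_opp_left] at h2
      by_cases c : P.deg a p + P.pairDeg a b + P.deg b q = P.pairDeg p q
      · rw [if_pos c, if_pos (by omega), if_pos (by omega)]
      · rw [if_neg c]
        split_ifs with c1 c2
        · omega
        · simp
        · rfl
    · intro t _ ht
      rw [e2 t ht]
      simp
    · simp
  rw [e3]
  split_ifs
  · have fa := sgn_mul_self (F := F) a
    have fp := sgn_mul_self (F := F) p
    linear_combination ((g : ContractedAlgebra F P) a p * (g : ContractedAlgebra F P) b q *
      symbol Λ p q * sgn F p * sgn F p) * fa + ((g : ContractedAlgebra F P) a p *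
      (g : ContractedAlgebra F P) b q * symbol Λ p q) * fp
  · simp

end

section

variable {s : Series} {n : ℕ} {F : Type*} [Field F] {P : SymmetricPartition s n}

/-- The nilpotent matrix whose only nonzero column is the column `b`, with entries `t`. -/
def columnMatrix (P : SymmetricPartition s n) (b : Idx s n) (t : Idx s n → F) :
    ContractedAlgebra F P :=
  Matrix.of fun x p => if p = b then t x else 0

theorem columnMatrix_mul_self {b : Idx s n} {t : Idx s n → F} (hb : t b = 0) :
    columnMatrix P b t * columnMatrix P b t = 0 := by
  ext x p
  rw [mul_entry]
  change _ = (0 : F)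
  refine Finset.sum_eq_zero fun r _ => ?_
  have : columnMatrix P b t x r * columnMatrix P b t r p = 0 := by
    change (if r = b then t x else 0) * (if p = b then t r else 0) = 0
    by_cases h : r = b
    · simp [h, hb]
    · simp [h]
  rw [this]
  simp

/-- The unit `1 + ∑ t x E_{x b}`. -/
def transvection (P : SymmetricPartition s n) (b : Idx s n) (t : Idx s n → F) (hb : t b = 0) :
    ContractedGL F P where
  val := 1 + columnMatrix P b t
  inv := 1 - columnMatrix P b t
  val_inv := by
    rw [mul_sub, add_mul, add_mul, columnMatrix_mul_self hb]
    simp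
  inv_val := by
    rw [mul_add, sub_mul, sub_mul, columnMatrix_mul_self hb]
    simp

theorem transvection_entry (b : Idx s n) (t : Idx s n → F) (hb : t b = 0) (x p : Idx s n) :
    (transvection P b t hb : ContractedAlgebra F P) x p =
      (if x = p then 1 else 0) + if p = b then t x else 0 := by
  change (1 : ContractedAlgebra F P) x p + _ = _
  rw [one_entry]
  rfl

theorem symbol_transvection_smul (b : Idx s n) (t : Idx s n → F) (hb : t b = 0)
    (Λ : Module.Dual F (nilradical F P)) {x y : Idx s n} (h : P.blk x + P.blk y ≠ 0) :
    symbol (transvection P b t hb • Λ) x y = symbol Λ x y +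
      (if P.deg x b + P.pairDeg x y = P.pairDeg b y then t x * symbol Λ b y else 0) +
      (if P.pairDeg x y + P.deg y b = P.pairDeg x b then t y * symbol Λ x b else 0) +
      (if P.deg x b + P.pairDeg x y + P.deg y b = P.pairDeg b b then
        t x * t y * symbol Λ b b else 0) := by
  have key : ∀ (x : Idx s n) (f : Idx s n → F),
      ∑ p, (transvection P b t hb : ContractedAlgebra F P) x p * f p = f x + t x * f b := by
    intro x f
    simp only [transvection_entry, add_mul, Finset.sum_add_distrib, ite_mul, one_mul, zero_mul,
      Finset.sum_ite_eq, Finset.sum_ite_eq', Finset.mem_univ, if_true]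
  rw [symbol_smul _ _ h]
  have e : ∀ p q, (if P.deg x p + P.pairDeg x y + P.deg y q = P.pairDeg p q then
        (transvection P b t hb : ContractedAlgebra F P) x p *
          (transvection P b t hb : ContractedAlgebra F P) y q * symbol Λ p q else 0) =
      (transvection P b t hb : ContractedAlgebra F P) x p *
        ((transvection P b t hb : ContractedAlgebra F P) y q *
        if P.deg x p + P.pairDeg x y + P.deg y q = P.pairDeg p q then symbol Λ p q else 0) := by
    intro p q
    split_ifs <;> ring
  simp only [e, ← Finset.mul_sum]
  rw [key]
  simp only [key, deg_self, zero_add, add_zero, if_true]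
  simp only [mul_add, mul_ite, mul_zero, mul_assoc]
  ring

/-- The product of a permutation matrix and an invertible diagonal matrix. -/
def monomialUnit (w : Equiv.Perm (Idx s n)) (hw : w ∈ leviWeylGroup P) (v : Idx s n → Fˣ) :
    ContractedGL F P where
  val := Matrix.of fun a p => if a = w p then (v p : F) else 0
  inv := Matrix.of fun p a => if a = w p then (↑(v p)⁻¹ : F) else 0
  val_inv := by
    ext a c
    change (∑ p, if P.deg a p + P.deg p c = P.deg a c then
      (if a = w p then (v p : F) else 0) * (if c = w p then (↑(v p)⁻¹ : F) else 0) else 0) =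
      (1 : ContractedAlgebra F P) a c
    rw [one_entry]
    obtain ⟨p, rfl⟩ := w.surjective a
    rw [Finset.sum_eq_single p]
    · by_cases h : w p = c
      · subst h
        have := hw p
        simp [SymmetricPartition.deg, this]
      · rw [if_neg h, if_neg (Ne.symm h)]
        simp
    · intro r _ hr
      rw [if_neg (fun e => hr (w.injective e).symm)]
      simp
    · simp
  inv_val := by
    ext p r
    change (∑ a, if P.deg p a + P.deg a r = P.deg p r then
      (if a = w p then (↑(v p)⁻¹ : F) else 0) * (if a = w r then (v r : F) else 0) else 0) =
      (1 : ContractedAlgebra F P) p r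
    rw [one_entry]
    rw [Finset.sum_eq_single (w p)]
    · have := hw p
      by_cases h : p = r
      · subst h
        simp [SymmetricPartition.deg, this]
      · rw [if_neg h, if_neg (fun e => h (w.injective e) : ¬ w p = w r)]
        simp
    · intro a _ ha
      rw [if_neg ha]
      simp
    · simp

theorem symbol_monomialUnit_smul {w : Equiv.Perm (Idx s n)} (hw : w ∈ leviWeylGroup P)
    (v : Idx s n → Fˣ) (Λ : Module.Dual F (nilradical F P)) (x y : Idx s n) :
    symbol (monomialUnit w hw v • Λ) (w x) (w y) = v x * v y * symbol Λ x y := by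
  have hx : P.blk (w x) = P.blk x := hw x
  have hy : P.blk (w y) = P.blk y := hw y
  by_cases h : P.blk x + P.blk y = 0
  · rw [symbol_eq_zero _ h, symbol_eq_zero _ (by rw [hx, hy, h]), mul_zero]
  have e : ∀ x p, (monomialUnit w hw v : ContractedAlgebra F P) (w x) p =
      if x = p then (v p : F) else 0 := by
    intro x p
    change (if w x = w p then (v p : F) else 0) = _
    simp only [w.injective.eq_iff]
  rw [symbol_smul _ _ (by rw [hx, hy]; exact h), Finset.sum_eq_single x, Finset.sum_eq_single y]
  · rw [e, e, if_pos rfl, if_pos rfl, if_pos]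
    simp [SymmetricPartition.deg, SymmetricPartition.pairDeg, hx, hy]
  · intro q _ hq
    rw [e y, if_neg hq.symm]
    simp
  · simp
  · intro p _ hp
    refine Finset.sum_eq_zero fun q _ => ?_
    rw [e x, if_neg hp.symm]
    simp
  · simp

/-- A bound for the absolute values of the numbers of the segments. -/
def SymmetricPartition.bound (P : SymmetricPartition s n) : ℤ := ∑ a, |P.blk a|

theorem abs_blk_le_bound (a : Idx s n) : |P.blk a| ≤ P.bound :=
  Finset.single_le_sum (f := fun a => |P.blk a|) (fun _ _ => abs_nonneg _) (Finset.mem_univ a)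

/-- The length of the position `(-a, b)`: the number of steps from the segment of `-a` to the
segment of `b`, when the segments are passed in descending cyclic order. -/
def SymmetricPartition.pairLen (P : SymmetricPartition s n) (a b : Idx s n) : ℤ :=
  if 0 < P.blk a + P.blk b then 2 * P.bound + 1 - (P.blk a + P.blk b) else -(P.blk a + P.blk b)

theorem pairLen_comm (a b : Idx s n) : P.pairLen a b = P.pairLen b a := by
  unfold SymmetricPartition.pairLen
  rw [add_comm]

theorem pairDeg_comm (a b : Idx s n) : P.pairDeg a b = P.pairDeg b a := by
  unfold SymmetricPartition.pairDeg
  rw [add_comm]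

theorem deg_add_pairDeg_of_len_le {x a b : Idx s n}
    (hl : P.pairLen x b ≤ P.pairLen a b) : P.deg x a + P.pairDeg x b = P.pairDeg a b := by
  have h1 := abs_le.1 (abs_blk_le_bound (P := P) x)
  have h2 := abs_le.1 (abs_blk_le_bound (P := P) a)
  have h3 := abs_le.1 (abs_blk_le_bound (P := P) b)
  unfold SymmetricPartition.pairLen at hl
  unfold SymmetricPartition.deg SymmetricPartition.pairDeg
  split_ifs at hl ⊢ <;> omega

/-- A longer position `(p, q)` that contributes to the position `(x, y)` under the action either has
the same segments or is strictly longer. -/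
theorem len_lt_or_blk_eq_of_deg {x y p q : Idx s n}
    (hd : P.deg x p + P.pairDeg x y + P.deg y q = P.pairDeg p q) :
    P.pairLen x y < P.pairLen p q ∨ (P.blk x = P.blk p ∧ P.blk y = P.blk q) := by
  have h1 := abs_le.1 (abs_blk_le_bound (P := P) x)
  have h2 := abs_le.1 (abs_blk_le_bound (P := P) y)
  have h3 := abs_le.1 (abs_blk_le_bound (P := P) p)
  have h4 := abs_le.1 (abs_blk_le_bound (P := P) q)
  unfold SymmetricPartition.deg SymmetricPartition.pairDeg at hd
  unfold SymmetricPartition.pairLen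
  split_ifs at hd ⊢ <;> omega

theorem len_le_of_deg {x y p q : Idx s n}
    (hd : P.deg x p + P.pairDeg x y + P.deg y q = P.pairDeg p q) :
    P.pairLen x y ≤ P.pairLen p q := by
  rcases len_lt_or_blk_eq_of_deg hd with h | ⟨h1, h2⟩
  · exact h.le
  · unfold SymmetricPartition.pairLen
    rw [h1, h2]

end

section

variable {s : Series} {n : ℕ} {F : Type*} [Field F] {P : SymmetricPartition s n}

/-- The rows with numbers in `U` contain at most one nonzero entry each, and these entries form a
direct summand of the symmetric matrix; in the symplectic case such an entry lies on the diagonal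
if its row and column belong to the same segment. -/
def IsPeeled (P : SymmetricPartition s n) (Y : Idx s n → Idx s n → F) (U : Finset (Idx s n)) :
    Prop :=
  ∀ x ∈ U, ∀ y, Y x y ≠ 0 →
    y ∈ U ∧ (∀ z, Y x z ≠ 0 → z = y) ∧ (s = Series.C → P.blk x = P.blk y → x = y)

/-- Outside of `U` all nonzero entries have length at most `N`. -/
def LenBounded (P : SymmetricPartition s n) (Y : Idx s n → Idx s n → F) (U : Finset (Idx s n))
    (N : ℤ) : Prop :=
  ∀ x y, x ∉ U → y ∉ U → Y x y ≠ 0 → P.pairLen x y ≤ N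

theorem IsPeeled.eq_zero {Y : Idx s n → Idx s n → F} {U : Finset (Idx s n)}
    (h : IsPeeled P Y U) {x y : Idx s n} (hx : x ∈ U) (hy : y ∉ U) : Y x y = 0 := by
  by_contra hne
  exact hy (h x hx y hne).1

variable {Λ : Module.Dual F (nilradical F P)} {U : Finset (Idx s n)} {N : ℤ}
  {b : Idx s n} {t : Idx s n → F}

theorem symbol_transvection_of_eq_zero (hb : t b = 0) {x y : Idx s n} (hx : t x = 0)
    (hy : t y * symbol Λ x b = 0) : symbol (transvection P b t hb • Λ) x y = symbol Λ x y := by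
  by_cases h : P.blk x + P.blk y = 0
  · rw [symbol_eq_zero _ h, symbol_eq_zero _ h]
  · rw [symbol_transvection_smul _ _ _ _ h, hx, hy]
    simp

theorem IsPeeled.transvection (h : IsPeeled P (symbol Λ) U) (hbU : b ∉ U) (hb : t b = 0)
    (ht : ∀ x ∈ U, t x = 0) : IsPeeled P (symbol (transvection P b t hb • Λ)) U := by
  have e : ∀ x ∈ U, ∀ y, symbol (ParabolicContraction.transvection P b t hb • Λ) x y =
      symbol Λ x y := fun x hx y =>
    symbol_transvection_of_eq_zero hb (ht x hx) (by rw [h.eq_zero hx hbU, mul_zero])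
  intro x hx y hy
  rw [e x hx] at hy
  obtain ⟨h1, h2, h3⟩ := h x hx y hy
  exact ⟨h1, fun z hz => h2 z (by rwa [e x hx] at hz), h3⟩

theorem LenBounded.transvection (h : LenBounded P (symbol Λ) U N) (hbU : b ∉ U) (hb : t b = 0) :
    LenBounded P (symbol (transvection P b t hb • Λ)) U N := by
  intro x y hx hy hne
  by_cases h0 : P.blk x + P.blk y = 0
  · exact absurd (symbol_eq_zero _ h0) hne
  rw [symbol_transvection_smul _ _ _ _ h0] at hne
  by_contra hlt
  apply hne
  have e1 : symbol Λ x y = 0 := by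
    by_contra c
    exact hlt (h x y hx hy c)
  have e2 : (if P.deg x b + P.pairDeg x y = P.pairDeg b y then t x * symbol Λ b y else 0) = 0 := by
    split_ifs with hd
    · by_contra c
      have := h b y hbU hy (right_ne_zero_of_mul c)
      have := len_le_of_deg (P := P) (x := x) (y := y) (p := b) (q := y)
        (by rw [deg_self, add_zero, hd])
      omega
    · rfl
  have e3 : (if P.pairDeg x y + P.deg y b = P.pairDeg x b then t y * symbol Λ x b else 0) = 0 := by
    split_ifs with hd
    · by_contra c
      have := h x b hx hbU (right_ne_zero_of_mul c)
      have := len_le_of_deg (P := P) (x := x) (y := y) (p := x) (q := b)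
        (by rw [deg_self, zero_add, hd])
      omega
    · rfl
  have e4 : (if P.deg x b + P.pairDeg x y + P.deg y b = P.pairDeg b b then
      t x * t y * symbol Λ b b else 0) = 0 := by
    split_ifs with hd
    · by_contra c
      have := h b b hbU hbU (right_ne_zero_of_mul c)
      have := len_le_of_deg (P := P) hd
      omega
    · rfl
  rw [e1, e2, e3, e4]
  simp

/-- An entry of maximal length clears the rest of its column, if the diagonal entry of its row
vanishes. -/
theorem exists_clear_column {a : Idx s n} (haU : a ∉ U) (hbU : b ∉ U)
    (hp : IsPeeled P (symbol Λ) U) (hl : LenBounded P (symbol Λ) U (P.pairLen a b))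
    (hne : symbol Λ a b ≠ 0) (haa : symbol Λ a a = 0) :
    ∃ g : ContractedGL F P, IsPeeled P (symbol (g • Λ)) U ∧
      LenBounded P (symbol (g • Λ)) U (P.pairLen a b) ∧
      (∀ x, x ≠ a → x ≠ b → symbol (g • Λ) x b = 0) ∧
      (∀ x, symbol (g • Λ) x a = symbol Λ x a) ∧ symbol (g • Λ) b b = symbol Λ b b := by
  set t : Idx s n → F := fun x => if x = a ∨ x = b then 0 else -(symbol Λ x b / symbol Λ a b)
    with ht
  have ta : t a = 0 := by simp [ht]
  have tb : t b = 0 := by simp [ht]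
  have htU : ∀ x ∈ U, t x = 0 := by
    intro x hx
    simp [ht, hp.eq_zero hx hbU]
  refine ⟨transvection P a t ta, hp.transvection haU ta htU, hl.transvection haU ta, ?_, ?_, ?_⟩
  · intro x hxa hxb
    by_cases h0 : P.blk x + P.blk b = 0
    · exact symbol_eq_zero _ h0
    rw [symbol_transvection_smul _ _ _ _ h0, tb, haa]
    by_cases hx0 : symbol Λ x b = 0
    · simp [ht, hx0]
    have hxU : x ∉ U := fun hx => hx0 (hp.eq_zero hx hbU)
    rw [if_pos (deg_add_pairDeg_of_len_le (hl x b hxU hbU hx0))]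
    simp only [ht, hxa, hxb, or_self, if_false]
    field_simp
    simp
  · intro x
    by_cases h0 : P.blk x + P.blk a = 0
    · rw [symbol_eq_zero _ h0, symbol_eq_zero _ h0]
    · rw [symbol_transvection_smul _ _ _ _ h0, ta, haa]
      simp
  · exact symbol_transvection_of_eq_zero ta tb (by rw [tb, zero_mul])

/-- An entry `(a, b)` of maximal length, with `a`, `b` in different segments, clears the diagonal
entry of its row. -/
theorem exists_clear_diagonal (h2 : (2 : F) ≠ 0) {a : Idx s n} (hab : a ≠ b) (haU : a ∉ U)
    (hbU : b ∉ U) (hblk : s = Series.C → P.blk a ≠ P.blk b)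
    (hp : IsPeeled P (symbol Λ) U) (hl : LenBounded P (symbol Λ) U (P.pairLen a b))
    (hne : symbol Λ a b ≠ 0) :
    ∃ g : ContractedGL F P, IsPeeled P (symbol (g • Λ)) U ∧
      LenBounded P (symbol (g • Λ)) U (P.pairLen a b) ∧ symbol (g • Λ) a b = symbol Λ a b ∧
      symbol (g • Λ) a a = 0 ∧ symbol (g • Λ) b b = symbol Λ b b := by
  by_cases haa : symbol Λ a a = 0
  · exact ⟨1, by rwa [one_smul], by rwa [one_smul], by rw [one_smul], by rwa [one_smul],
      by rw [one_smul]⟩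
  have hs : s = Series.C := by
    by_contra hs
    have := symbol_symm Λ a a
    rw [formSign, if_neg hs] at this
    have h3 : 2 * symbol Λ a a = 0 := by linear_combination this
    exact haa ((mul_eq_zero.1 h3).resolve_left h2)
  have hblk := hblk hs
  have hba : symbol Λ b a = symbol Λ a b := by
    rw [symbol_symm, formSign, if_pos hs, one_mul]
  have h0 : P.blk a + P.blk b ≠ 0 := fun h => hne (symbol_eq_zero _ h)
  have h0a : P.blk a + P.blk a ≠ 0 := fun h => haa (symbol_eq_zero _ h)
  have d1 : P.deg a b + P.pairDeg a a = P.pairDeg b a :=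
    deg_add_pairDeg_of_len_le (by rw [pairLen_comm b a]; exact hl a a haU haU haa)
  have d2 : symbol Λ b b ≠ 0 → P.deg a b + P.pairDeg a b ≠ P.pairDeg b b := by
    intro hbb hd
    have h3 := hl b b hbU hbU hbb
    rcases len_lt_or_blk_eq_of_deg (P := P) (x := a) (y := b) (p := b) (q := b)
      (by rw [deg_self, add_zero, hd]) with h4 | h4
    · omega
    · exact hblk h4.1
  set t : Idx s n → F := fun x => if x = a then -(symbol Λ a a / (2 * symbol Λ a b)) else 0 with ht
  have ta : t a = -(symbol Λ a a / (2 * symbol Λ a b)) := by simp [ht]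
  have tb : t b = 0 := by simp [ht, hab.symm]
  have htU : ∀ x ∈ U, t x = 0 := by
    intro x hx
    have : x ≠ a := fun h => haU (h ▸ hx)
    simp [ht, this]
  refine ⟨transvection P b t tb, hp.transvection hbU tb htU, hl.transvection hbU tb, ?_, ?_, ?_⟩
  · rw [symbol_transvection_smul _ _ _ _ h0, tb]
    have : (if P.deg a b + P.pairDeg a b = P.pairDeg b b then t a * symbol Λ b b else 0) = 0 := by
      by_cases hbb : symbol Λ b b = 0
      · simp [hbb]
      · rw [if_neg (d2 hbb)]
    rw [this]
    simp
  · rw [symbol_transvection_smul _ _ _ _ h0a, if_pos d1, if_pos (by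
      rw [add_comm, d1, pairDeg_comm])]
    have : (if P.deg a b + P.pairDeg a a + P.deg a b = P.pairDeg b b then
        t a * t a * symbol Λ b b else 0) = 0 := by
      by_cases hbb : symbol Λ b b = 0
      · simp [hbb]
      · rw [if_neg]
        rw [d1, pairDeg_comm b a, add_comm]
        exact d2 hbb
    rw [this, hba, ta]
    field_simp
    ring
  · exact symbol_transvection_of_eq_zero tb tb (by rw [tb, zero_mul])

/-- A nonzero entry of maximal length can be split off, together with its mirror image. -/
theorem exists_peel_offDiagonal (h2 : (2 : F) ≠ 0) {a : Idx s n} (hab : a ≠ b) (haU : a ∉ U)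
    (hbU : b ∉ U) (hblk : s = Series.C → P.blk a ≠ P.blk b)
    (hp : IsPeeled P (symbol Λ) U) (hl : LenBounded P (symbol Λ) U (P.pairLen a b))
    (hne : symbol Λ a b ≠ 0) :
    ∃ g : ContractedGL F P, IsPeeled P (symbol (g • Λ)) (insert a (insert b U)) := by
  obtain ⟨g₁, hp₁, hl₁, hab₁, haa₁, -⟩ := exists_clear_diagonal h2 hab haU hbU hblk hp hl hne
  have hne₁ : symbol (g₁ • Λ) b a ≠ 0 := by
    rw [symbol_ne_zero_comm, hab₁]
    exact hne
  rw [pairLen_comm] at hl₁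
  obtain ⟨g₂, hp₂, hl₂, hba₂, hbb₂, haa₂⟩ := exists_clear_diagonal h2 hab.symm hbU haU
    (fun h => (hblk h).symm) hp₁ hl₁ hne₁
  rw [haa₁] at haa₂
  rw [← hba₂, symbol_ne_zero_comm] at hne₁
  rw [pairLen_comm] at hl₂
  obtain ⟨g₃, hp₃, hl₃, hb₃, ha₃, hbb₃⟩ := exists_clear_column haU hbU hp₂ hl₂ hne₁ haa₂
  rw [hbb₂] at hbb₃
  have hne₃ : symbol (g₃ • g₂ • g₁ • Λ) b a ≠ 0 := by
    rw [ha₃, symbol_ne_zero_comm]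
    exact hne₁
  have haa₃ := (ha₃ a).trans haa₂
  rw [pairLen_comm] at hl₃
  obtain ⟨g₄, hp₄, hl₄, ha₄, hb₄, haa₄⟩ := exists_clear_column hbU haU hp₃ hl₃ hne₃ hbb₃
  rw [haa₃] at haa₄
  refine ⟨g₄ * g₃ * g₂ * g₁, ?_⟩
  simp only [mul_smul]
  set Λ' := g₄ • g₃ • g₂ • g₁ • Λ
  have ra : ∀ z, symbol Λ' a z ≠ 0 → z = b := by
    intro z hz
    rw [symbol_ne_zero_comm] at hz
    by_contra hzb
    by_cases hza : z = a
    · exact hz (hza ▸ haa₄)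
    · exact hz (ha₄ z hzb hza)
  have rb : ∀ z, symbol Λ' b z ≠ 0 → z = a := by
    intro z hz
    rw [symbol_ne_zero_comm] at hz
    by_contra hza
    rw [hb₄] at hz
    by_cases hzb : z = b
    · exact hz (hzb ▸ hbb₃)
    · exact hz (hb₃ z hza hzb)
  intro x hx y hy
  rw [Finset.mem_insert, Finset.mem_insert] at hx
  rcases hx with rfl | rfl | hx
  · obtain rfl := ra y hy
    exact ⟨by simp, ra, fun h h' => absurd h' (hblk h)⟩
  · obtain rfl := rb y hy
    exact ⟨by simp, rb, fun h h' => absurd h'.symm (hblk h)⟩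
  · obtain ⟨q1, q2, q3⟩ := hp₄ x hx y hy
    exact ⟨by simp [q1], q2, q3⟩

/-- A nonzero diagonal entry of maximal length can be split off. -/
theorem exists_peel_diagonal {a : Idx s n} (haU : a ∉ U)
    (hp : IsPeeled P (symbol Λ) U) (hl : LenBounded P (symbol Λ) U (P.pairLen a a))
    (hne : symbol Λ a a ≠ 0) :
    ∃ g : ContractedGL F P, IsPeeled P (symbol (g • Λ)) (insert a U) := by
  set t : Idx s n → F := fun x => if x = a then 0 else -(symbol Λ x a / symbol Λ a a) with ht
  have ta : t a = 0 := by simp [ht]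
  have htU : ∀ x ∈ U, t x = 0 := by
    intro x hx
    simp [ht, hp.eq_zero hx haU]
  refine ⟨transvection P a t ta, ?_⟩
  have hp' := hp.transvection haU ta htU
  have ra : ∀ z, symbol (transvection P a t ta • Λ) a z ≠ 0 → z = a := by
    intro z hz
    rw [symbol_ne_zero_comm] at hz
    by_contra hza
    apply hz
    by_cases h0 : P.blk z + P.blk a = 0
    · exact symbol_eq_zero _ h0
    rw [symbol_transvection_smul _ _ _ _ h0, ta]
    by_cases hx0 : symbol Λ z a = 0
    · simp [ht, hx0]
    have hzU : z ∉ U := fun hx => hx0 (hp.eq_zero hx haU)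
    rw [if_pos (deg_add_pairDeg_of_len_le (hl z a hzU haU hx0))]
    simp only [ht, hza, if_false]
    field_simp
    simp
  intro x hx y hy
  rw [Finset.mem_insert] at hx
  rcases hx with rfl | hx
  · obtain rfl := ra y hy
    exact ⟨by simp, ra, fun _ _ => rfl⟩
  · obtain ⟨q1, q2, q3⟩ := hp' x hx y hy
    exact ⟨by simp [q1], q2, q3⟩

theorem exists_peel (h2 : (2 : F) ≠ 0) (hp : IsPeeled P (symbol Λ) U)
    (h : ∃ x y, x ∉ U ∧ y ∉ U ∧ symbol Λ x y ≠ 0) :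
    ∃ (g : ContractedGL F P) (U' : Finset (Idx s n)), U ⊂ U' ∧ IsPeeled P (symbol (g • Λ)) U' := by
  classical
  obtain ⟨x₀, y₀, hx₀, hy₀, hne₀⟩ := h
  obtain ⟨⟨a, b⟩, hab, hmax⟩ := Finset.exists_max_image
    (Finset.univ.filter fun p : Idx s n × Idx s n => p.1 ∉ U ∧ p.2 ∉ U ∧ symbol Λ p.1 p.2 ≠ 0)
    (fun p => P.pairLen p.1 p.2) ⟨(x₀, y₀), by simp [hx₀, hy₀, hne₀]⟩
  simp only [Finset.mem_filter, Finset.mem_univ, true_and] at hab hmax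
  obtain ⟨haU, hbU, hne⟩ := hab
  have hl : LenBounded P (symbol Λ) U (P.pairLen a b) := fun x y hx hy hxy =>
    hmax (x, y) ⟨hx, hy, hxy⟩
  have diag : ∀ (Λ' : Module.Dual F (nilradical F P)) (c : Idx s n), c ∉ U →
      IsPeeled P (symbol Λ') U → LenBounded P (symbol Λ') U (P.pairLen c c) → symbol Λ' c c ≠ 0 →
      ∃ (g : ContractedGL F P) (U' : Finset (Idx s n)), U ⊂ U' ∧
        IsPeeled P (symbol (g • Λ')) U' := by
    intro Λ' c hc hp' hl' hne'
    obtain ⟨g, hg⟩ := exists_peel_diagonal hc hp' hl' hne'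
    exact ⟨g, _, Finset.ssubset_insert hc, hg⟩
  by_cases hsame : s = Series.C ∧ P.blk a = P.blk b
  · obtain ⟨hs, hblk⟩ := hsame
    have la : P.pairLen a a = P.pairLen a b := by
      unfold SymmetricPartition.pairLen
      rw [hblk]
    have lb : P.pairLen b b = P.pairLen a b := by
      unfold SymmetricPartition.pairLen
      rw [hblk]
    by_cases haa : symbol Λ a a ≠ 0
    · exact diag Λ a haU hp (la ▸ hl) haa
    by_cases hbb : symbol Λ b b ≠ 0
    · exact diag Λ b hbU hp (lb ▸ hl) hbb
    rw [not_not] at haa hbb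
    have hab : b ≠ a := fun h => hne (h ▸ haa)
    set t : Idx s n → F := fun x => if x = a then 1 else 0 with ht
    have ta : t a = 1 := by simp [ht]
    have tb : t b = 0 := by simp [ht, hab]
    have htU : ∀ x ∈ U, t x = 0 := by
      intro x hx
      have : x ≠ a := fun h => haU (h ▸ hx)
      simp [ht, this]
    obtain ⟨g, U', hU', hg⟩ := diag (transvection P b t tb • Λ) a haU (hp.transvection hbU tb htU)
      (by rw [la]; exact hl.transvection hbU tb) (by
        have h0 : P.blk a + P.blk a ≠ 0 := fun h => hne (symbol_eq_zero _ (by rw [← hblk, h]))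
        rw [symbol_transvection_smul _ _ _ _ h0, ta, haa, hbb, symbol_symm Λ a b, formSign,
          if_pos hs, if_pos, if_pos]
        · intro h
          apply mul_ne_zero h2 hne
          simp only [mul_zero, ite_self] at h
          linear_combination h
        · simp [SymmetricPartition.pairDeg, SymmetricPartition.deg, hblk]
        · simp [SymmetricPartition.pairDeg, SymmetricPartition.deg, hblk])
    exact ⟨g * transvection P b t tb, U', hU', by rwa [mul_smul]⟩
  · by_cases hab : a = b
    · subst hab
      exact diag Λ a haU hp hl hne
    · obtain ⟨g, hg⟩ := exists_peel_offDiagonal h2 hab haU hbU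
        (fun h h' => hsame ⟨h, h'⟩) hp hl hne
      refine ⟨g, _, ⟨fun x hx => by simp [hx], fun hsub => haU (hsub (by simp))⟩, hg⟩

/-- Every orbit contains a form whose symbol is monomial. -/
theorem exists_isPeeled_univ (h2 : (2 : F) ≠ 0) (Λ : Module.Dual F (nilradical F P)) :
    ∃ g : ContractedGL F P, IsPeeled P (symbol (g • Λ)) Finset.univ := by
  have main : ∀ (k : ℕ) (Λ : Module.Dual F (nilradical F P)) (U : Finset (Idx s n)),
      Uᶜ.card ≤ k → IsPeeled P (symbol Λ) U →
      ∃ g : ContractedGL F P, IsPeeled P (symbol (g • Λ)) Finset.univ := by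
    intro k
    induction k with
    | zero =>
      intro Λ U hU hp
      have : U = Finset.univ := by
        rw [← Finset.compl_eq_empty_iff]
        exact Finset.card_eq_zero.1 (by omega)
      exact ⟨1, by rw [one_smul, ← this]; exact hp⟩
    | succ k ih =>
      intro Λ U hU hp
      by_cases h : ∃ x y, x ∉ U ∧ y ∉ U ∧ symbol Λ x y ≠ 0
      · obtain ⟨g, U', hU', hg⟩ := exists_peel h2 hp h
        have hlt : U'ᶜ.card < Uᶜ.card := Finset.card_lt_card (Finset.compl_ssubset_compl.2 hU')
        obtain ⟨g', hg'⟩ := ih (g • Λ) U' (by omega) hg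
        exact ⟨g' * g, by rwa [mul_smul]⟩
      · push Not at h
        refine ⟨1, ?_⟩
        rw [one_smul]
        intro x _ y hy
        have hx : x ∈ U := by
          by_contra hx
          by_cases hyU : y ∈ U
          · exact symbol_ne_zero_comm.2 hy (hp.eq_zero hyU hx)
          · exact hy (h x y hx hyU)
        exact ⟨Finset.mem_univ _, (hp x hx y hy).2⟩
  exact main _ Λ ∅ le_rfl fun x hx => absurd hx (Finset.notMem_empty x)

end

section

theorem exists_binary_eq {F : Type*} [Field F] [Finite F] (hF : ringChar F ≠ 2) {α β : F}
    (hα : α ≠ 0) (hβ : β ≠ 0) (c : F) : ∃ x y : F, α * x ^ 2 + β * y ^ 2 = c := by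
  have := Fintype.ofFinite F
  obtain ⟨x, y, h⟩ := FiniteField.exists_root_sum_quadratic
    (Polynomial.degree_quadratic (b := 0) (c := -c) hα)
    (Polynomial.degree_quadratic (b := 0) (c := 0) hβ) (FiniteField.odd_card_of_char_ne_two hF)
  refine ⟨x, y, ?_⟩
  simp at h
  linear_combination h

theorem isSquare_mul_of_not_isSquare {F : Type*} [Field F] [Finite F] {a b : F}
    (ha : ¬IsSquare a) (hb : ¬IsSquare b) : IsSquare (a * b) := by
  classical
  have := Fintype.ofFinite F
  by_contra h
  rw [← quadraticChar_neg_one_iff_not_isSquare] at ha hb h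
  rw [map_mul, ha, hb] at h
  norm_num at h

variable {s : Series} {n : ℕ} {F : Type*} [Field F] {P : SymmetricPartition s n}
  {Λ : Module.Dual F (nilradical F P)}

theorem pos_of_blk_pos {a : Idx s n} (h : 0 < P.blk a) : 0 < a.1 := by
  by_contra h0
  have : a ≤ opp a := by
    change a.1 ≤ (opp a).1
    rw [opp_val]
    omega
  have := P.mono this
  rw [P.blk_opp] at this
  omega

theorem sgn_eq_of_blk_eq {a b : Idx s n} (h : P.blk a = P.blk b) (h0 : P.blk a ≠ 0) :
    sgn F a = sgn F b := by
  have key : ∀ c : Idx s n, P.blk c ≠ 0 → (c.1 < 0 ↔ P.blk c < 0) := by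
    intro c hc
    rcases lt_or_gt_of_ne hc with hlt | hgt
    · have := pos_of_blk_pos (P := P) (a := opp c) (by rw [P.blk_opp]; omega)
      rw [opp_val] at this
      constructor <;> intro <;> omega
    · have := pos_of_blk_pos hgt
      constructor <;> intro <;> omega
  unfold sgn
  simp only [key a h0, key b (h ▸ h0), h]

theorem symbol_transvection_single {a b : Idx s n} (hab : a ≠ b) (hblk : P.blk a = P.blk b)
    (r : F) (x y : Idx s n) :
    symbol (transvection P b (fun z => if z = a then r else 0) (if_neg hab.symm) • Λ) x y =
      symbol Λ x y + (if x = a then r else 0) * symbol Λ b y +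
      (if y = a then r else 0) * symbol Λ x b +
      (if x = a then r else 0) * (if y = a then r else 0) * symbol Λ b b := by
  by_cases h0 : P.blk x + P.blk y = 0
  · rw [symbol_eq_zero _ h0, symbol_eq_zero _ h0]
    by_cases hx : x = a <;> by_cases hy : y = a <;> subst_vars
    · have e1 : symbol Λ b y = 0 := symbol_eq_zero _ (by omega)
      have e2 : symbol Λ y b = 0 := symbol_eq_zero _ (by omega)
      have e3 : symbol Λ b b = 0 := symbol_eq_zero _ (by omega)
      simp [e1, e2, e3]
    · have e1 : symbol Λ b y = 0 := symbol_eq_zero _ (by omega)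
      simp [e1, hy]
    · have e1 : symbol Λ x b = 0 := symbol_eq_zero _ (by omega)
      simp [e1, hx]
    · simp [hx, hy]
  · rw [symbol_transvection_smul _ _ _ _ h0]
    unfold SymmetricPartition.deg SymmetricPartition.pairDeg
    by_cases hx : x = a <;> by_cases hy : y = a <;> subst_vars <;> simp [*]

/-- Two diagonal entries in the same segment form a binary quadratic form, and any value of that
form can be moved to the diagonal. -/
theorem exists_rotation {a b : Idx s n} (hab : a ≠ b) (hblk : P.blk a = P.blk b)
    (hp : IsPeeled P (symbol Λ) Finset.univ) (ha : symbol Λ a a ≠ 0) (hb : symbol Λ b b ≠ 0)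
    (r : F) (hr : symbol Λ a a + r ^ 2 * symbol Λ b b ≠ 0) :
    ∃ g : ContractedGL F P, symbol (g • Λ) a a = symbol Λ a a + r ^ 2 * symbol Λ b b ∧
      symbol (g • Λ) b b =
        symbol Λ a a * symbol Λ b b / (symbol Λ a a + r ^ 2 * symbol Λ b b) ∧
      ∀ x y, ¬(x = a ∧ y = a) → ¬(x = b ∧ y = b) → symbol (g • Λ) x y = symbol Λ x y := by
  set α := symbol Λ a a with hα
  set β := symbol Λ b b with hβ
  have ra : ∀ y, y ≠ a → symbol Λ a y = 0 := fun y hy => by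
    by_contra h
    exact hy ((hp a (Finset.mem_univ _) a ha).2.1 y h)
  have rb : ∀ y, y ≠ b → symbol Λ b y = 0 := fun y hy => by
    by_contra h
    exact hy ((hp b (Finset.mem_univ _) b hb).2.1 y h)
  have ca : ∀ y, y ≠ a → symbol Λ y a = 0 := fun y hy => by
    rw [symbol_symm, ra y hy, mul_zero]
  have cb : ∀ y, y ≠ b → symbol Λ y b = 0 := fun y hy => by
    rw [symbol_symm, rb y hy, mul_zero]
  refine ⟨transvection P a (fun z => if z = b then -(r * β / (α + r ^ 2 * β)) else 0)
    (if_neg hab) * transvection P b (fun z => if z = a then r else 0) (if_neg hab.symm), ?_⟩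
  simp only [mul_smul]
  simp only [symbol_transvection_single hab.symm hblk.symm, symbol_transvection_single hab hblk]
  have rab := ra b hab.symm
  have rba := rb a hab
  refine ⟨?_, ?_, ?_⟩
  · simp only [if_neg hab, if_true, rab, rba, ← hα, ← hβ]
    ring
  · simp only [if_neg hab.symm, if_true, rab, rba, ← hα, ← hβ]
    generalize hγ : α + r ^ 2 * β = γ at hr ⊢
    field_simp
    rw [← hγ]
    ring
  · intro x y hxa hxb
    by_cases x1 : x = a
    · subst x1
      by_cases y1 : y = b
      · subst y1
        simp only [if_neg hab, if_neg hab.symm, if_true, rab, rba, ← hα, ← hβ]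
        field_simp
        ring
      · have y2 : y ≠ x := fun h => hxa ⟨rfl, h⟩
        simp [y1, y2, hab, rb y y1]
    · by_cases x2 : x = b
      · subst x2
        by_cases y1 : y = a
        · subst y1
          simp only [if_neg hab, if_neg hab.symm, if_true, rab, rba, ← hα, ← hβ]
          field_simp
          ring
        · have y2 : y ≠ x := fun h => hxb ⟨rfl, h⟩
          simp [y1, y2, hab.symm, rb y y2, ra y y1]
      · by_cases y1 : y = a
        · subst y1
          simp [x1, x2, hab, cb x x2]
        · by_cases y2 : y = b
          · subst y2
            simp [x1, x2, hab.symm, cb x x2, ca x x1]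
          · simp [x1, x2, y1, y2]

theorem exists_fewer_nonsquares [Finite F] (hF : ringChar F ≠ 2) {a b : Idx s n} (hab : a ≠ b)
    (hblk : P.blk a = P.blk b) (hp : IsPeeled P (symbol Λ) Finset.univ)
    (ha : ¬IsSquare (symbol Λ a a * (2 * sgn F a)))
    (hb : ¬IsSquare (symbol Λ b b * (2 * sgn F b))) :
    ∃ g : ContractedGL F P, IsPeeled P (symbol (g • Λ)) Finset.univ ∧
      {x | ¬IsSquare (symbol (g • Λ) x x * (2 * sgn F x))} ⊂
        {x | ¬IsSquare (symbol Λ x x * (2 * sgn F x))} := by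
  have h2 : (2 : F) ≠ 0 := Ring.two_ne_zero hF
  have ha0 : symbol Λ a a ≠ 0 := fun h => ha (by rw [h, zero_mul]; exact IsSquare.zero)
  have hb0 : symbol Λ b b ≠ 0 := fun h => hb (by rw [h, zero_mul]; exact IsSquare.zero)
  have hs : sgn F a = sgn F b :=
    sgn_eq_of_blk_eq hblk fun h => ha0 (symbol_eq_zero _ (by omega))
  have hc : 2 * sgn F a ≠ 0 := mul_ne_zero h2 (sgn_ne_zero a)
  obtain ⟨x, y, hxy⟩ := exists_binary_eq hF ha0 hb0 (2 * sgn F a)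
  have hx : x ≠ 0 := by
    rintro rfl
    apply hb
    rw [← hs]
    exact ⟨symbol Λ b b * y, by rw [← hxy]; ring⟩
  have hval : symbol Λ a a + (y / x) ^ 2 * symbol Λ b b = 2 * sgn F a / x ^ 2 := by
    rw [← hxy]
    field_simp
  have hne : symbol Λ a a + (y / x) ^ 2 * symbol Λ b b ≠ 0 := by
    rw [hval]
    exact div_ne_zero hc (pow_ne_zero _ hx)
  obtain ⟨g, g1, g2, g3⟩ := exists_rotation hab hblk hp ha0 hb0 (y / x) hne
  have hb0' : symbol (g • Λ) b b ≠ 0 := by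
    rw [g2]
    exact div_ne_zero (mul_ne_zero ha0 hb0) hne
  have hiff : ∀ x y, symbol (g • Λ) x y ≠ 0 ↔ symbol Λ x y ≠ 0 := by
    intro x y
    by_cases c1 : x = a ∧ y = a
    · obtain ⟨rfl, rfl⟩ := c1
      exact ⟨fun _ => ha0, fun _ => by rw [g1]; exact hne⟩
    · by_cases c2 : x = b ∧ y = b
      · obtain ⟨rfl, rfl⟩ := c2
        exact ⟨fun _ => hb0, fun _ => hb0'⟩
      · rw [g3 x y c1 c2]
  have ga : IsSquare (symbol (g • Λ) a a * (2 * sgn F a)) := by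
    rw [g1, hval]
    exact ⟨2 * sgn F a / x, by ring⟩
  have gb : IsSquare (symbol (g • Λ) b b * (2 * sgn F b)) := by
    rw [g2, hval]
    obtain ⟨z, hz⟩ := isSquare_mul_of_not_isSquare ha hb
    refine ⟨z * x / (2 * sgn F a), ?_⟩
    have : z * x / (2 * sgn F a) * (z * x / (2 * sgn F a)) = (z * z) * x ^ 2 / (2 * sgn F a) ^ 2 := by
      field_simp
    rw [this, ← hz, ← hs]
    field_simp
  refine ⟨g, ?_, ?_, ?_⟩
  · intro x _ y hy
    obtain ⟨q1, q2, q3⟩ := hp x (Finset.mem_univ _) y ((hiff x y).1 hy)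
    exact ⟨q1, fun z hz => q2 z ((hiff x z).1 hz), q3⟩
  · intro z hz
    by_cases za : z = a
    · exact absurd (za ▸ ga) hz
    by_cases zb : z = b
    · exact absurd (zb ▸ gb) hz
    · rw [Set.mem_ofPred_eq, g3 z z (fun h => za h.1) (fun h => zb h.1)] at hz
      exact hz
  · intro hsub
    exact hsub ha ga

/-- Every orbit contains a form with monomial symbol such that every segment has at most one
diagonal entry in the wrong square class. -/
theorem exists_isPeeled_few_nonsquares [Finite F] (hF : ringChar F ≠ 2)
    (Λ : Module.Dual F (nilradical F P)) :
    ∃ g : ContractedGL F P, IsPeeled P (symbol (g • Λ)) Finset.univ ∧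
      ∀ a b, P.blk a = P.blk b → ¬IsSquare (symbol (g • Λ) a a * (2 * sgn F a)) →
        ¬IsSquare (symbol (g • Λ) b b * (2 * sgn F b)) → a = b := by
  have main : ∀ (k : ℕ) (Λ : Module.Dual F (nilradical F P)),
      {x | ¬IsSquare (symbol Λ x x * (2 * sgn F x))}.ncard ≤ k →
      IsPeeled P (symbol Λ) Finset.univ →
      ∃ g : ContractedGL F P, IsPeeled P (symbol (g • Λ)) Finset.univ ∧
        ∀ a b, P.blk a = P.blk b → ¬IsSquare (symbol (g • Λ) a a * (2 * sgn F a)) →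
          ¬IsSquare (symbol (g • Λ) b b * (2 * sgn F b)) → a = b := by
    intro k
    induction k with
    | zero =>
      intro Λ hk hp
      rw [Nat.le_zero, Set.ncard_eq_zero] at hk
      refine ⟨1, by rwa [one_smul], fun a b _ ha _ => ?_⟩
      rw [one_smul] at ha
      exact absurd hk (Set.Nonempty.ne_empty ⟨a, ha⟩)
    | succ k ih =>
      intro Λ hk hp
      by_cases h : ∃ a b, P.blk a = P.blk b ∧ a ≠ b ∧ ¬IsSquare (symbol Λ a a * (2 * sgn F a)) ∧
          ¬IsSquare (symbol Λ b b * (2 * sgn F b))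
      · obtain ⟨a, b, hblk, hab, ha, hb⟩ := h
        obtain ⟨g, hg, hlt⟩ := exists_fewer_nonsquares hF hab hblk hp ha hb
        have := Set.ncard_lt_ncard hlt
        obtain ⟨g', hg'⟩ := ih (g • Λ) (by omega) hg
        exact ⟨g' * g, by simpa only [mul_smul] using hg'⟩
      · refine ⟨1, by rwa [one_smul], fun a b hblk ha hb => ?_⟩
        rw [one_smul] at ha hb
        by_contra hab
        exact h ⟨a, b, hblk, hab, ha, hb⟩
  obtain ⟨g, hg⟩ := exists_isPeeled_univ (Ring.two_ne_zero hF) Λ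
  obtain ⟨g', hg'⟩ := main _ (g • Λ) le_rfl hg
  exact ⟨g' * g, by simpa only [mul_smul] using hg'⟩

theorem exists_unit_sq_mul [Finite F] {δ : Fˣ} (hδ : ¬IsSquare δ) {c z : F} (hc : c ≠ 0)
    (hz : z ≠ 0) :
    ∃ v : Fˣ, (v : F) * v * z = c ∨ (¬IsSquare (z * c) ∧ (v : F) * v * z = c * δ) := by
  have key : ∀ d : F, d ≠ 0 → IsSquare (z * d) → ∃ v : Fˣ, (v : F) * v * z = d := by
    rintro d hd ⟨r, hr⟩
    have hr0 : r ≠ 0 := by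
      rintro rfl
      rw [mul_zero] at hr
      exact mul_ne_zero hz hd hr
    refine ⟨Units.mk0 (d / r) (div_ne_zero hd hr0), ?_⟩
    rw [Units.val_mk0]
    field_simp
    linear_combination hr
  by_cases h : IsSquare (z * c)
  · obtain ⟨v, hv⟩ := key c hc h
    exact ⟨v, Or.inl hv⟩
  · have hδ' : ¬IsSquare (δ : F) := by
      rintro ⟨r, hr⟩
      have hr0 : r ≠ 0 := by
        rintro rfl
        rw [mul_zero] at hr
        exact δ.ne_zero hr
      exact hδ ⟨Units.mk0 r hr0, Units.ext (by simpa using hr)⟩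
    obtain ⟨v, hv⟩ := key (c * δ) (mul_ne_zero hc δ.ne_zero) (by
      rw [← mul_assoc]
      exact isSquare_mul_of_not_isSquare h hδ')
    exact ⟨v, Or.inr ⟨h, hv⟩⟩

theorem symbol_self_eq_zero (h2 : (2 : F) ≠ 0) (hs : s ≠ Series.C) (a : Idx s n) :
    symbol Λ a a = 0 := by
  have := symbol_symm Λ a a
  rw [formSign, if_neg hs] at this
  have h3 : 2 * symbol Λ a a = 0 := by linear_combination this
  exact (mul_eq_zero.1 h3).resolve_left h2

/-- The symbols of the forms of basic pairs. -/
structure IsNormalSymbol (P : SymmetricPartition s n) (δ : Fˣ) (Y : Idx s n → Idx s n → F) :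
    Prop where
  peeled : IsPeeled P Y Finset.univ
  lt : ∀ x y, x < y → Y x y ≠ 0 → Y x y = sgn F x
  diag : ∀ x, Y x x ≠ 0 → Y x x = 2 * sgn F x ∨ Y x x = 2 * sgn F x * δ
  unique : ∀ a b, P.blk a = P.blk b → Y a a = 2 * sgn F a * δ → Y b b = 2 * sgn F b * δ → a = b

/-- Every orbit contains a form with normalized symbol. -/
theorem exists_isNormalSymbol [Finite F] (hF : ringChar F ≠ 2) {δ : Fˣ} (hδ : ¬IsSquare δ)
    (Λ : Module.Dual F (nilradical F P)) :
    ∃ g : ContractedGL F P, IsNormalSymbol P δ (symbol (g • Λ)) := by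
  have h2 : (2 : F) ≠ 0 := Ring.two_ne_zero hF
  obtain ⟨g, hp, hu⟩ := exists_isPeeled_few_nonsquares hF Λ
  set Λ' := g • Λ
  have hv : ∀ y, ∃ v : Fˣ, (∀ x, x < y → symbol Λ' x y ≠ 0 → v * symbol Λ' x y = sgn F x) ∧
      (∀ z, y < z → symbol Λ' y z ≠ 0 → v = 1) ∧ (symbol Λ' y y ≠ 0 →
        v * v * symbol Λ' y y = 2 * sgn F y ∨
        (¬IsSquare (symbol Λ' y y * (2 * sgn F y)) ∧
          v * v * symbol Λ' y y = 2 * sgn F y * δ)) := by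
    intro y
    have uniq : ∀ x z, symbol Λ' x y ≠ 0 → symbol Λ' y z ≠ 0 → x = z := fun x z hx hz =>
      (hp y (Finset.mem_univ _) z hz).2.1 x (symbol_ne_zero_comm.1 hx)
    by_cases hx : ∃ x, x < y ∧ symbol Λ' x y ≠ 0
    · obtain ⟨x, hxy, hx⟩ := hx
      refine ⟨Units.mk0 (sgn F x / symbol Λ' x y) (div_ne_zero (sgn_ne_zero x) hx), ?_, ?_, ?_⟩
      · intro z _ hz
        have hzx : z = x := (uniq z x hz (symbol_ne_zero_comm.1 hx))
        subst hzx
        rw [Units.val_mk0]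
        field_simp
      · intro z hyz hz
        have := uniq x z hx hz
        subst this
        exact absurd hyz hxy.not_gt
      · intro hy
        have := uniq x y hx hy
        exact absurd this hxy.ne
    · by_cases hy : symbol Λ' y y ≠ 0
      · obtain ⟨v, hv⟩ := exists_unit_sq_mul hδ (mul_ne_zero h2 (sgn_ne_zero (F := F) y)) hy
        refine ⟨v, fun x hxy h => absurd ⟨x, hxy, h⟩ hx, fun z hyz hz => ?_, fun _ => hv⟩
        have := uniq y z hy hz
        exact absurd this hyz.ne
      · exact ⟨1, fun x hxy h => absurd ⟨x, hxy, h⟩ hx, fun _ _ _ => rfl, fun h => absurd h hy⟩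
  choose v v1 v2 v3 using hv
  have e : ∀ x y, symbol (monomialUnit (P := P) 1 (leviWeylGroup P).one_mem v • Λ') x y =
      v x * v y * symbol Λ' x y := symbol_monomialUnit_smul (leviWeylGroup P).one_mem v Λ'
  have e0 : ∀ x y, symbol (monomialUnit (P := P) 1 (leviWeylGroup P).one_mem v • Λ') x y ≠ 0 ↔
      symbol Λ' x y ≠ 0 := by
    intro x y
    rw [e]
    simp
  refine ⟨monomialUnit 1 (leviWeylGroup P).one_mem v * g, ?_, ?_, ?_, ?_⟩
  · rw [mul_smul]
    intro x _ y hy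
    obtain ⟨q1, q2, q3⟩ := hp x (Finset.mem_univ _) y ((e0 x y).1 hy)
    exact ⟨q1, fun z hz => q2 z ((e0 x z).1 hz), q3⟩
  · rw [mul_smul]
    intro x y hxy hy
    rw [e0] at hy
    rw [e, v2 x y hxy hy, Units.val_one, one_mul, v1 y x hxy hy]
  · rw [mul_smul]
    intro x hx
    rw [e0] at hx
    rw [e]
    rcases v3 x hx with h | ⟨-, h⟩
    · exact Or.inl h
    · exact Or.inr h
  · rw [mul_smul]
    intro a b hblk ha hb
    have key : ∀ c, v c * v c * symbol Λ' c c = 2 * sgn F c * δ →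
        ¬IsSquare (symbol Λ' c c * (2 * sgn F c)) := by
      intro c hc
      have hc0 : 2 * sgn F c ≠ 0 := mul_ne_zero h2 (sgn_ne_zero c)
      have hne : symbol Λ' c c ≠ 0 := by
        intro h0
        rw [h0, mul_zero] at hc
        exact mul_ne_zero hc0 δ.ne_zero hc.symm
      rcases v3 c hne with h | ⟨h, -⟩
      · exfalso
        rw [h] at hc
        apply hδ
        have : (δ : F) = 1 := mul_left_cancel₀ hc0 (by rw [← hc, mul_one])
        exact ⟨1, Units.ext (by simp [this])⟩
      · exact h
    rw [e] at ha hb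
    exact hu a b hblk (key a ha) (key b hb)

end

section

variable {s : Series} {n : ℕ} {F : Type*} [Field F] {P : SymmetricPartition s n}
  {Λ : Module.Dual F (nilradical F P)}

open Classical in
/-- The value of `φ` at the pair `(-x, y)`, or zero if this pair is not in `D`. -/
def RookPair.coeff (p : RookPair F P) (x y : Idx s n) : F :=
  if h : (opp x, y) ∈ p.D then p.φ ⟨_, h⟩ else 0

theorem RookPair.coeff_of_mem (p : RookPair F P) {x y : Idx s n} (h : (opp x, y) ∈ p.D) :
    p.coeff x y = p.φ ⟨_, h⟩ := dif_pos h

theorem RookPair.coeff_ne_zero (p : RookPair F P) {x y : Idx s n} :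
    p.coeff x y ≠ 0 ↔ (opp x, y) ∈ p.D := by
  unfold coeff
  by_cases h : (opp x, y) ∈ p.D <;> simp [h]

theorem isRoot_opp_iff {x y : Idx s n} :
    IsRoot (opp x, y) ↔ opp x ≠ y ∧ (x < y ∨ (s = Series.C ∧ x = y)) := by
  unfold IsRoot
  have e1 : (0 < -x.1 + y.1) ↔ x < y := by
    rw [← Subtype.coe_lt_coe]
    constructor <;> intro <;> omega
  have e2 : (-x.1 + y.1 = 0) ↔ x = y := by
    rw [Subtype.ext_iff]
    constructor <;> intro <;> omega
  simp only [opp_val, e1, e2]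

theorem RookPair.lt_or_eq (p : RookPair F P) {x y : Idx s n} (h : (opp x, y) ∈ p.D) :
    x < y ∨ (s = Series.C ∧ x = y) :=
  (isRoot_opp_iff.1 (p.isNilRoot _ h).1).2

theorem RookPair.coeff_eq_zero (p : RookPair F P) {x y : Idx s n} (h : y < x) :
    p.coeff x y = 0 := by
  by_contra hne
  rcases p.lt_or_eq (p.coeff_ne_zero.1 hne) with h' | ⟨-, rfl⟩
  · exact h.not_gt h'
  · exact lt_irrefl _ h

theorem opp_eq_iff {x y : Idx s n} : opp x = y ↔ x = opp y :=
  ⟨fun h => by rw [← h, opp_opp], fun h => by rw [h, opp_opp]⟩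

theorem RookPair.sum_eq_coeff (p : RookPair F P) (x y : Idx s n) :
    ∑ γ : {γ // γ ∈ p.D}, (p.φ γ : F) * (if γ.1 = (opp x, y) then 1 else 0) = p.coeff x y := by
  by_cases h : (opp x, y) ∈ p.D
  · rw [Finset.sum_eq_single ⟨_, h⟩]
    · rw [if_pos rfl, mul_one, p.coeff_of_mem h]
    · intro γ _ hγ
      rw [if_neg fun e => hγ (Subtype.ext e), mul_zero]
    · simp
  · rw [Finset.sum_eq_zero, RookPair.coeff, dif_neg h]
    intro γ _
    rw [if_neg, mul_zero]
    intro e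
    exact h (e ▸ γ.2)

theorem RookPair.symbol_form (p : RookPair F P) (x y : Idx s n) :
    symbol p.form x y = sgn F x * p.coeff x y + formSign F s * sgn F y * p.coeff y x := by
  have e : p.form (skewPart F P (matrixUnit F P (opp x) y)) =
      ∑ γ : {γ // γ ∈ p.D}, ((p.φ γ : F) * (if γ.1 = (opp x, y) then 1 else 0) +
        formSign F s * sgn F y * sgn F x *
          ((p.φ γ : F) * (if γ.1 = (opp y, x) then 1 else 0))) := by
    rw [RookPair.form, LinearMap.sum_apply]
    refine Finset.sum_congr rfl fun γ _ => ?_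
    rw [LinearMap.smul_apply, smul_eq_mul]
    change (p.φ γ : F) * (skewPart F P (matrixUnit F P (opp x) y)).1 γ.1.1 γ.1.2 = _
    rw [skewPart_entry, if_neg (p.isNilRoot _ γ.2).2, matrixUnit_entry, matrixUnit_entry]
    have c1 : (γ.1.1 = opp x ∧ γ.1.2 = y) ↔ γ.1 = (opp x, y) := by rw [Prod.ext_iff]
    have c2 : (opp γ.1.2 = opp x ∧ opp γ.1.1 = y) ↔ γ.1 = (opp y, x) := by
      rw [Prod.ext_iff, opp_eq_iff, opp_opp, opp_eq_iff, and_comm]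
    simp only [c1, c2]
    by_cases h : γ.1 = (opp y, x)
    · rw [if_pos h, h, sgn_opp]
      ring
    · rw [if_neg h]
      ring
  rw [symbol, e, Finset.sum_add_distrib, ← Finset.mul_sum, p.sum_eq_coeff, p.sum_eq_coeff]
  linear_combination formSign F s * sgn F y * p.coeff y x * sgn_mul_self (F := F) x

theorem RookPair.symbol_form_of_lt (p : RookPair F P) {x y : Idx s n} (h : x < y) :
    symbol p.form x y = sgn F x * p.coeff x y := by
  rw [p.symbol_form, p.coeff_eq_zero h]
  ring

theorem RookPair.symbol_form_self (p : RookPair F P) (hs : s = Series.C) (x : Idx s n) :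
    symbol p.form x x = 2 * sgn F x * p.coeff x x := by
  rw [p.symbol_form, formSign, if_pos hs]
  ring

theorem ne_one_of_not_isSquare {δ : Fˣ} (hδ : ¬IsSquare δ) : δ ≠ 1 := by
  rintro rfl
  exact hδ IsSquare.one

open Classical in
/-- Normalized symbols come from basic pairs. -/
theorem exists_isBasic_of_isNormalSymbol (h2 : (2 : F) ≠ 0) {δ : Fˣ} (hδ : ¬IsSquare δ)
    (h : IsNormalSymbol P δ (symbol Λ)) : ∃ p : RookPair F P, p.IsBasic δ ∧ p.form = Λ := by
  have hδ1 := ne_one_of_not_isSquare hδ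
  set D : Finset (Idx s n × Idx s n) :=
    Finset.univ.filter fun γ => IsRoot γ ∧ symbol Λ (opp γ.1) γ.2 ≠ 0 with hD
  have memD : ∀ γ, γ ∈ D ↔ IsRoot γ ∧ symbol Λ (opp γ.1) γ.2 ≠ 0 := by
    intro γ
    simp [hD]
  have memD' : ∀ γ ∈ D ∪ D.image prime, symbol Λ (opp γ.1) γ.2 ≠ 0 := by
    intro γ hγ
    rcases Finset.mem_union.1 hγ with hγ | hγ
    · exact ((memD γ).1 hγ).2
    · obtain ⟨β, hβ, rfl⟩ := Finset.mem_image.1 hγ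
      simp only [prime, opp_opp]
      rw [symbol_ne_zero_comm]
      exact ((memD β).1 hβ).2
  have hnil : ∀ γ ∈ D, IsNilRoot P γ := by
    intro γ hγ
    obtain ⟨h1, h3⟩ := (memD γ).1 hγ
    refine ⟨h1, fun hb => h3 (symbol_eq_zero _ ?_)⟩
    rw [P.blk_opp, hb]
    ring
  have hrow : ∀ α ∈ D ∪ D.image prime, ∀ β ∈ D ∪ D.image prime, α.1 = β.1 → α = β := by
    intro α hα β hβ e
    have h1 := memD' α hα
    have h3 := memD' β hβ
    rw [← e] at h3
    exact Prod.ext e ((h.peeled _ (Finset.mem_univ _) _ h3).2.1 _ h1)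
  have hcol : ∀ α ∈ D ∪ D.image prime, ∀ β ∈ D ∪ D.image prime, α.2 = β.2 → α = β := by
    intro α hα β hβ e
    have h1 := symbol_ne_zero_comm.2 (memD' α hα)
    have h3 := symbol_ne_zero_comm.2 (memD' β hβ)
    rw [← e] at h3
    have := (h.peeled _ (Finset.mem_univ _) _ h3).2.1 _ h1
    exact Prod.ext ((oppEquiv s n).injective this) e
  let p : RookPair F P :=
    { D := D
      isNilRoot := hnil
      row_unique := hrow
      col_unique := hcol
      φ := fun γ => if opp γ.1.1 = γ.1.2 ∧ symbol Λ (opp γ.1.1) γ.1.2 =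
        2 * sgn F (opp γ.1.1) * δ then δ else 1 }
  have hφ : ∀ γ : {γ // γ ∈ p.D}, p.φ γ = if opp γ.1.1 = γ.1.2 ∧
      symbol Λ (opp γ.1.1) γ.1.2 = 2 * sgn F (opp γ.1.1) * δ then δ else 1 := fun _ => rfl
  have hφδ : ∀ γ, p.φ γ = δ → opp γ.1.1 = γ.1.2 ∧ symbol Λ (opp γ.1.1) γ.1.2 =
      2 * sgn F (opp γ.1.1) * δ := by
    intro γ hγ
    rw [hφ] at hγ
    by_contra hc
    rw [if_neg hc] at hγ
    exact hδ1 hγ.symm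
  refine ⟨p, ⟨?_, fun hs => ⟨?_, ?_, fun k => ⟨?_, ?_⟩⟩⟩, ?_⟩
  · rintro hs γ
    rw [hφ, if_neg]
    rintro ⟨h1, -⟩
    have hr := (hnil γ.1 γ.2).1.2
    rw [← h1, opp_val] at hr
    rcases hr with hr | hr
    · omega
    · exact hs hr.1
  · intro γ
    rw [hφ]
    split_ifs
    · exact Or.inr rfl
    · exact Or.inl rfl
  · intro γ hγ
    exact (hφδ γ hγ).1.symm
  · intro γ hγ h1 h3
    have hne := ((memD γ).1 hγ).2
    have := (h.peeled _ (Finset.mem_univ _) _ hne).2.2 hs (by rw [P.blk_opp, h1, h3])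
    exact this.symm
  · rintro γ ⟨h1, h3, h4⟩ β ⟨h1', h3', h4'⟩
    obtain ⟨e, he⟩ := hφδ γ h4
    obtain ⟨e', he'⟩ := hφδ β h4'
    rw [← e] at he
    rw [← e'] at he'
    have := h.unique _ _ (by rw [P.blk_opp, P.blk_opp, h1, h1']) he he'
    have e1 := (oppEquiv s n).injective this
    exact Subtype.ext (Prod.ext e1 (by rw [← e, ← e', e1]))
  · apply symbol_injective h2
    have hlt : ∀ x y, x < y → symbol p.form x y = symbol Λ x y := by
      intro x y hxy
      rw [p.symbol_form_of_lt hxy]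
      by_cases hne : symbol Λ x y = 0
      · rw [hne]
        have : p.coeff x y = 0 := by
          by_contra hc
          have := ((memD _).1 (p.coeff_ne_zero.1 hc)).2
          rw [opp_opp] at this
          exact this hne
        rw [this, mul_zero]
      · have hm : (opp x, y) ∈ p.D := by
          refine (memD _).2 ⟨isRoot_opp_iff.2 ⟨?_, Or.inl hxy⟩, ?_⟩
          · rintro rfl
            apply hne
            apply symbol_eq_zero
            rw [P.blk_opp, add_neg_cancel]
          · rw [opp_opp]
            exact hne
        rw [p.coeff_of_mem hm, hφ, if_neg, Units.val_one, mul_one, h.lt x y hxy hne]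
        rintro ⟨e, -⟩
        rw [opp_opp] at e
        exact hxy.ne e
    intro x y
    rcases lt_trichotomy x y with hxy | rfl | hxy
    · exact hlt x y hxy
    · by_cases hs : s = Series.C
      · rw [p.symbol_form_self hs]
        by_cases hne : symbol Λ x x = 0
        · rw [hne]
          have : p.coeff x x = 0 := by
            by_contra hc
            have := ((memD _).1 (p.coeff_ne_zero.1 hc)).2
            rw [opp_opp] at this
            exact this hne
          rw [this, mul_zero]
        · have hm : (opp x, x) ∈ p.D := by
            refine (memD _).2 ⟨isRoot_opp_iff.2 ⟨?_, Or.inr ⟨hs, rfl⟩⟩, ?_⟩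
            · intro e
              have := congrArg Subtype.val e
              rw [opp_val] at this
              exact val_ne_zero hs x (by omega)
            · rw [opp_opp]
              exact hne
          rw [p.coeff_of_mem hm, hφ]
          simp only [opp_opp, true_and]
          split_ifs with hc
          · exact hc.symm
          · rw [Units.val_one, mul_one]
            exact ((h.diag x hne).resolve_right hc).symm
      · rw [symbol_self_eq_zero h2 hs, symbol_self_eq_zero h2 hs]
    · rw [symbol_symm _ y x, hlt y x hxy, ← symbol_symm]

end

section

variable {s : Series} {n : ℕ} {F : Type*} [Field F] {P : SymmetricPartition s n}
  {Λ : Module.Dual F (nilradical F P)}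

/-- The values of `φ` as a symmetric function of `(x, y)`, where `(x, y)` stands for the pair
`(-x, y)` or `(-y, x)`. -/
def RookPair.edge (p : RookPair F P) (x y : Idx s n) : F :=
  if x ≤ y then p.coeff x y else p.coeff y x

theorem RookPair.edge_comm (p : RookPair F P) (x y : Idx s n) : p.edge x y = p.edge y x := by
  unfold edge
  rcases lt_trichotomy x y with h | rfl | h
  · rw [if_pos h.le, if_neg h.not_ge]
  · rfl
  · rw [if_pos h.le, if_neg h.not_ge]

theorem RookPair.edge_of_mem (p : RookPair F P) {x y : Idx s n} (h : (opp x, y) ∈ p.D) :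
    p.edge x y = p.φ ⟨_, h⟩ := by
  have : x ≤ y := by
    rcases p.lt_or_eq h with h | ⟨-, rfl⟩
    · exact h.le
    · exact le_rfl
  rw [edge, if_pos this, p.coeff_of_mem h]

theorem RookPair.edge_ne_zero_of_le (p : RookPair F P) {x y : Idx s n} (h : x ≤ y) :
    p.edge x y ≠ 0 ↔ (opp x, y) ∈ p.D := by
  rw [edge, if_pos h, p.coeff_ne_zero]

open Classical in
theorem RookPair.mem_of_edge_ne_zero (p : RookPair F P) {x y : Idx s n} (h : p.edge x y ≠ 0) :
    (opp x, y) ∈ p.D ∪ p.D.image prime := by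
  rcases le_total x y with hxy | hxy
  · exact Finset.mem_union_left _ ((p.edge_ne_zero_of_le hxy).1 h)
  · rw [p.edge_comm, p.edge_ne_zero_of_le hxy] at h
    refine Finset.mem_union_right _ (Finset.mem_image.2 ⟨_, h, ?_⟩)
    simp [prime]

theorem RookPair.edge_unique (p : RookPair F P) {x y z : Idx s n} (hy : p.edge x y ≠ 0)
    (hz : p.edge x z ≠ 0) : y = z := by
  classical
  have := p.row_unique (opp x, y) (by convert p.mem_of_edge_ne_zero hy) (opp x, z)
    (by convert p.mem_of_edge_ne_zero hz) rfl
  exact congrArg Prod.snd this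

theorem RookPair.blk_ne_of_edge_ne_zero (p : RookPair F P) {x y : Idx s n} (h : p.edge x y ≠ 0) :
    P.blk x + P.blk y ≠ 0 := by
  have key : ∀ {x y : Idx s n}, (opp x, y) ∈ p.D → P.blk x + P.blk y ≠ 0 := by
    intro x y h
    have : P.blk (opp x) ≠ P.blk y := (p.isNilRoot _ h).2
    rw [P.blk_opp] at this
    omega
  rcases le_total x y with hxy | hxy
  · exact key ((p.edge_ne_zero_of_le hxy).1 h)
  · rw [p.edge_comm, p.edge_ne_zero_of_le hxy] at h
    rw [add_comm]
    exact key h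

theorem RookPair.eq_C_of_edge_self_ne_zero (p : RookPair F P) {x : Idx s n}
    (h : p.edge x x ≠ 0) : s = Series.C := by
  rw [p.edge_ne_zero_of_le le_rfl] at h
  exact ((p.lt_or_eq h).resolve_left (lt_irrefl x)).1

/-- The ratio of the entries of the symbol of `Λ_{D,φ}` to the values of `φ`. -/
def edgeSign (F : Type*) [Field F] (x y : Idx s n) : F :=
  if x < y then sgn F x else if y < x then formSign F s * sgn F y
    else (1 + formSign F s) * sgn F x

theorem RookPair.symbol_form_eq (p : RookPair F P) (x y : Idx s n) :
    symbol p.form x y = edgeSign F x y * p.edge x y := by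
  unfold edgeSign edge
  rcases lt_trichotomy x y with h | rfl | h
  · rw [p.symbol_form_of_lt h, if_pos h, if_pos h.le]
  · rw [p.symbol_form, if_neg (lt_irrefl x), if_neg (lt_irrefl x), if_pos le_rfl]
    ring
  · rw [symbol_symm _ y x, p.symbol_form_of_lt h, if_neg h.not_gt, if_pos h, if_neg h.not_ge]
    ring

theorem edgeSign_ne_zero {x y : Idx s n} (h : x ≠ y) : edgeSign F x y ≠ 0 := by
  unfold edgeSign
  rcases lt_or_gt_of_ne h with h | h
  · rw [if_pos h]
    exact sgn_ne_zero x
  · rw [if_neg h.not_gt, if_pos h]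
    exact mul_ne_zero formSign_ne_zero (sgn_ne_zero y)

theorem edgeSign_comm {x y : Idx s n} (h : x ≠ y) :
    edgeSign F y x = formSign F s * edgeSign F x y := by
  have key : ∀ {x y : Idx s n}, x < y → edgeSign F y x = formSign F s * edgeSign F x y := by
    intro x y h
    unfold edgeSign
    rw [if_neg h.not_gt, if_pos h, if_pos h]
  rcases lt_or_gt_of_ne h with h | h
  · exact key h
  · rw [key h, ← mul_assoc, formSign_mul_self, one_mul]

theorem edgeSign_self (hs : s = Series.C) (x : Idx s n) : edgeSign F x x = 2 * sgn F x := by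
  unfold edgeSign formSign
  rw [if_neg (lt_irrefl x), if_neg (lt_irrefl x), if_pos hs]
  ring

theorem RookPair.symbol_form_ne_zero (h2 : (2 : F) ≠ 0) (p : RookPair F P) {x y : Idx s n} :
    symbol p.form x y ≠ 0 ↔ p.edge x y ≠ 0 := by
  rw [p.symbol_form_eq]
  refine ⟨fun h => right_ne_zero_of_mul h, fun h => mul_ne_zero ?_ h⟩
  by_cases hxy : x = y
  · subst hxy
    rw [edgeSign_self (p.eq_C_of_edge_self_ne_zero h)]
    exact mul_ne_zero h2 (sgn_ne_zero x)
  · exact edgeSign_ne_zero hxy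

/-- If a permutation from `W_L` carries the edges of `p₁` to those of `p₂`, then the forms lie in
the same orbit. -/
theorem exists_smul_form_eq (h2 : (2 : F) ≠ 0) {p₁ p₂ : RookPair F P} {w : Equiv.Perm (Idx s n)}
    (hw : w ∈ leviWeylGroup P) (h : ∀ x y, p₂.edge (w x) (w y) = p₁.edge x y) :
    ∃ g : ContractedGL F P, g • p₁.form = p₂.form := by
  have hv : ∀ y, ∃ v : Fˣ,
      (∀ x, x < y → p₁.edge x y ≠ 0 → v * edgeSign F x y = edgeSign F (w x) (w y)) ∧
      (∀ z, y ≤ z → p₁.edge y z ≠ 0 → v = 1) := by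
    intro y
    by_cases hx : ∃ x, x < y ∧ p₁.edge x y ≠ 0
    · obtain ⟨x, hxy, hx⟩ := hx
      rw [p₁.edge_comm] at hx
      refine ⟨Units.mk0 (edgeSign F (w x) (w y) / edgeSign F x y)
        (div_ne_zero (edgeSign_ne_zero (w.injective.ne hxy.ne)) (edgeSign_ne_zero hxy.ne)), ?_, ?_⟩
      · intro z _ hz
        rw [p₁.edge_comm] at hz
        have := p₁.edge_unique hx hz
        subst this
        rw [Units.val_mk0, div_mul_cancel₀ _ (edgeSign_ne_zero hxy.ne)]
      · intro z hz hne
        have := p₁.edge_unique hx hne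
        subst this
        exact absurd hxy hz.not_gt
    · exact ⟨1, fun x hxy hne => absurd ⟨x, hxy, hne⟩ hx, fun _ _ _ => rfl⟩
  choose v v1 v2 using hv
  refine ⟨monomialUnit w hw v, symbol_injective h2 fun a b => ?_⟩
  obtain ⟨x, rfl⟩ := w.surjective a
  obtain ⟨y, rfl⟩ := w.surjective b
  rw [symbol_monomialUnit_smul, p₁.symbol_form_eq, p₂.symbol_form_eq, h]
  by_cases hne : p₁.edge x y = 0
  · simp [hne]
  rw [← mul_assoc]
  congr 1
  have key : ∀ {x y : Idx s n}, x < y → p₁.edge x y ≠ 0 →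
      (v x : F) * v y * edgeSign F x y = edgeSign F (w x) (w y) := by
    intro x y hxy hne
    rw [v2 x y hxy.le hne, Units.val_one, one_mul, v1 y x hxy hne]
  rcases lt_trichotomy x y with hxy | rfl | hxy
  · exact key hxy hne
  · have hs := p₁.eq_C_of_edge_self_ne_zero hne
    have hb := p₁.blk_ne_of_edge_ne_zero hne
    rw [v2 x x le_rfl hne, edgeSign_self hs, edgeSign_self hs,
      sgn_eq_of_blk_eq (F := F) (P := P) (a := w x) (b := x) (hw x) (by rw [hw x]; omega)]
    simp
  · rw [p₁.edge_comm] at hne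
    have := key hxy hne
    rw [edgeSign_comm hxy.ne, edgeSign_comm (w.injective.ne hxy.ne), ← this]
    ring

/-- Conjugation of a permutation by `i ↦ -i`. -/
def oppConj (w : Equiv.Perm (Idx s n)) : Equiv.Perm (Idx s n) :=
  (oppEquiv s n).trans (w.trans (oppEquiv s n))

theorem oppConj_apply (w : Equiv.Perm (Idx s n)) (x : Idx s n) :
    oppConj w x = opp (w (opp x)) := rfl

theorem oppConj_oppConj (w : Equiv.Perm (Idx s n)) : oppConj (oppConj w) = w := by
  ext x
  simp [oppConj_apply]

theorem oppConj_mem {w : Equiv.Perm (Idx s n)} (hw : w ∈ leviWeylGroup P) :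
    oppConj w ∈ leviWeylGroup P := by
  intro x
  rw [oppConj_apply, P.blk_opp, hw (opp x), P.blk_opp, neg_neg]

theorem weylActRoot_oppConj (w : Equiv.Perm (Idx s n)) (x y : Idx s n) :
    weylActRoot (oppConj w) (opp x, y) =
      if w x ≤ w y then (opp (w x), w y) else (opp (w y), w x) := by
  unfold weylActRoot
  simp only [oppConj_apply, opp_opp, opp_val, prime]
  have : (0 ≤ -(w x).1 + (w y).1) ↔ w x ≤ w y := by
    rw [← Subtype.coe_le_coe]
    constructor <;> intro <;> omega
  simp only [this]

/-- Membership in a common `W_L`-orbit in terms of edges. -/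
theorem RookPair.weylConj_iff (p₁ p₂ : RookPair F P) : p₁.WeylConj p₂ ↔
    ∃ w ∈ leviWeylGroup P, ∀ x y, p₂.edge (w x) (w y) = p₁.edge x y := by
  constructor
  · rintro ⟨w', hw', e, he⟩
    set w := oppConj w' with hw
    have hw'' : w' = oppConj w := by rw [hw, oppConj_oppConj]
    rw [hw''] at he
    refine ⟨w, oppConj_mem hw', ?_⟩
    have key : ∀ x y, (h : (opp x, y) ∈ p₁.D) → p₂.edge (w x) (w y) = p₁.edge x y := by
      intro x y h
      obtain ⟨he1, he2⟩ := he ⟨_, h⟩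
      rw [weylActRoot_oppConj] at he1
      rw [p₁.edge_of_mem h, ← he2]
      have hmem := (e ⟨_, h⟩).2
      split_ifs at he1 with hle
      · rw [he1] at hmem
        rw [p₂.edge_of_mem hmem]
        congr 2
        exact Subtype.ext he1.symm
      · rw [he1] at hmem
        rw [p₂.edge_comm, p₂.edge_of_mem hmem]
        congr 2
        exact Subtype.ext he1.symm
    have zero : ∀ a b x y, (h : (opp a, b) ∈ p₂.D) → w x = a → w y = b → p₁.edge x y ≠ 0 := by
      rintro a b x y h rfl rfl
      obtain ⟨⟨⟨i, j⟩, hγ⟩, hγe⟩ := e.surjective ⟨_, h⟩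
      obtain ⟨i, rfl⟩ : ∃ i', opp i' = i := ⟨opp i, opp_opp i⟩
      have hne : p₁.edge i j ≠ 0 := by
        rw [p₁.edge_of_mem hγ]
        exact Units.ne_zero _
      obtain ⟨he1, -⟩ := he ⟨_, hγ⟩
      rw [hγe, weylActRoot_oppConj] at he1
      have oinj : ∀ {a b : Idx s n}, opp a = opp b → a = b := fun h => (oppEquiv s n).injective h
      split_ifs at he1 with hle
      · obtain ⟨e1, e2⟩ := Prod.ext_iff.1 he1
        rw [w.injective (oinj e1), w.injective e2]
        exact hne
      · obtain ⟨e1, e2⟩ := Prod.ext_iff.1 he1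
        rw [w.injective (oinj e1), w.injective e2, p₁.edge_comm]
        exact hne
    intro x y
    by_cases h : p₁.edge x y = 0
    · rw [h]
      by_contra hne
      rcases le_total (w x) (w y) with hle | hle
      · exact zero _ _ x y ((p₂.edge_ne_zero_of_le hle).1 hne) rfl rfl h
      · rw [p₂.edge_comm] at hne
        rw [p₁.edge_comm] at h
        exact zero _ _ y x ((p₂.edge_ne_zero_of_le hle).1 hne) rfl rfl h
    · rcases le_total x y with hle | hle
      · exact key x y ((p₁.edge_ne_zero_of_le hle).1 h)
      · rw [p₁.edge_comm] at h
        rw [p₁.edge_comm, p₂.edge_comm]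
        exact key y x ((p₁.edge_ne_zero_of_le hle).1 h)
  · rintro ⟨w, hw, h⟩
    have hmem : ∀ γ : {γ // γ ∈ p₁.D}, ∃ hm : weylActRoot (oppConj w) γ.1 ∈ p₂.D,
        p₂.φ ⟨_, hm⟩ = p₁.φ γ := by
      rintro ⟨⟨x, y⟩, hγ⟩
      obtain ⟨x, rfl⟩ : ∃ x', opp x' = x := ⟨opp x, opp_opp x⟩
      have h1 := h x y
      rw [p₁.edge_of_mem hγ] at h1
      have hne : p₂.edge (w x) (w y) ≠ 0 := by
        rw [h1]
        exact Units.ne_zero _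
      rw [weylActRoot_oppConj]
      split_ifs with hle
      · have hm := (p₂.edge_ne_zero_of_le hle).1 hne
        rw [p₂.edge_of_mem hm] at h1
        exact ⟨hm, Units.ext h1⟩
      · rw [p₂.edge_comm] at hne h1
        have hm := (p₂.edge_ne_zero_of_le (le_of_not_ge hle)).1 hne
        rw [p₂.edge_of_mem hm] at h1
        exact ⟨hm, Units.ext h1⟩
    let f : {γ // γ ∈ p₁.D} → {γ // γ ∈ p₂.D} := fun γ => ⟨_, (hmem γ).1⟩
    have hf : Function.Bijective f := by
      constructor
      · rintro ⟨⟨x, y⟩, hγ⟩ ⟨⟨x', y'⟩, hγ'⟩ he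
        obtain ⟨x, rfl⟩ : ∃ z, opp z = x := ⟨opp x, opp_opp x⟩
        obtain ⟨x', rfl⟩ : ∃ z, opp z = x' := ⟨opp x', opp_opp x'⟩
        have he1 : weylActRoot (oppConj w) (opp x, y) = weylActRoot (oppConj w) (opp x', y') :=
          congrArg Subtype.val he
        rw [weylActRoot_oppConj, weylActRoot_oppConj] at he1
        have oinj : ∀ {a b : Idx s n}, opp a = opp b → a = b := fun h =>
          (oppEquiv s n).injective h
        have hle : ∀ {x y}, (opp x, y) ∈ p₁.D → x ≤ y := by
          intro x y h
          rcases p₁.lt_or_eq h with h | ⟨-, rfl⟩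
          · exact h.le
          · exact le_rfl
        have l1 := hle hγ
        have l2 := hle hγ'
        have : x = x' ∧ y = y' := by
          split_ifs at he1 <;>
          · obtain ⟨e1, e2⟩ := Prod.ext_iff.1 he1
            have h1 := w.injective (oinj e1)
            have h2 := w.injective e2
            clear he1 e1 e2
            subst h1 h2
            first
              | exact ⟨rfl, rfl⟩
              | exact ⟨le_antisymm l1 l2, le_antisymm l2 l1⟩
        obtain ⟨rfl, rfl⟩ := this
        rfl
      · rintro ⟨⟨a, b⟩, hγ⟩
        obtain ⟨a, rfl⟩ : ∃ z, opp z = a := ⟨opp a, opp_opp a⟩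
        obtain ⟨x, rfl⟩ := w.surjective a
        obtain ⟨y, rfl⟩ := w.surjective b
        have hle : w x ≤ w y := by
          rcases p₂.lt_or_eq hγ with h | ⟨-, h⟩
          · exact h.le
          · exact h.le
        have hne : p₁.edge x y ≠ 0 := by
          rw [← h, p₂.edge_of_mem hγ]
          exact Units.ne_zero _
        rcases le_total x y with hxy | hxy
        · refine ⟨⟨_, (p₁.edge_ne_zero_of_le hxy).1 hne⟩, Subtype.ext ?_⟩
          change weylActRoot (oppConj w) (opp x, y) = _
          rw [weylActRoot_oppConj, if_pos hle]
        · rw [p₁.edge_comm] at hne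
          refine ⟨⟨_, (p₁.edge_ne_zero_of_le hxy).1 hne⟩, Subtype.ext ?_⟩
          change weylActRoot (oppConj w) (opp y, x) = _
          rw [weylActRoot_oppConj]
          split_ifs with hle'
          · have := le_antisymm hle hle'
            simp [this]
          · rfl
    exact ⟨oppConj w, oppConj_mem hw, Equiv.ofBijective f hf,
      fun γ => ⟨rfl, (hmem γ).2⟩⟩

end

section

section Matrices

variable {ι F : Type*} [Fintype ι] [DecidableEq ι] [Field F]

open Classical in
theorem Matrix.card_support_le_of_eq_mul {T₁ T₂ G H : Matrix ι ι F} (h : T₂ = G * T₁ * H)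
    (hrow : ∀ x y z, T₂ x y ≠ 0 → T₂ x z ≠ 0 → y = z)
    (hcol : ∀ x y z, T₂ x z ≠ 0 → T₂ y z ≠ 0 → x = y) :
    (Finset.univ.filter fun j : ι × ι => T₂ j.1 j.2 ≠ 0).card ≤
      (Finset.univ.filter fun j : ι × ι => T₁ j.1 j.2 ≠ 0).card := by
  set S₁ := {j : ι × ι // T₁ j.1 j.2 ≠ 0}
  set S₂ := {j : ι × ι // T₂ j.1 j.2 ≠ 0}
  let A : Matrix ι S₁ F := Matrix.of fun i t => if i = t.1.1 then 1 else 0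
  let B : Matrix S₁ ι F := Matrix.of fun t j => if j = t.1.2 then T₁ t.1.1 t.1.2 else 0
  have hAB : A * B = T₁ := by
    ext i j
    rw [Matrix.mul_apply]
    change ∑ t : S₁, (if i = t.1.1 then 1 else 0) * (if j = t.1.2 then T₁ t.1.1 t.1.2 else 0) = _
    by_cases hij : T₁ i j = 0
    · rw [hij]
      refine Finset.sum_eq_zero fun t _ => ?_
      by_cases h1 : i = t.1.1
      · by_cases h2 : j = t.1.2
        · exact absurd (h1 ▸ h2 ▸ hij) t.2
        · simp [h2]
      · simp [h1]
    · rw [Finset.sum_eq_single (⟨(i, j), hij⟩ : S₁)]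
      · simp
      · intro t _ ht
        by_cases h1 : i = t.1.1
        · by_cases h2 : j = t.1.2
          · exact absurd (Subtype.ext (Prod.ext h1.symm h2.symm)) ht
          · simp [h2]
        · simp [h1]
      · simp
  have hsub : T₂.submatrix (fun t : S₂ => t.1.1) (fun t : S₂ => t.1.2) =
      (G * A).submatrix (fun t : S₂ => t.1.1) id * (B * H).submatrix id (fun t : S₂ => t.1.2) := by
    have e : T₂ = G * A * (B * H) := by
      rw [h, Matrix.mul_assoc G A, ← Matrix.mul_assoc A B, hAB, Matrix.mul_assoc]
    ext t u
    rw [Matrix.submatrix_apply, Matrix.mul_apply]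
    simp only [Matrix.submatrix_apply, id]
    rw [← Matrix.mul_apply, ← e]
  have hdiag : T₂.submatrix (fun t : S₂ => t.1.1) (fun t : S₂ => t.1.2) =
      Matrix.diagonal fun t : S₂ => T₂ t.1.1 t.1.2 := by
    ext t u
    rw [Matrix.submatrix_apply, Matrix.diagonal_apply]
    split_ifs with htu
    · rw [htu]
    · by_contra hne
      have e := hrow _ _ _ hne t.2
      have e' := hcol _ _ _ hne u.2
      exact htu (Subtype.ext (Prod.ext e' e.symm))
  have hrank : (T₂.submatrix (fun t : S₂ => t.1.1) (fun t : S₂ => t.1.2)).rank =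
      Fintype.card S₂ := by
    apply Matrix.rank_of_isUnit
    rw [hdiag, Matrix.isUnit_iff_isUnit_det, Matrix.det_diagonal, isUnit_iff_ne_zero,
      Finset.prod_ne_zero_iff]
    exact fun t _ => t.2
  rw [← Fintype.card_subtype, ← Fintype.card_subtype]
  calc Fintype.card S₂ = _ := hrank.symm
    _ ≤ _ := by
      rw [hsub]
      exact Matrix.rank_mul_le_left _ _
    _ ≤ Fintype.card S₁ := Matrix.rank_le_card_width _

open Classical in
/-- Congruent symmetric monomial matrices with the same positions of nonzero entries have
discriminants that differ by a square. -/
theorem Matrix.isSquare_prod_of_congr {T G : Matrix ι ι F} {r : ι → F}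
    (hT : ∀ x y z, T x y ≠ 0 → T x z ≠ 0 → y = z) (hsymm : ∀ x y, T x y ≠ 0 → T y x ≠ 0)
    (h : ∀ x y, (G * T * G.transpose) x y = r x * T x y) :
    IsSquare (∏ x ∈ Finset.univ.filter fun x => ∃ y, T x y ≠ 0, r x) := by
  set S := {x // ∃ y, T x y ≠ 0}
  set A : Matrix S S F := T.submatrix Subtype.val Subtype.val with hA
  set B : Matrix S S F := G.submatrix Subtype.val Subtype.val with hB
  have restrict : ∀ f : ι → F, (∀ x, (¬∃ y, T x y ≠ 0) → f x = 0) → ∑ x, f x = ∑ x : S, f x := by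
    intro f hf
    rw [← Finset.sum_filter_of_ne (p := fun x => ∃ y, T x y ≠ 0)]
    · exact Finset.sum_subtype _ (by simp) f
    · intro x _ hx
      by_contra hc
      exact hx (hf x hc)
  have hcongr : Matrix.diagonal (fun x : S => r x) * A = B * A * B.transpose := by
    ext x y
    rw [Matrix.diagonal_mul]
    change r x * T x y = _
    rw [← h, Matrix.mul_apply, Matrix.mul_apply, restrict]
    · refine Finset.sum_congr rfl fun q _ => ?_
      rw [Matrix.mul_apply, Matrix.mul_apply, restrict]
      · rfl
      · intro p hp
        have : T p q = 0 := by
          by_contra hc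
          exact hp ⟨q, hc⟩
        rw [this, mul_zero]
    · intro q hq
      rw [Matrix.mul_apply, Finset.sum_eq_zero, zero_mul]
      intro p _
      have : T p q = 0 := by
        by_contra hc
        exact hq ⟨p, hsymm p q hc⟩
      rw [this, mul_zero]
  have hdet : A.det ≠ 0 := by
    have hd : A * A.transpose = Matrix.diagonal fun x : S => ∑ y : S, A x y * A x y := by
      ext x z
      rw [Matrix.mul_apply, Matrix.diagonal_apply]
      split_ifs with hxz
      · rw [hxz]
        rfl
      · refine Finset.sum_eq_zero fun y _ => ?_
        by_contra hc
        exact hxz (Subtype.ext (hT y x z (hsymm x y (left_ne_zero_of_mul hc))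
          (hsymm z y (right_ne_zero_of_mul hc))))
    have hne : (A * A.transpose).det ≠ 0 := by
      rw [hd, Matrix.det_diagonal, Finset.prod_ne_zero_iff]
      rintro x -
      obtain ⟨y, hy⟩ := x.2
      rw [Finset.sum_eq_single (⟨y, x, hsymm _ _ hy⟩ : S)]
      · exact mul_ne_zero hy hy
      · intro z _ hz
        by_contra hc
        exact hz (Subtype.ext (hT x z y (left_ne_zero_of_mul hc) hy))
      · simp
    rw [Matrix.det_mul] at hne
    exact left_ne_zero_of_mul hne
  refine ⟨B.det, mul_right_cancel₀ hdet ?_⟩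
  have := congrArg Matrix.det hcongr
  rw [Matrix.det_mul, Matrix.det_mul, Matrix.det_mul, Matrix.det_diagonal,
    Matrix.det_transpose] at this
  rw [Finset.prod_subtype _ (p := fun x => ∃ y, T x y ≠ 0) (by simp) r, this]
  ring

end Matrices

/-- An inversion principle: if the products over all elements above a given one are trivial, then
so are the products over the classes. -/
@[to_additive]
theorem prod_fiber_eq_one {J C A : Type*} [Fintype J] [DecidableEq C] [CommGroup A] (κ : J → C)
    (rel : J → J → Prop) [DecidableRel rel] (len : J → ℤ) (Q : J → Prop) (f : J → A)
    (refl : ∀ i j, κ i = κ j → rel i j)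
    (lt : ∀ i j, rel i j → κ i = κ j ∨ len i < len j)
    (compat : ∀ i j k, rel i j → κ j = κ k → rel i k)
    (up : ∀ i j, Q i → rel i j → Q j)
    (h : ∀ i, Q i → ∏ j ∈ Finset.univ.filter (rel i), f j = 1) :
    ∀ i, Q i → ∏ j ∈ Finset.univ.filter (fun j => κ j = κ i), f j = 1 := by
  obtain ⟨N, hN⟩ := (Set.finite_range len).bddAbove
  have main : ∀ (m : ℕ) (i : J), (N - len i).toNat ≤ m → Q i →
      ∏ j ∈ Finset.univ.filter (fun j => κ j = κ i), f j = 1 := by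
    intro m
    induction m with
    | zero =>
      intro i hi hQ
      rw [← h i hQ]
      refine Finset.prod_congr (Finset.filter_congr fun j _ => ?_) fun _ _ => rfl
      refine ⟨fun e => refl i j e.symm, fun hr => ?_⟩
      rcases lt i j hr with e | hl
      · exact e.symm
      · have := hN ⟨j, rfl⟩
        omega
    | succ m ih =>
      intro i hi hQ
      have hs := h i hQ
      rw [← Finset.prod_filter_mul_prod_filter_not _ (fun j => κ j = κ i), Finset.filter_filter,
        Finset.filter_filter] at hs
      have e1 : Finset.univ.filter (fun j => rel i j ∧ κ j = κ i) =
          Finset.univ.filter fun j => κ j = κ i :=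
        Finset.filter_congr fun j _ => ⟨fun e => e.2, fun e => ⟨refl i j e.symm, e⟩⟩
      have e2 : ∏ j ∈ Finset.univ.filter (fun j => rel i j ∧ ¬κ j = κ i), f j = 1 := by
        rw [← Finset.prod_fiberwise_of_maps_to (g := κ)
          (t := (Finset.univ.filter (fun j => rel i j ∧ ¬κ j = κ i)).image κ)
          (fun j hj => Finset.mem_image_of_mem κ hj)]
        refine Finset.prod_eq_one fun c hc => ?_
        obtain ⟨k, hk, rfl⟩ := Finset.mem_image.1 hc
        rw [Finset.mem_filter] at hk
        obtain ⟨-, hk, hne⟩ := hk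
        have hlt := (lt i k hk).resolve_left (fun e => hne e.symm)
        have := hN ⟨k, rfl⟩
        rw [← ih k (by omega) (up i k hQ hk), Finset.filter_filter]
        refine Finset.prod_congr (Finset.filter_congr fun j _ => ?_) fun _ _ => rfl
        exact ⟨fun e => e.2, fun e => ⟨⟨compat i k j hk e.symm, by rw [e]; exact hne⟩, e⟩⟩
      rwa [e1, e2, mul_one] at hs
  exact fun i => main _ i le_rfl

variable {s : Series} {n : ℕ} {F : Type*} [Field F] {P : SymmetricPartition s n}
  {Λ : Module.Dual F (nilradical F P)}

/-- The position `(x, y)` contributes to the position `(k, l)`. -/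
def SymmetricPartition.Above (P : SymmetricPartition s n) (k l x y : Idx s n) : Prop :=
  P.deg k x + P.pairDeg k l + P.deg l y = P.pairDeg x y

instance (P : SymmetricPartition s n) (k l x y : Idx s n) : Decidable (P.Above k l x y) :=
  inferInstanceAs (Decidable (_ = _))

theorem Above.blk_ne {k l x y : Idx s n} (h : P.Above k l x y) (h0 : P.blk k + P.blk l ≠ 0) :
    P.blk x + P.blk y ≠ 0 := by
  unfold SymmetricPartition.Above SymmetricPartition.deg SymmetricPartition.pairDeg at h
  split_ifs at h <;> omega

/-- The part of a symbol above a given position. -/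
def truncation (P : SymmetricPartition s n) (k l : Idx s n) (Y : Idx s n → Idx s n → F) :
    Matrix (Idx s n) (Idx s n) F :=
  Matrix.of fun x y => if P.Above k l x y then Y x y else 0

/-- The matrix through which `g` acts on truncated symbols. -/
def truncatedMatrix (k : Idx s n) (g : ContractedAlgebra F P) : Matrix (Idx s n) (Idx s n) F :=
  Matrix.of fun a p => if P.deg k a + P.deg a p = P.deg k p then g a p else 0

theorem pairDeg_le (k l a b : Idx s n) :
    P.pairDeg a b ≤ P.deg k a + P.pairDeg k l + P.deg l b := by
  unfold SymmetricPartition.deg SymmetricPartition.pairDeg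
  split_ifs <;> omega

theorem truncation_smul (g : ContractedGL F P) {k l : Idx s n} (h0 : P.blk k + P.blk l ≠ 0) :
    truncation P k l (symbol (g • Λ)) =
      truncatedMatrix k (g : ContractedAlgebra F P) * truncation P k l (symbol Λ) *
        (truncatedMatrix l (g : ContractedAlgebra F P)).transpose := by
  ext a b
  rw [Matrix.mul_apply]
  simp only [Matrix.mul_apply, Finset.sum_mul]
  rw [Finset.sum_comm]
  have key : ∀ p q, truncatedMatrix k (g : ContractedAlgebra F P) a p *
      truncation P k l (symbol Λ) p q *
        (truncatedMatrix l (g : ContractedAlgebra F P)).transpose q b =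
      if P.Above k l a b ∧ P.Above a b p q then (g : ContractedAlgebra F P) a p *
        (g : ContractedAlgebra F P) b q * symbol Λ p q else 0 := by
    intro p q
    change (if P.deg k a + P.deg a p = P.deg k p then (g : ContractedAlgebra F P) a p else 0) *
      (if P.Above k l p q then symbol Λ p q else 0) *
      (if P.deg l b + P.deg b q = P.deg l q then (g : ContractedAlgebra F P) b q else 0) = _
    have h1 := deg_le P k a p
    have h2 := deg_le P l b q
    have h3 := pairDeg_le (P := P) k l a b
    have h4 := pairDeg_le (P := P) a b p q
    have h5 := pairDeg_le (P := P) k l p q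
    have ab (x y z t : Idx s n) : P.Above x y z t ↔
      P.deg x z + P.pairDeg x y + P.deg y t = P.pairDeg z t := Iff.rfl
    by_cases c : P.Above k l a b ∧ P.Above a b p q
    · rw [if_pos c]
      rw [ab, ab] at c
      rw [if_pos (by omega), if_pos ((ab _ _ _ _).2 (by omega)), if_pos (by omega)]
      ring
    · rw [if_neg c]
      by_cases c1 : P.deg k a + P.deg a p = P.deg k p
      · by_cases c2 : P.Above k l p q
        · by_cases c3 : P.deg l b + P.deg b q = P.deg l q
          · rw [ab] at c2
            rw [ab, ab] at c
            exact absurd (by omega) c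
          · rw [if_neg c3, mul_zero]
        · rw [if_neg c2, mul_zero, zero_mul]
      · rw [if_neg c1, zero_mul, zero_mul]
  simp only [key]
  change (if P.Above k l a b then symbol (g • Λ) a b else 0) = _
  by_cases h : P.Above k l a b
  · rw [if_pos h, symbol_smul _ _ (Above.blk_ne h h0)]
    simp only [h, true_and]
    rfl
  · simp [h]

open Classical in
/-- The number of entries in any pair of segments is an invariant of the orbit, for forms with
monomial symbol. -/
theorem card_block_eq {Λ₁ Λ₂ : Module.Dual F (nilradical F P)} {g : ContractedGL F P}
    (hg : g • Λ₁ = Λ₂)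
    (h₁ : ∀ x y z, symbol Λ₁ x y ≠ 0 → symbol Λ₁ x z ≠ 0 → y = z)
    (h₂ : ∀ x y z, symbol Λ₂ x y ≠ 0 → symbol Λ₂ x z ≠ 0 → y = z) (k l : ℤ) :
    (Finset.univ.filter fun j : Idx s n × Idx s n =>
      (P.blk j.1, P.blk j.2) = (k, l) ∧ symbol Λ₁ j.1 j.2 ≠ 0).card =
    (Finset.univ.filter fun j : Idx s n × Idx s n =>
      (P.blk j.1, P.blk j.2) = (k, l) ∧ symbol Λ₂ j.1 j.2 ≠ 0).card := by
  have ne : ∀ (Λ : Module.Dual F (nilradical F P)) (k l x y : Idx s n),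
      truncation P k l (symbol Λ) x y ≠ 0 ↔ P.Above k l x y ∧ symbol Λ x y ≠ 0 := by
    intro Λ k l x y
    change (if P.Above k l x y then symbol Λ x y else 0) ≠ 0 ↔ _
    by_cases h : P.Above k l x y <;> simp [h]
  have le : ∀ {Λ₁ Λ₂ : Module.Dual F (nilradical F P)} {g : ContractedGL F P}, g • Λ₁ = Λ₂ →
      (∀ x y z, symbol Λ₂ x y ≠ 0 → symbol Λ₂ x z ≠ 0 → y = z) →
      ∀ i : Idx s n × Idx s n, P.blk i.1 + P.blk i.2 ≠ 0 →
      (Finset.univ.filter fun j : Idx s n × Idx s n =>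
        P.Above i.1 i.2 j.1 j.2 ∧ symbol Λ₂ j.1 j.2 ≠ 0).card ≤
      (Finset.univ.filter fun j : Idx s n × Idx s n =>
        P.Above i.1 i.2 j.1 j.2 ∧ symbol Λ₁ j.1 j.2 ≠ 0).card := by
    intro Λ₁ Λ₂ g hg h i hi
    have := Matrix.card_support_le_of_eq_mul (hg ▸ truncation_smul g hi)
      (fun x y z hy hz => h x y z ((ne _ _ _ _ _).1 hy).2 ((ne _ _ _ _ _).1 hz).2)
      (fun x y z hx hy => h z x y (symbol_ne_zero_comm.1 ((ne _ _ _ _ _).1 hx).2)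
        (symbol_ne_zero_comm.1 ((ne _ _ _ _ _).1 hy).2))
    simpa only [ne] using this
  by_cases hkl : ∃ i : Idx s n × Idx s n, (P.blk i.1, P.blk i.2) = (k, l)
  swap
  · rw [Finset.filter_false_of_mem, Finset.filter_false_of_mem]
    · exact fun j _ hj => hkl ⟨j, hj.1⟩
    · exact fun j _ hj => hkl ⟨j, hj.1⟩
  obtain ⟨i, hi⟩ := hkl
  by_cases hi0 : P.blk i.1 + P.blk i.2 = 0
  · have : ∀ (Λ : Module.Dual F (nilradical F P)) (j : Idx s n × Idx s n),
        ¬((P.blk j.1, P.blk j.2) = (k, l) ∧ symbol Λ j.1 j.2 ≠ 0) := by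
      rintro Λ j ⟨hj, hne⟩
      rw [← hi, Prod.mk.injEq] at hj
      exact hne (symbol_eq_zero _ (by rw [hj.1, hj.2, hi0]))
    rw [Finset.filter_false_of_mem fun j _ => this Λ₁ j,
      Finset.filter_false_of_mem fun j _ => this Λ₂ j]
  have := sum_fiber_eq_zero (J := Idx s n × Idx s n) (A := ℤ) (fun j => (P.blk j.1, P.blk j.2))
    (fun i j => P.Above i.1 i.2 j.1 j.2) (fun j => P.pairLen j.1 j.2)
    (fun j => P.blk j.1 + P.blk j.2 ≠ 0)
    (fun j => (if symbol Λ₁ j.1 j.2 ≠ 0 then 1 else 0) - (if symbol Λ₂ j.1 j.2 ≠ 0 then 1 else 0))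
    (by
      intro i j hij
      rw [Prod.mk.injEq] at hij
      simp [SymmetricPartition.Above, SymmetricPartition.deg, SymmetricPartition.pairDeg, hij.1,
        hij.2])
    (by
      intro i j hij
      rcases len_lt_or_blk_eq_of_deg hij with h | h
      · exact Or.inr h
      · exact Or.inl (Prod.ext h.1 h.2))
    (by
      intro i j k hij hjk
      rw [Prod.mk.injEq] at hjk
      unfold SymmetricPartition.Above SymmetricPartition.deg SymmetricPartition.pairDeg at hij ⊢
      rwa [← hjk.1, ← hjk.2])
    (fun i j hi hij => Above.blk_ne hij hi)
    (by
      intro i hi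
      rw [Finset.sum_sub_distrib, ← Finset.sum_filter, ← Finset.sum_filter, Finset.filter_filter,
        Finset.filter_filter, Finset.sum_const, Finset.sum_const]
      have l1 := le hg h₂ i hi
      have l2 := le (g := g⁻¹) (Λ₁ := Λ₂) (Λ₂ := Λ₁) (by rw [← hg, inv_smul_smul]) h₁ i hi
      rw [le_antisymm l1 l2, sub_self]) i hi0
  rw [Finset.sum_sub_distrib, ← Finset.sum_filter, ← Finset.sum_filter, Finset.filter_filter,
    Finset.filter_filter, Finset.sum_const, Finset.sum_const, sub_eq_zero] at this
  simp only [hi, nsmul_eq_mul, mul_one, Nat.cast_inj] at this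
  exact this

end

section

section Combinatorics

open Classical in
/-- A partial injection that preserves colours extends to a permutation that preserves colours. -/
theorem exists_perm_extending {α C : Type*} [Finite α] (β : α → C) (R : α → α → Prop)
    (hβ : ∀ x y, R x y → β x = β y)
    (hR : ∀ x y x' y', R x y → R x' y' → (x = x' ↔ y = y')) :
    ∃ w : Equiv.Perm α, (∀ x, β (w x) = β x) ∧ ∀ x y, R x y → w x = y := by
  have he : ∀ c, ∃ e : Equiv.Perm {a // β a = c}, ∀ x y, R x.1 y.1 → e x = y := by
    intro c
    choose f hf using fun x : {x : {a // β a = c} // ∃ y, R x.1 y} => x.2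
    let e : {x : {a // β a = c} // ∃ y, R x.1 y} ≃ {y : {a // β a = c} // ∃ x, R x y.1} :=
      Equiv.ofBijective (fun x => ⟨⟨f x, by rw [← hβ _ _ (hf x), x.1.2]⟩, x.1.1, hf x⟩) (by
        constructor
        · intro x x' h
          have : f x = f x' := congrArg (fun z => z.1.1) h
          exact Subtype.ext (Subtype.ext ((hR _ _ _ _ (hf x) (hf x')).2 this))
        · rintro ⟨⟨y, hy⟩, x, hx⟩
          refine ⟨⟨⟨x, by rw [hβ _ _ hx, hy]⟩, y, hx⟩, Subtype.ext (Subtype.ext ?_)⟩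
          exact (hR _ _ _ _ (hf _) hx).1 rfl)
    refine ⟨e.extendSubtype, fun x y hxy => ?_⟩
    rw [Equiv.extendSubtype_apply_of_mem e x ⟨y, hxy⟩]
    exact Subtype.ext ((hR _ _ _ _ (hf _) hxy).1 rfl)
  choose e he using he
  refine ⟨Equiv.ofFiberEquiv (f := β) (g := β) e, fun x => Equiv.ofFiberEquiv_map e x, ?_⟩
  intro x y hxy
  have := he (β x) ⟨x, rfl⟩ ⟨y, (hβ x y hxy).symm⟩ hxy
  exact congrArg Subtype.val this

theorem exists_equiv_of_card_eq {J C : Type*} [Fintype J] [DecidableEq C] (p q : J → Prop)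
    [DecidablePred p] [DecidablePred q] (f g : J → C)
    (h : ∀ c, (Finset.univ.filter fun j => p j ∧ f j = c).card =
      (Finset.univ.filter fun j => q j ∧ g j = c).card) :
    ∃ e : {j // p j} ≃ {j // q j}, ∀ j, g (e j).1 = f j.1 := by
  have he : ∀ c, Nonempty ({a : {j // p j} // f a.1 = c} ≃ {a : {j // q j} // g a.1 = c}) := by
    intro c
    refine ⟨(Equiv.subtypeSubtypeEquivSubtypeInter p (fun j => f j = c)).trans
      ((Fintype.equivOfCardEq ?_).trans
        (Equiv.subtypeSubtypeEquivSubtypeInter q (fun j => g j = c)).symm)⟩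
    rw [Fintype.card_subtype, Fintype.card_subtype]
    exact h c
  exact ⟨Equiv.ofFiberEquiv fun c => (he c).some, fun j =>
    Equiv.ofFiberEquiv_map (f := fun a : {j // p j} => f a.1) (g := fun a : {j // q j} => g a.1)
      (fun c => (he c).some) j⟩

end Combinatorics

variable {s : Series} {n : ℕ} {F : Type*} [Field F] {P : SymmetricPartition s n}

/-- The edges of a rook pair, listed once. -/
abbrev RookPair.Edge (p : RookPair F P) : Type _ :=
  {j : Idx s n × Idx s n // j.1 ≤ j.2 ∧ p.edge j.1 j.2 ≠ 0}

theorem RookPair.Edge.ext_fst {p : RookPair F P} {j k : p.Edge} (h : j.1.1 = k.1.1) : j = k := by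
  refine Subtype.ext (Prod.ext h ?_)
  have hk := k.2.2
  rw [← h] at hk
  exact p.edge_unique j.2.2 hk

theorem RookPair.Edge.ext_snd {p : RookPair F P} {j k : p.Edge} (h : j.1.2 = k.1.2) : j = k := by
  refine Subtype.ext (Prod.ext ?_ h)
  have hj := j.2.2
  have hk := k.2.2
  rw [← h, p.edge_comm] at hk
  rw [p.edge_comm] at hj
  exact p.edge_unique hj hk

theorem RookPair.Edge.fst_eq_snd_iff {p : RookPair F P} {j k : p.Edge} :
    j.1.1 = k.1.2 ↔ j = k ∧ j.1.1 = j.1.2 := by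
  constructor
  · intro h
    have hj := j.2.2
    have hk := k.2.2
    rw [← h, p.edge_comm] at hk
    have e := p.edge_unique hj hk
    have h1 := j.2.1
    have h2 := k.2.1
    rw [← h, ← e] at h2
    have h3 := le_antisymm h1 h2
    exact ⟨RookPair.Edge.ext_fst (h3.trans e), h3⟩
  · rintro ⟨rfl, h⟩
    exact h

/-- A bijection between the edges of two rook pairs that preserves segments and loops is induced by
an element of `W_L`. -/
theorem exists_perm_of_edge_equiv {p₁ p₂ : RookPair F P} (e : p₁.Edge ≃ p₂.Edge)
    (hblk : ∀ j, P.blk (e j).1.1 = P.blk j.1.1 ∧ P.blk (e j).1.2 = P.blk j.1.2)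
    (hloop : ∀ j, (e j).1.1 = (e j).1.2 ↔ j.1.1 = j.1.2) :
    ∃ w ∈ leviWeylGroup P, (∀ x y, p₂.edge (w x) (w y) ≠ 0 ↔ p₁.edge x y ≠ 0) ∧
      ∀ x y, p₁.edge x y ≠ 0 → ∃ j : p₁.Edge, p₁.edge x y = p₁.edge j.1.1 j.1.2 ∧
        p₂.edge (w x) (w y) = p₂.edge (e j).1.1 (e j).1.2 := by
  obtain ⟨w, hw, hR⟩ := exists_perm_extending P.blk
    (fun x y => ∃ j : p₁.Edge, (x = j.1.1 ∧ y = (e j).1.1) ∨ (x = j.1.2 ∧ y = (e j).1.2))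
    (by
      rintro x y ⟨j, ⟨rfl, rfl⟩ | ⟨rfl, rfl⟩⟩
      · exact (hblk j).1.symm
      · exact (hblk j).2.symm)
    (by
      have c1 : ∀ j k : p₁.Edge, j.1.1 = k.1.1 ↔ (e j).1.1 = (e k).1.1 := fun j k =>
        ⟨fun h => by rw [RookPair.Edge.ext_fst h], fun h => by
          rw [e.injective (RookPair.Edge.ext_fst h)]⟩
      have c2 : ∀ j k : p₁.Edge, j.1.2 = k.1.2 ↔ (e j).1.2 = (e k).1.2 := fun j k =>
        ⟨fun h => by rw [RookPair.Edge.ext_snd h], fun h => by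
          rw [e.injective (RookPair.Edge.ext_snd h)]⟩
      have c3 : ∀ j k : p₁.Edge, j.1.1 = k.1.2 ↔ (e j).1.1 = (e k).1.2 := fun j k => by
        rw [RookPair.Edge.fst_eq_snd_iff (j := j) (k := k),
          RookPair.Edge.fst_eq_snd_iff (j := e j) (k := e k), hloop, e.injective.eq_iff]
      rintro x y x' y' ⟨j, ⟨rfl, rfl⟩ | ⟨rfl, rfl⟩⟩ ⟨k, ⟨rfl, rfl⟩ | ⟨rfl, rfl⟩⟩
      · exact c1 j k
      · exact c3 j k
      · rw [eq_comm, c3 k j, eq_comm]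
      · exact c2 j k)
  have w1 : ∀ j : p₁.Edge, w j.1.1 = (e j).1.1 := fun j => hR _ _ ⟨j, Or.inl ⟨rfl, rfl⟩⟩
  have w2 : ∀ j : p₁.Edge, w j.1.2 = (e j).1.2 := fun j => hR _ _ ⟨j, Or.inr ⟨rfl, rfl⟩⟩
  have key : ∀ x y, p₁.edge x y ≠ 0 → ∃ j : p₁.Edge, p₁.edge x y = p₁.edge j.1.1 j.1.2 ∧
        p₂.edge (w x) (w y) = p₂.edge (e j).1.1 (e j).1.2 := by
    intro x y hne
    rcases le_total x y with h | h
    · let j : p₁.Edge := ⟨(x, y), h, hne⟩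
      exact ⟨j, rfl, by rw [← w1 j, ← w2 j]⟩
    · rw [p₁.edge_comm] at hne
      let j : p₁.Edge := ⟨(y, x), h, hne⟩
      exact ⟨j, p₁.edge_comm _ _, by rw [← w1 j, ← w2 j, p₂.edge_comm]⟩
  refine ⟨w, hw, fun x y => ⟨fun hne => ?_, fun hne => ?_⟩, key⟩
  · have back : ∀ x y, w x ≤ w y → p₂.edge (w x) (w y) ≠ 0 → p₁.edge x y ≠ 0 := by
      intro x y hle hne
      let k : p₂.Edge := ⟨(w x, w y), hle, hne⟩
      have h1 := w1 (e.symm k)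
      have h2 := w2 (e.symm k)
      rw [e.apply_symm_apply] at h1 h2
      rw [← w.injective h1, ← w.injective h2]
      exact (e.symm k).2.2
    rcases le_total (w x) (w y) with h | h
    · exact back x y h hne
    · rw [p₁.edge_comm]
      rw [p₂.edge_comm] at hne
      exact back y x h hne
  · obtain ⟨j, -, h⟩ := key x y hne
    rw [h]
    exact (e j).2.2

section Basic

variable {δ : Fˣ} {p : RookPair F P}

theorem RookPair.IsBasic.edge_eq (hp : p.IsBasic δ) {x y : Idx s n} (h : p.edge x y ≠ 0) :
    p.edge x y = 1 ∨ p.edge x y = δ := by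
  have key : ∀ x y, (h : (opp x, y) ∈ p.D) → p.edge x y = 1 ∨ p.edge x y = δ := by
    intro x y h
    rw [p.edge_of_mem h]
    by_cases hs : s = Series.C
    · rcases (hp.2 hs).1 ⟨_, h⟩ with e | e
      · exact Or.inl (by rw [e, Units.val_one])
      · exact Or.inr (by rw [e])
    · exact Or.inl (by rw [hp.1 hs, Units.val_one])
  rcases le_total x y with hxy | hxy
  · exact key x y ((p.edge_ne_zero_of_le hxy).1 h)
  · rw [p.edge_comm] at h ⊢
    exact key y x ((p.edge_ne_zero_of_le hxy).1 h)

theorem RookPair.IsBasic.eq_of_edge_eq (hδ : δ ≠ 1) (hp : p.IsBasic δ) {x y : Idx s n}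
    (h : p.edge x y = δ) : s = Series.C ∧ x = y := by
  have key : ∀ x y, (h : (opp x, y) ∈ p.D) → p.edge x y = δ → s = Series.C ∧ x = y := by
    intro x y h he
    rw [p.edge_of_mem h, Units.val_inj] at he
    by_cases hs : s = Series.C
    · have := (hp.2 hs).2.1 ⟨_, h⟩ he
      simp only [IsAntidiagonal, opp_opp] at this
      exact ⟨hs, this.symm⟩
    · rw [hp.1 hs] at he
      exact absurd he.symm hδ
  have hne : p.edge x y ≠ 0 := by
    rw [h]
    exact δ.ne_zero
  rcases le_total x y with hxy | hxy
  · exact key x y ((p.edge_ne_zero_of_le hxy).1 hne) h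
  · rw [p.edge_comm] at h hne
    obtain ⟨h1, h2⟩ := key y x ((p.edge_ne_zero_of_le hxy).1 hne) h
    exact ⟨h1, h2.symm⟩

theorem RookPair.IsBasic.eq_iff (hp : p.IsBasic δ) {x y : Idx s n} (h : p.edge x y ≠ 0) :
    x = y ↔ s = Series.C ∧ P.blk x = P.blk y := by
  constructor
  · rintro rfl
    exact ⟨p.eq_C_of_edge_self_ne_zero h, rfl⟩
  · rintro ⟨hs, hb⟩
    have key : ∀ x y, P.blk x = P.blk y → (opp x, y) ∈ p.D → x = y := by
      intro x y hb h
      have := ((hp.2 hs).2.2 (-P.blk x)).1 _ h (P.blk_opp x) (by rw [neg_neg, hb])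
      simp only [IsAntidiagonal, opp_opp] at this
      exact this.symm
    rcases le_total x y with hxy | hxy
    · exact key x y hb ((p.edge_ne_zero_of_le hxy).1 h)
    · rw [p.edge_comm] at h
      exact (key y x hb.symm ((p.edge_ne_zero_of_le hxy).1 h)).symm

theorem RookPair.IsBasic.unique (hp : p.IsBasic δ) (hs : s = Series.C) {x y : Idx s n}
    (hb : P.blk x = P.blk y) (hx : p.edge x x = δ) (hy : p.edge y y = δ) : x = y := by
  have mem : ∀ z, p.edge z z = δ → ∃ h : (opp z, z) ∈ p.D, p.φ ⟨_, h⟩ = δ := by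
    intro z hz
    have hne : p.edge z z ≠ 0 := by
      rw [hz]
      exact δ.ne_zero
    have h := (p.edge_ne_zero_of_le le_rfl).1 hne
    rw [p.edge_of_mem h, Units.val_inj] at hz
    exact ⟨h, hz⟩
  obtain ⟨h1, h1'⟩ := mem x hx
  obtain ⟨h2, h2'⟩ := mem y hy
  have := ((hp.2 hs).2.2 (-P.blk x)).2 (x := ⟨_, h1⟩) ⟨P.blk_opp x, (neg_neg _).symm, h1'⟩
    (y := ⟨_, h2⟩) ⟨by rw [hb]; exact P.blk_opp y, by rw [hb]; exact (neg_neg _).symm, h2'⟩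
  exact congrArg (fun z => z.1.2) this

end Basic

open Classical in
theorem card_edge_eq (h2 : (2 : F) ≠ 0) {δ : Fˣ} {p₁ p₂ : RookPair F P} (hp₁ : p₁.IsBasic δ)
    (hp₂ : p₂.IsBasic δ) {g : ContractedGL F P} (hg : g • p₁.form = p₂.form) (k l : ℤ) :
    (Finset.univ.filter fun j : Idx s n × Idx s n =>
      (j.1 ≤ j.2 ∧ p₁.edge j.1 j.2 ≠ 0) ∧ (P.blk j.1, P.blk j.2) = (k, l)).card =
    (Finset.univ.filter fun j : Idx s n × Idx s n =>
      (j.1 ≤ j.2 ∧ p₂.edge j.1 j.2 ≠ 0) ∧ (P.blk j.1, P.blk j.2) = (k, l)).card := by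
  have hrook : ∀ p : RookPair F P, ∀ x y z, symbol p.form x y ≠ 0 → symbol p.form x z ≠ 0 →
      y = z := fun p x y z hy hz =>
    p.edge_unique ((p.symbol_form_ne_zero h2).1 hy) ((p.symbol_form_ne_zero h2).1 hz)
  have hc := card_block_eq hg (hrook p₁) (hrook p₂) k l
  simp only [RookPair.symbol_form_ne_zero h2] at hc
  have blk_le : ∀ j : Idx s n × Idx s n, j.1 ≤ j.2 → P.blk j.1 ≤ P.blk j.2 := fun j h => P.mono h
  rcases lt_trichotomy k l with hkl | rfl | hkl
  · have e : ∀ p : RookPair F P, (Finset.univ.filter fun j : Idx s n × Idx s n =>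
        (j.1 ≤ j.2 ∧ p.edge j.1 j.2 ≠ 0) ∧ (P.blk j.1, P.blk j.2) = (k, l)) =
        Finset.univ.filter fun j : Idx s n × Idx s n =>
          (P.blk j.1, P.blk j.2) = (k, l) ∧ p.edge j.1 j.2 ≠ 0 := by
      intro p
      refine Finset.filter_congr fun j _ => ⟨fun h => ⟨h.2, h.1.2⟩, fun h => ⟨⟨?_, h.2⟩, h.1⟩⟩
      by_contra hc
      have := P.mono (le_of_not_ge hc)
      obtain ⟨h1, h3⟩ := Prod.mk.injEq .. ▸ h.1
      omega
    rw [e, e, hc]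
  · by_cases hs : s = Series.C
    · have e : ∀ p : RookPair F P, p.IsBasic δ → (Finset.univ.filter fun j : Idx s n × Idx s n =>
          (j.1 ≤ j.2 ∧ p.edge j.1 j.2 ≠ 0) ∧ (P.blk j.1, P.blk j.2) = (k, k)) =
          Finset.univ.filter fun j : Idx s n × Idx s n =>
            (P.blk j.1, P.blk j.2) = (k, k) ∧ p.edge j.1 j.2 ≠ 0 := by
        intro p hp
        refine Finset.filter_congr fun j _ => ⟨fun h => ⟨h.2, h.1.2⟩, fun h => ⟨⟨?_, h.2⟩, h.1⟩⟩
        have h1 := h.1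
        rw [Prod.mk.injEq] at h1
        exact ((hp.eq_iff h.2).2 ⟨hs, h1.1.trans h1.2.symm⟩).le
      rw [e p₁ hp₁, e p₂ hp₂, hc]
    · have e : ∀ p : RookPair F P, (Finset.univ.filter fun j : Idx s n × Idx s n =>
            (P.blk j.1, P.blk j.2) = (k, k) ∧ p.edge j.1 j.2 ≠ 0).card =
          2 * (Finset.univ.filter fun j : Idx s n × Idx s n =>
          (j.1 ≤ j.2 ∧ p.edge j.1 j.2 ≠ 0) ∧ (P.blk j.1, P.blk j.2) = (k, k)).card := by
        intro p
        rw [← Finset.card_filter_add_card_filter_not (fun j : Idx s n × Idx s n => j.1 ≤ j.2),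
          two_mul, Finset.filter_filter, Finset.filter_filter]
        congr 1
        · congr 1
          refine Finset.filter_congr fun j _ => ?_
          tauto
        · refine Finset.card_equiv (Equiv.prodComm _ _) fun j => ?_
          simp only [Finset.mem_filter, Finset.mem_univ, true_and, Equiv.prodComm_apply,
            Prod.fst_swap, Prod.snd_swap, Prod.mk.injEq]
          rw [p.edge_comm j.2 j.1]
          constructor
          · rintro ⟨⟨⟨h1, h3⟩, h4⟩, h5⟩
            exact ⟨⟨le_of_not_ge h5, h4⟩, h3, h1⟩
          · rintro ⟨⟨h1, h3⟩, h4, h5⟩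
            refine ⟨⟨⟨h5, h4⟩, h3⟩, fun h6 => ?_⟩
            have := le_antisymm h1 h6
            rw [this] at h3
            exact hs (p.eq_C_of_edge_self_ne_zero h3)
      rw [e, e] at hc
      omega
  · rw [Finset.filter_false_of_mem, Finset.filter_false_of_mem]
    · rintro j - ⟨⟨h, -⟩, h'⟩
      rw [Prod.mk.injEq] at h'
      have := blk_le j h
      omega
    · rintro j - ⟨⟨h, -⟩, h'⟩
      rw [Prod.mk.injEq] at h'
      have := blk_le j h
      omega

end

/-- The quadratic character of a finite field, with values in the units of `ℤ`. -/
def squareClass (F : Type*) [Field F] [Fintype F] [DecidableEq F] : Fˣ →* ℤˣ :=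
  (quadraticChar F).toUnitHom

theorem squareClass_eq_one {F : Type*} [Field F] [Fintype F] [DecidableEq F] {u : Fˣ}
    (h : IsSquare (u : F)) : squareClass F u = 1 := by
  apply Units.ext
  rw [squareClass, MulChar.coe_toUnitHom, Units.val_one]
  exact (quadraticChar_one_iff_isSquare u.ne_zero).2 h

theorem squareClass_eq_neg_one {F : Type*} [Field F] [Fintype F] [DecidableEq F] {u : Fˣ}
    (h : ¬IsSquare u) : squareClass F u = -1 := by
  apply Units.ext
  rw [squareClass, MulChar.coe_toUnitHom, Units.val_neg, Units.val_one,
    quadraticChar_neg_one_iff_not_isSquare]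
  rintro ⟨r, hr⟩
  have hr0 : r ≠ 0 := by
    rintro rfl
    rw [mul_zero] at hr
    exact u.ne_zero hr
  exact h ⟨Units.mk0 r hr0, Units.ext (by simpa using hr)⟩

variable {s : Series} {n : ℕ} {F : Type*} [Field F] {P : SymmetricPartition s n}

open Classical in
/-- If two symmetric monomial symbols in the same orbit differ by a permutation and a scaling of the
rows, the scaling factors of the rows above a given diagonal position multiply to a square. -/
theorem isSquare_prod_ratio {Λ₁ Λ₂ : Module.Dual F (nilradical F P)} {g : ContractedGL F P}
    (hg : g • Λ₁ = Λ₂) (h₁ : ∀ x y z, symbol Λ₁ x y ≠ 0 → symbol Λ₁ x z ≠ 0 → y = z)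
    {w : Equiv.Perm (Idx s n)} (hw : w ∈ leviWeylGroup P) {r : Idx s n → F}
    (hr : ∀ x y, symbol Λ₂ (w x) (w y) = r x * symbol Λ₁ x y) {i : Idx s n} (hi : P.blk i ≠ 0) :
    IsSquare (∏ x ∈ Finset.univ.filter fun x => ∃ y, P.Above i i x y ∧ symbol Λ₁ x y ≠ 0, r x) := by
  have te : ∀ (Λ : Module.Dual F (nilradical F P)) (x y : Idx s n),
      truncation P i i (symbol Λ) x y = if P.Above i i x y then symbol Λ x y else 0 :=
    fun _ _ _ => rfl
  have tne : ∀ (Λ : Module.Dual F (nilradical F P)) (x y : Idx s n),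
      truncation P i i (symbol Λ) x y ≠ 0 ↔ P.Above i i x y ∧ symbol Λ x y ≠ 0 := by
    intro Λ x y
    rw [te]
    by_cases h : P.Above i i x y <;> simp [h]
  have above_symm : ∀ x y, P.Above i i x y → P.Above i i y x := by
    intro x y h
    unfold SymmetricPartition.Above at h ⊢
    rw [pairDeg_comm y x]
    omega
  have above_w : ∀ x y, P.Above i i (w x) (w y) ↔ P.Above i i x y := by
    intro x y
    unfold SymmetricPartition.Above SymmetricPartition.deg SymmetricPartition.pairDeg
    rw [hw x, hw y]
  have := Matrix.isSquare_prod_of_congr (T := truncation P i i (symbol Λ₁))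
    (G := (truncatedMatrix i (g : ContractedAlgebra F P)).submatrix w id) (r := r)
    (fun x y z hy hz => h₁ x y z ((tne _ _ _).1 hy).2 ((tne _ _ _).1 hz).2)
    (fun x y h => (tne _ _ _).2 ⟨above_symm x y ((tne _ _ _).1 h).1,
      symbol_ne_zero_comm.2 ((tne _ _ _).1 h).2⟩)
    (fun x y => by
      have e := congrFun (congrFun (truncation_smul (Λ := Λ₁) g (k := i) (l := i) (by omega)) (w x))
        (w y)
      rw [hg, te] at e
      simp only [above_w] at e
      have e' : ((truncatedMatrix i (g : ContractedAlgebra F P)).submatrix w id *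
          truncation P i i (symbol Λ₁) *
          ((truncatedMatrix i (g : ContractedAlgebra F P)).submatrix w id).transpose) x y =
          (truncatedMatrix i (g : ContractedAlgebra F P) * truncation P i i (symbol Λ₁) *
            (truncatedMatrix i (g : ContractedAlgebra F P)).transpose) (w x) (w y) := rfl
      rw [e', ← e, te, hr]
      split_ifs <;> simp)
  simpa only [tne] using this

open Classical in
/-- In the symplectic case the number of roots `γ` in `I_k × I_{-k}` with `φ(γ) = δ` is determined
by the orbit. -/
theorem card_nonsquare_eq [Finite F] (hF : ringChar F ≠ 2) {δ : Fˣ} (hδ : ¬IsSquare δ)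
    (hs : s = Series.C) {p₁ p₂ : RookPair F P} (hp₁ : p₁.IsBasic δ) (hp₂ : p₂.IsBasic δ)
    {g : ContractedGL F P} (hg : g • p₁.form = p₂.form) {w : Equiv.Perm (Idx s n)}
    (hw : w ∈ leviWeylGroup P) (hne : ∀ x y, p₂.edge (w x) (w y) ≠ 0 ↔ p₁.edge x y ≠ 0) (k : ℤ) :
    (Finset.univ.filter fun x : Idx s n => P.blk x = k ∧ p₁.edge x x = δ).card =
    (Finset.univ.filter fun x : Idx s n => P.blk x = k ∧ p₂.edge x x = δ).card := by
  have := Fintype.ofFinite F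
  have h2 : (2 : F) ≠ 0 := Ring.two_ne_zero hF
  have empty : ∀ p : RookPair F P, (∀ x, P.blk x = k → P.blk x = 0) →
      (Finset.univ.filter fun x : Idx s n => P.blk x = k ∧ p.edge x x = δ).card = 0 := by
    intro p hk
    rw [Finset.card_eq_zero, Finset.filter_eq_empty_iff]
    rintro x - ⟨h1, h3⟩
    have := p.blk_ne_of_edge_ne_zero (x := x) (y := x) (by rw [h3]; exact δ.ne_zero)
    have := hk x h1
    omega
  by_cases hk : ∀ x, P.blk x = k → P.blk x = 0
  · rw [empty p₁ hk, empty p₂ hk]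
  push Not at hk
  obtain ⟨i, rfl, hi⟩ := hk
  have sne : ∀ (p : RookPair F P) {x y : Idx s n}, symbol p.form x y ≠ 0 ↔ p.edge x y ≠ 0 :=
    fun p => p.symbol_form_ne_zero h2
  have ssymm : ∀ (Λ : Module.Dual F (nilradical F P)) (x y : Idx s n),
      symbol Λ y x = symbol Λ x y := by
    intro Λ x y
    rw [symbol_symm, formSign, if_pos hs, one_mul]
  have hr : ∀ x, ∃ r : Fˣ, ∀ y, symbol p₂.form (w x) (w y) = r * symbol p₁.form x y := by
    intro x
    have zero : ∀ y, symbol p₁.form x y = 0 → symbol p₂.form (w x) (w y) = 0 := by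
      intro y h
      by_contra hc
      exact (sne p₁).2 ((hne x y).1 ((sne p₂).1 hc)) h
    by_cases h : ∃ y, symbol p₁.form x y ≠ 0
    · obtain ⟨y, hy⟩ := h
      have hy' : symbol p₂.form (w x) (w y) ≠ 0 := (sne p₂).2 ((hne x y).2 ((sne p₁).1 hy))
      refine ⟨Units.mk0 (symbol p₂.form (w x) (w y) / symbol p₁.form x y) (div_ne_zero hy' hy),
        fun z => ?_⟩
      by_cases hz : symbol p₁.form x z = 0
      · rw [zero z hz, hz, mul_zero]
      · obtain rfl := p₁.edge_unique ((sne p₁).1 hy) ((sne p₁).1 hz)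
        rw [Units.val_mk0, div_mul_cancel₀ _ hy]
    · push Not at h
      exact ⟨1, fun y => by rw [zero y (h y), h y, mul_zero]⟩
  choose r hr using hr
  have rsymm : ∀ x y, p₁.edge x y ≠ 0 → r x = r y := by
    intro x y h
    have e1 := hr x y
    have e2 := hr y x
    rw [ssymm _ (w x), ssymm _ x, e1] at e2
    exact Units.ext (mul_right_cancel₀ ((sne p₁).2 h) e2)
  set f : Idx s n → ℤˣ := fun x => if p₁.edge x x ≠ 0 then squareClass F (r x) else 1 with hf
  have above_symm : ∀ i x y : Idx s n, P.Above i i x y → P.Above i i y x := by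
    intro i x y h
    unfold SymmetricPartition.Above at h ⊢
    rw [pairDeg_comm y x]
    omega
  have total : ∀ i : Idx s n, P.blk i ≠ 0 →
      ∏ x ∈ Finset.univ.filter (fun x => P.Above i i x x), f x = 1 := by
    intro i hi
    set S := Finset.univ.filter fun x => ∃ y, P.Above i i x y ∧ symbol p₁.form x y ≠ 0 with hS
    have memS : ∀ x, x ∈ S ↔ ∃ y, P.Above i i x y ∧ p₁.edge x y ≠ 0 := by
      intro x
      simp only [hS, Finset.mem_filter, Finset.mem_univ, true_and, sne]
    have hsq := isSquare_prod_ratio hg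
      (fun x y z hy hz => p₁.edge_unique ((sne p₁).1 hy) ((sne p₁).1 hz)) hw hr hi
    rw [← hS] at hsq
    have h1 : ∏ x ∈ S, squareClass F (r x) = 1 := by
      rw [← map_prod]
      apply squareClass_eq_one
      rw [Units.coe_prod]
      exact hsq
    rw [← Finset.prod_filter_mul_prod_filter_not S (fun x => p₁.edge x x ≠ 0)] at h1
    have h3 : ∏ x ∈ S.filter (fun x => ¬p₁.edge x x ≠ 0), squareClass F (r x) = 1 := by
      choose! σ hσ using fun x (hx : x ∈ S) => (memS x).1 hx
      have hσ' : ∀ x ∈ S.filter (fun x => ¬p₁.edge x x ≠ 0), P.Above i i x (σ x) ∧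
          p₁.edge x (σ x) ≠ 0 ∧ σ x ≠ x ∧ σ x ∈ S ∧ p₁.edge (σ x) (σ x) = 0 := by
        intro x hx
        obtain ⟨hxS, hx0⟩ := Finset.mem_filter.1 hx
        obtain ⟨a1, a2⟩ := hσ x hxS
        have a2' := a2
        rw [p₁.edge_comm] at a2'
        refine ⟨a1, a2, fun h => ?_, (memS _).2 ⟨x, above_symm _ _ _ a1, a2'⟩, ?_⟩
        · rw [h] at a2
          exact hx0 a2
        · by_contra hc
          have := p₁.edge_unique a2' hc
          rw [← this] at a2
          exact hx0 a2
      refine Finset.prod_involution (fun x _ => σ x) ?_ ?_ ?_ ?_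
      · intro x hx
        rw [← rsymm x (σ x) (hσ' x hx).2.1]
        exact Int.units_mul_self _
      · intro x hx _
        exact (hσ' x hx).2.2.1
      · intro x hx
        exact Finset.mem_filter.2 ⟨(hσ' x hx).2.2.2.1, not_not.2 (hσ' x hx).2.2.2.2⟩
      · intro x hx
        have a := (hσ' x hx).2.1
        rw [p₁.edge_comm] at a
        exact p₁.edge_unique (hσ _ (hσ' x hx).2.2.2.1).2 a
    rw [h3, mul_one] at h1
    rw [hf, ← Finset.prod_filter, Finset.filter_filter, ← h1]
    refine Finset.prod_congr ?_ fun _ _ => rfl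
    ext x
    simp only [Finset.mem_filter, Finset.mem_univ, true_and, memS]
    constructor
    · rintro ⟨a, b⟩
      exact ⟨⟨x, a, b⟩, b⟩
    · rintro ⟨⟨y, a, b⟩, c⟩
      rw [p₁.edge_unique b c] at a
      exact ⟨a, c⟩
  have block := prod_fiber_eq_one P.blk (fun x y => P.Above x x y y) (fun x => P.pairLen x x)
    (fun x => P.blk x ≠ 0) f
    (by
      intro x y h
      simp [SymmetricPartition.Above, SymmetricPartition.deg, SymmetricPartition.pairDeg, h])
    (by
      intro x y h
      rcases len_lt_or_blk_eq_of_deg h with h | h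
      · exact Or.inr h
      · exact Or.inl h.1)
    (by
      intro x y z h hyz
      unfold SymmetricPartition.Above SymmetricPartition.deg SymmetricPartition.pairDeg at h ⊢
      rwa [← hyz])
    (fun x y hx h => by
      have := Above.blk_ne h (by omega)
      omega)
    total i hi
  have hδ1 : (δ : F) ≠ 1 := fun h => hδ ⟨1, Units.ext (by simpa using h)⟩
  have hfx : ∀ x, P.blk x ≠ 0 → f x = (if p₁.edge x x = δ then -1 else 1) *
      (if p₂.edge (w x) (w x) = δ then -1 else 1) := by
    intro x hx
    by_cases h : p₁.edge x x = 0
    · have h' : p₂.edge (w x) (w x) = 0 := by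
        by_contra hc
        exact (hne x x).1 hc h
      simp [hf, h, h', δ.ne_zero.symm]
    · have h' := (hne x x).2 h
      have e := hr x x
      have hsg : sgn F (w x) = sgn F x := sgn_eq_of_blk_eq (hw x) (by rw [hw x]; exact hx)
      rw [p₁.symbol_form_eq, p₂.symbol_form_eq, edgeSign_self hs, edgeSign_self hs, hsg] at e
      have e1 : p₂.edge (w x) (w x) = r x * p₁.edge x x := by
        apply mul_left_cancel₀ (mul_ne_zero h2 (sgn_ne_zero (F := F) x))
        linear_combination e
      have hfx : f x = squareClass F (r x) := if_pos h
      rw [hfx]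
      rcases hp₁.edge_eq h with c1 | c1 <;> rcases hp₂.edge_eq h' with c2 | c2 <;>
        rw [c1, c2] at e1 <;> rw [c1, c2]
      · have : r x = 1 := Units.ext (by rw [Units.val_one]; linear_combination -e1)
        simp [this, hδ1.symm]
      · have : r x = δ := Units.ext (by linear_combination -e1)
        simp [this, hδ1.symm, squareClass_eq_neg_one hδ]
      · have : r x * δ = 1 := Units.ext (by simpa using e1.symm)
        have := congrArg (squareClass F) this
        rw [map_mul, map_one, squareClass_eq_neg_one hδ] at this
        simp only [hδ1.symm, if_true, if_false]
        rw [mul_one]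
        rw [mul_neg_one] at this
        rw [← this, neg_neg]
      · have : r x = 1 := Units.ext (by
          rw [Units.val_one]
          exact mul_right_cancel₀ δ.ne_zero (by rw [← e1, one_mul]))
        simp [this]
  rw [Finset.prod_congr rfl fun x hx => hfx x (by
    rw [(Finset.mem_filter.1 hx).2]
    exact hi), Finset.prod_mul_distrib, Finset.prod_ite, Finset.prod_ite] at block
  simp only [Finset.prod_const, one_pow, mul_one, Finset.filter_filter] at block
  have e2 : (Finset.univ.filter fun x : Idx s n =>
      P.blk x = P.blk i ∧ p₂.edge (w x) (w x) = δ).card =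
      (Finset.univ.filter fun x : Idx s n => P.blk x = P.blk i ∧ p₂.edge x x = δ).card := by
    refine Finset.card_equiv w fun x => ?_
    simp only [Finset.mem_filter, Finset.mem_univ, true_and]
    rw [hw x]
  rw [e2] at block
  have le1 : ∀ p : RookPair F P, p.IsBasic δ →
      (Finset.univ.filter fun x : Idx s n => P.blk x = P.blk i ∧ p.edge x x = δ).card ≤ 1 := by
    intro p hp
    rw [Finset.card_le_one]
    intro x hx y hy
    simp only [Finset.mem_filter, Finset.mem_univ, true_and] at hx hy
    exact hp.unique hs (hx.1.trans hy.1.symm) hx.2 hy.2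
  have l1 := le1 p₁ hp₁
  have l2 := le1 p₂ hp₂
  generalize (Finset.univ.filter fun x : Idx s n =>
    P.blk x = P.blk i ∧ p₁.edge x x = δ).card = a at *
  generalize (Finset.univ.filter fun x : Idx s n =>
    P.blk x = P.blk i ∧ p₂.edge x x = δ).card = b at *
  interval_cases a <;> interval_cases b <;> simp at block ⊢

open Classical in
theorem exists_perm_of_smul_form_eq [Finite F] (hF : ringChar F ≠ 2) {δ : Fˣ} (hδ : ¬IsSquare δ)
    {p₁ p₂ : RookPair F P} (hp₁ : p₁.IsBasic δ) (hp₂ : p₂.IsBasic δ) {g : ContractedGL F P}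
    (hg : g • p₁.form = p₂.form) :
    ∃ w ∈ leviWeylGroup P, ∀ x y, p₂.edge (w x) (w y) = p₁.edge x y := by
  have h2 : (2 : F) ≠ 0 := Ring.two_ne_zero hF
  have hδ1 := ne_one_of_not_isSquare hδ
  have hloop : ∀ (e : p₁.Edge ≃ p₂.Edge), (∀ j, (P.blk (e j).1.1, P.blk (e j).1.2) =
      (P.blk j.1.1, P.blk j.1.2)) → ∀ j, (e j).1.1 = (e j).1.2 ↔ j.1.1 = j.1.2 := by
    intro e he j
    have := he j
    rw [Prod.mk.injEq] at this
    rw [hp₁.eq_iff j.2.2, hp₂.eq_iff (e j).2.2, this.1, this.2]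
  obtain ⟨e, he⟩ := exists_equiv_of_card_eq
    (fun j : Idx s n × Idx s n => j.1 ≤ j.2 ∧ p₁.edge j.1 j.2 ≠ 0)
    (fun j : Idx s n × Idx s n => j.1 ≤ j.2 ∧ p₂.edge j.1 j.2 ≠ 0)
    (fun j => (P.blk j.1, P.blk j.2)) (fun j => (P.blk j.1, P.blk j.2))
    (fun c => card_edge_eq h2 hp₁ hp₂ hg c.1 c.2)
  obtain ⟨w, hw, hne, -⟩ := exists_perm_of_edge_equiv e
    (fun j => Prod.mk.injEq .. ▸ he j) (hloop e he)
  have hloops : ∀ k, (Finset.univ.filter fun x : Idx s n => P.blk x = k ∧ p₁.edge x x = δ).card =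
      (Finset.univ.filter fun x : Idx s n => P.blk x = k ∧ p₂.edge x x = δ).card := by
    intro k
    by_cases hs : s = Series.C
    · exact card_nonsquare_eq hF hδ hs hp₁ hp₂ hg hw hne k
    · rw [Finset.filter_false_of_mem, Finset.filter_false_of_mem]
      · exact fun x _ h => hs (hp₂.eq_of_edge_eq hδ1 h.2).1
      · exact fun x _ h => hs (hp₁.eq_of_edge_eq hδ1 h.2).1
  have cardδ : ∀ p : RookPair F P, p.IsBasic δ → ∀ k l : ℤ,
      (Finset.univ.filter fun j : Idx s n × Idx s n => (j.1 ≤ j.2 ∧ p.edge j.1 j.2 ≠ 0) ∧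
        (P.blk j.1, P.blk j.2, p.edge j.1 j.2) = (k, l, (δ : F))).card =
      if k = l then
        (Finset.univ.filter fun x : Idx s n => P.blk x = k ∧ p.edge x x = δ).card else 0 := by
    intro p hp k l
    split_ifs with hkl
    · subst hkl
      symm
      refine Finset.card_bij (fun x _ => (x, x)) ?_ ?_ ?_
      · intro x hx
        simp only [Finset.mem_filter, Finset.mem_univ, true_and, Prod.mk.injEq] at hx ⊢
        refine ⟨⟨le_rfl, ?_⟩, hx.1, hx.1, hx.2⟩
        rw [hx.2]
        exact δ.ne_zero
      · intro x _ y _ h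
        exact congrArg Prod.fst h
      · rintro ⟨x, y⟩ hj
        simp only [Finset.mem_filter, Finset.mem_univ, true_and, Prod.mk.injEq] at hj
        obtain ⟨-, h1, -, h3⟩ := hj
        obtain rfl := (hp.eq_of_edge_eq hδ1 h3).2
        exact ⟨x, by simp [h1, h3], rfl⟩
    · rw [Finset.card_eq_zero, Finset.filter_eq_empty_iff]
      rintro ⟨x, y⟩ - ⟨-, h⟩
      simp only [Prod.mk.injEq] at h
      obtain ⟨h1, h3, h4⟩ := h
      obtain rfl := (hp.eq_of_edge_eq hδ1 h4).2
      exact hkl (h1.symm.trans h3)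
  have hδ1' : (δ : F) ≠ 1 := fun h => hδ1 (Units.ext h)
  have split : ∀ p : RookPair F P, p.IsBasic δ → ∀ k l : ℤ,
      (Finset.univ.filter fun j : Idx s n × Idx s n =>
        (j.1 ≤ j.2 ∧ p.edge j.1 j.2 ≠ 0) ∧ (P.blk j.1, P.blk j.2) = (k, l)).card =
      (Finset.univ.filter fun j : Idx s n × Idx s n => (j.1 ≤ j.2 ∧ p.edge j.1 j.2 ≠ 0) ∧
        (P.blk j.1, P.blk j.2, p.edge j.1 j.2) = (k, l, (δ : F))).card +
      (Finset.univ.filter fun j : Idx s n × Idx s n => (j.1 ≤ j.2 ∧ p.edge j.1 j.2 ≠ 0) ∧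
        (P.blk j.1, P.blk j.2, p.edge j.1 j.2) = (k, l, (1 : F))).card := by
    intro p hp k l
    rw [← Finset.card_filter_add_card_filter_not
      (fun j : Idx s n × Idx s n => p.edge j.1 j.2 = δ), Finset.filter_filter,
      Finset.filter_filter]
    congr 2
    · refine Finset.filter_congr fun j _ => ?_
      simp only [Prod.mk.injEq]
      tauto
    · refine Finset.filter_congr fun j _ => ?_
      simp only [Prod.mk.injEq]
      constructor
      · rintro ⟨⟨h1, h3, h4⟩, h5⟩
        exact ⟨h1, h3, h4, (hp.edge_eq h1.2).resolve_right h5⟩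
      · rintro ⟨h1, h3, h4, h5⟩
        refine ⟨⟨h1, h3, h4⟩, ?_⟩
        rw [h5]
        exact hδ1'.symm
  obtain ⟨e', he'⟩ := exists_equiv_of_card_eq
    (fun j : Idx s n × Idx s n => j.1 ≤ j.2 ∧ p₁.edge j.1 j.2 ≠ 0)
    (fun j : Idx s n × Idx s n => j.1 ≤ j.2 ∧ p₂.edge j.1 j.2 ≠ 0)
    (fun j => (P.blk j.1, P.blk j.2, p₁.edge j.1 j.2))
    (fun j => (P.blk j.1, P.blk j.2, p₂.edge j.1 j.2)) (by
      rintro ⟨k, l, v⟩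
      have hcδ := (cardδ p₁ hp₁ k l).trans
        ((if_congr Iff.rfl (hloops k) rfl).trans (cardδ p₂ hp₂ k l).symm)
      by_cases hv : v = δ
      · rw [hv]
        exact hcδ
      by_cases hv1 : v = 1
      · rw [hv1]
        have h1 := split p₁ hp₁ k l
        have h3 := split p₂ hp₂ k l
        have h4 := card_edge_eq h2 hp₁ hp₂ hg k l
        omega
      · have none : ∀ p : RookPair F P, p.IsBasic δ → ∀ j : Idx s n × Idx s n,
            ¬((j.1 ≤ j.2 ∧ p.edge j.1 j.2 ≠ 0) ∧
              (P.blk j.1, P.blk j.2, p.edge j.1 j.2) = (k, l, v)) := by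
          rintro p hp j ⟨⟨-, h1⟩, h3⟩
          simp only [Prod.mk.injEq] at h3
          rcases hp.edge_eq h1 with h | h
          · exact hv1 (h3.2.2.symm.trans h)
          · exact hv (h3.2.2.symm.trans h)
        rw [Finset.filter_false_of_mem fun j _ => none p₁ hp₁ j,
          Finset.filter_false_of_mem fun j _ => none p₂ hp₂ j])
  have he'' : ∀ j, P.blk (e' j).1.1 = P.blk j.1.1 ∧ P.blk (e' j).1.2 = P.blk j.1.2 ∧
      p₂.edge (e' j).1.1 (e' j).1.2 = p₁.edge j.1.1 j.1.2 := by
    intro j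
    have := he' j
    simpa only [Prod.mk.injEq] using this
  obtain ⟨w', hw', hne', hval⟩ := exists_perm_of_edge_equiv e'
    (fun j => ⟨(he'' j).1, (he'' j).2.1⟩)
    (hloop e' fun j => Prod.ext (he'' j).1 (he'' j).2.1)
  refine ⟨w', hw', fun x y => ?_⟩
  by_cases h : p₁.edge x y = 0
  · rw [h]
    by_contra hc
    exact (hne' x y).1 hc h
  · obtain ⟨j, h1, h3⟩ := hval x y h
    rw [h1, h3, (he'' j).2.2]

end ParabolicContraction

end

open ParabolicContraction in
theorem mainTheorem7 {F : Type*} [Field F] [Finite F] (hF : ringChar F ≠ 2)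
    (δ : Fˣ) (hδ : ¬ IsSquare δ) (s : Series) (n : ℕ) (P : SymmetricPartition s n) :
    (∀ Λ : Module.Dual F (nilradical F P), ∃ p : RookPair F P, p.IsBasic δ ∧
      p.form ∈ MulAction.orbit (ContractedGL F P) Λ) ∧
    (∀ p₁ p₂ : RookPair F P, p₁.IsBasic δ → p₂.IsBasic δ →
      (MulAction.orbit (ContractedGL F P) p₁.form = MulAction.orbit (ContractedGL F P) p₂.form ↔
        p₁.WeylConj p₂)) := by
  have h2 : (2 : F) ≠ 0 := Ring.two_ne_zero hF
  refine ⟨fun Λ => ?_, fun p₁ p₂ hp₁ hp₂ => ?_⟩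
  · obtain ⟨g, hg⟩ := exists_isNormalSymbol hF hδ Λ
    obtain ⟨p, hp, hpΛ⟩ := exists_isBasic_of_isNormalSymbol h2 hδ hg
    exact ⟨p, hp, g, hpΛ.symm⟩
  · rw [RookPair.weylConj_iff]
    constructor
    · intro h
      obtain ⟨g, hg⟩ : p₂.form ∈ MulAction.orbit (ContractedGL F P) p₁.form := by
        rw [h]
        exact MulAction.mem_orbit_self _
      exact exists_perm_of_smul_form_eq hF hδ hp₁ hp₂ hg
    · rintro ⟨w, hw, h⟩
      obtain ⟨g, hg⟩ := exists_smul_form_eq h2 hw h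
      rw [← hg]
      exact (MulAction.orbit_eq_iff.2 ⟨g, rfl⟩).symm
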